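/- Let $k$ be a field, $n\ge 0$, and let $\{f_1,\dots,f_s\}$ be a finite reduced Gröbner basis, with respect to the degree-lexicographic order $\prec$ with $x_1\succ\dots\succ x_n$, of the ideal $\mathfrak a=\langle f_1,\dots,f_s\rangle$ generated by it, where $\mathfrak a$ is either (N) a two-sided ideal of $k\langle x_1,\dots,x_n\rangle$ or (C) an ideal of $k[x_1,\dots,x_n]$. Let $A$ be the quotient algebra, $\mathcal G$ the set of standard monomials of degree $\ge 1$ (so $\mathcal G\cup\{1\}$ is a $k$-basis of $A$ if $A\neq0$), and $A^e=A\otimes_kA^{op}$, acting on $A$ by $(a\otimes b)x=axb$. **The complex.** The normalized Hochschild (two-sided Bar) resolution is the complex of free $A^e$-modules with basis the tuples (cells) $[w_1|\dots|w_l]$, $w_i\in\mathcal G$, in degree $l\ge 0$, and differential $$\partial[w_1|\dots|w_l]=(w_1\otimes1)[w_2|\dots|w_l]+\sum_{j=1}^{l-1}(-1)^j\sum_{v\in\mathcal G}a_{j,v}[w_1|\dots|w_{j-1}|v|w_{j+2}|\dots|w_l]+(-1)^l(1\otimes w_l)[w_1|\dots|w_{l-1}],$$ where $w_jw_{j+1}=a_{j,1}+\sum_{v\in\mathcal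 G}a_{j,v}v$ in $A$ (if $w_jw_{j+1}\in\mathcal G$, this is the trivial representation $v=w_jw_{j+1}$). Write $[c:c']$ for the coefficient of $c'$ in $\partial c$, and draw an edge $c\to c'$ if $[c:c']\ne0$. **The matching.** Let $B^0$ be the set of all cells. Given $B^{j-1}$, let $\mathcal M_j$ be the set of pairs $[p|u_1|u_2|q]\to[p|w_j|q]$ of cells in $B^{j-1}$, with $p=(w_1,\dots,w_{j-1})$ and $w_j=u_1u_2$, such that $u_1$ is the $\prec$-maximal monomial among those $u$ for which $w_j=uv$ with $[p|u|v|q]\in B^{j-1}$, while no proper prefix (in case (C): proper divisor) $u'$ of $u$ has this property. Let $B^j$ be the set of cells of $B^{j-1}$ that lie in no pair of $\mathcal M_j$, and put $\mathcal M=\bigcup_{j\ge1}\mathcal M_j$. A cell in no pair of $\mathcal M$ is called critical. **The complex $F_\bullet$.** Let $G_{\mathcal M}$ be the directed graph obtained by reversing the edges in $\mathcal M$; an unreversed edge $c\to c'$ has weight $[c:c']$, a reversed edge $c'\to c$ has weight $-[c:c']^{-1}$, and the weight of a path is the ordered product of the weights of its steps. Let $F_i$ be the free $A^e$-module on the critical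 cells of degree $i$, and $\partial e=\sum_f[e:f]_{\mathcal M}\,f$, where $[e:f]_{\mathcal M}$ is the sum of the weights of all paths from $e$ to $f$ in $G_{\mathcal M}$. **Reductions.** A contraction replaces a cell $[w_1|\dots|w_l]$ by a cell $[w_1|\dots|w_{j-1}|v|w_{j+2}|\dots|w_l]$ with $a_{j,v}\neq0$. A reduction of Type I is a passage from $c$ to some $c_2\ne c$ by a contraction $c\rightsquigarrow c'$ followed by a reversed edge $c'\to c_2$ of $\mathcal M$. A reduction of Type II is a contraction to a critical cell. We say that no reduction of Type II occurs if no sequence of Type I reductions that starts at a critical cell can be followed by a reduction of Type II. **Theorem.** In both cases (N) and (C): 1. $\mathcal M$ is an acyclic matching on the normalized Hochschild complex: its pairs are edges, each cell lies in at most one of them, their coefficients are central units, and $G_{\mathcal M}$ has no directed cycles. Only finitely many paths of $G_{\mathcal M}$ start at a given cell, so $\partial$ is well defined. In case (N) the critical cells are exactly the fully attached tuples: $[\,]$, $[x_i]$ with $x_i\in\mathcal G$, and $[u_1|v_1t_1|v_2t_2|\dots|v_rt_r]$, $r\geq 1$, with entries in $\mathcal G$, where $|u_1|=1$, every $u_jv_jt_j$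 is a minimal generator of the initial ideal of $\mathfrak a$, $u_{j+1}=t_j$, and $v_jt_jq\in\mathcal G$ for each proper prefix $q$ of $v_{j+1}t_{j+1}$. 2. $(F_\bullet,\partial)$ is a free resolution of $A$ as an $A\otimes A^{op}$-module, with augmentation $F_0\to A$, $[\,]\mapsto 1$. 3. If no reduction of Type II occurs, then $(F_\bullet,\partial)$ is minimal, that is, $\partial F_{i+1}\subseteq\mathfrak m F_i$ for all $i\ge0$, where $\mathfrak m\subseteq A\otimes A^{op}$ is the ideal generated by all $x_i\otimes1$ and $1\otimes x_i$. -/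

import Mathlib

universe u

open scoped TensorProduct

noncomputable section


/-! ### Algebraic discrete Morse theory on a weighted directed graph -/

namespace AlgMorse

variable {V R : Type*} [Ring R]

/-- The based complex is given by the matrix `wt c c' = [c : c']` of its differential and by the
homological degree `deg`; `c ⟶ c'` is an edge iff `c'` is one degree lower and `[c : c'] ≠ 0`. -/
def Edge (deg : V → ℕ) (wt : V → V → R) (c c' : V) : Prop :=
  deg c = deg c' + 1 ∧ wt c c' ≠ 0

/-- Edges of the graph `G_M`: the edges of `M` are reversed, the other ones are kept. -/
def MEdge (deg : V → ℕ) (wt : V → V → R) (M : Set (V × V)) (c c' : V) : Prop :=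
  (Edge deg wt c c' ∧ (c, c') ∉ M) ∨ (Edge deg wt c' c ∧ (c', c) ∈ M)

structure IsAcyclicMatching (deg : V → ℕ) (wt : V → V → R) (M : Set (V × V)) : Prop where
  edge : ∀ e ∈ M, Edge deg wt e.1 e.2
  matching : ∀ e ∈ M, ∀ e' ∈ M,
    (e.1 = e'.1 ∨ e.1 = e'.2 ∨ e.2 = e'.1 ∨ e.2 = e'.2) → e = e'
  central : ∀ e ∈ M, wt e.1 e.2 ∈ Subring.center R
  invertible : ∀ e ∈ M, IsUnit (wt e.1 e.2)
  acyclic : ∀ c, ¬ Relation.TransGen (MEdge deg wt M) c c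

/-- The critical vertices: those that lie in no edge of `M`. -/
def Critical (M : Set (V × V)) (c : V) : Prop := ∀ e ∈ M, e.1 ≠ c ∧ e.2 ≠ c

/-- The weight of one step of `G_M`. -/
def stepWeight (deg : V → ℕ) (wt : V → V → R) (c c' : V) : R :=
  open Classical in if deg c < deg c' then - Ring.inverse (wt c' c) else wt c c'

/-- The weight of a path, as the ordered product of the weights of its steps. -/
def pathWeight (deg : V → ℕ) (wt : V → V → R) : List V → R
  | [] => 1
  | [_] => 1
  | c :: c' :: p => stepWeight deg wt c c' * pathWeight deg wt (c' :: p)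

/-- All paths of `G_M` that start at `c` (as lists of vertices). -/
def pathsFrom (deg : V → ℕ) (wt : V → V → R) (M : Set (V × V)) (c : V) : Set (List V) :=
  {p | p.head? = some c ∧ p.IsChain (MEdge deg wt M)}

/-- All paths of `G_M` from `c` to `c'`. -/
def paths (deg : V → ℕ) (wt : V → V → R) (M : Set (V × V)) (c c' : V) : Set (List V) :=
  {p | p ∈ pathsFrom deg wt M c ∧ p.getLast? = some c'}

/-- `Γ(c, c')`, the sum of the weights of all paths from `c` to `c'`. -/
def Gam (deg : V → ℕ) (wt : V → V → R) (M : Set (V × V)) (c c' : V) : R :=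
  ∑ᶠ p ∈ paths deg wt M c c', pathWeight deg wt p

/-- The critical vertices of degree `i`. -/
def CritCell (deg : V → ℕ) (M : Set (V × V)) (i : ℕ) : Type _ :=
  {c : V // Critical M c ∧ deg c = i}

/-- The differential of the Morse complex, `e ↦ ∑_f Γ(e, f) f`. -/
def morseD (deg : V → ℕ) (wt : V → V → R) (M : Set (V × V)) (i : ℕ) :
    (CritCell deg M (i + 1) →₀ R) →ₗ[R] (CritCell deg M i →₀ R) :=
  Finsupp.linearCombination R fun e =>
    ∑ᶠ f : CritCell deg M i, Finsupp.single f (Gam deg wt M e.1 f.1)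

end AlgMorse

/-! ### Free resolutions -/

/-- `⋯ → F 2 → F 1 → F 0 → N → 0` is exact and all `F i` are free. -/
structure IsFreeRes (R : Type*) [Ring R] {N : Type*} [AddCommGroup N] [Module R N]
    (F : ℕ → Type*) [∀ i, AddCommGroup (F i)] [∀ i, Module R (F i)]
    (d : ∀ i, F (i + 1) →ₗ[R] F i) (ε : F 0 →ₗ[R] N) : Prop where
  free : ∀ i, Module.Free R (F i)
  exact : ∀ i, Function.Exact (d (i + 1)) (d i)
  exact_zero : Function.Exact (d 0) ε
  surjective : Function.Surjective ε

/-! ### The normalized acyclic Hochschild complex of an algebra with standard monomials -/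

/-- The ring `A ⊗ A^op`. -/
abbrev Env (k A : Type*) [Field k] [Ring A] [Algebra k A] : Type _ := A ⊗[k] Aᵐᵒᵖ

/-- `A` as an `A ⊗ A^op`-module: `(a ⊗ b) • x = a * x * b`. -/
instance Env.instModule (k A : Type*) [Field k] [Ring A] [Algebra k A] : Module (Env k A) A :=
  TensorProduct.Algebra.module

theorem Env.tmul_smul {k A : Type*} [Field k] [Ring A] [Algebra k A] (a b x : A) :
    ((a ⊗ₜ[k] MulOpposite.op b : Env k A) • x : A) = a * x * b := by
  change a • (MulOpposite.op b • x) = _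
  simp [mul_assoc]

/-- The monomials of an algebra `A` presented by a Gröbner basis: their residue classes in `A`, the
set `G` of standard monomials of degree at least one, and the monomial order. -/
structure StdMonomials (k A Mon : Type*) [Field k] [Ring A] [Algebra k A] [Monoid Mon] where
  val : Mon →* A
  G : Set Mon
  lt : Mon → Mon → Prop

namespace StdMonomials

variable {k A Mon : Type*} [Field k] [Ring A] [Algebra k A] [Monoid Mon]
  (D : StdMonomials k A Mon)

/-- `r` writes `a` as a linear combination of standard monomials (the monomial `1` included). -/
def IsRepr (a : A) (r : Mon →₀ k) : Prop :=
  (∀ v ∈ r.support, v ∈ D.G ∨ v = 1) ∧ r.sum (fun v t => t • D.val v) = a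

/-- The coefficients of `a` in the basis `G ∪ {1}` of `A`. -/
def repr (a : A) : Mon →₀ k :=
  open Classical in if h : ∃ r, D.IsRepr a r then h.choose else 0

/-- The basis elements `[w₁|…|w_l]`, `w_i ∈ G`, of the normalized Hochschild complex. -/
def Cell : Type _ := {c : List Mon // ∀ w ∈ c, w ∈ D.G}

/-- The homological degree. -/
def deg (c : D.Cell) : ℕ := c.1.length

/-- `∑_v a_v [p|v|s]`, where `∑_v a_v v` represents `w`. -/
def contraction (p : List Mon) (w : Mon) (s : List Mon) : List Mon →₀ Env k A :=
  (D.repr (D.val w)).sum fun v a => Finsupp.single (p ++ [v] ++ s) (algebraMap k (Env k A) a)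

/-- `∂[w₁|…|w_l] = (w₁ ⊗ 1)[w₂|…|w_l] + ∑_j (-1)^j [w₁|…|w_j w_{j+1}|…|w_l]
+ (-1)^l (1 ⊗ w_l)[w₁|…|w_{l-1}]`, with the products written in the basis `G ∪ {1}`. Tuples with
an entry `1` have to be omitted; they are not cells, so `bdCoeff` does not see them. -/
def boundary : List Mon → (List Mon →₀ Env k A)
  | [] => 0
  | w :: t =>
      Finsupp.single t (D.val w ⊗ₜ[k] 1)
      + ∑ j ∈ Finset.range t.length,
          ((-1 : Env k A) ^ (j + 1)) •
            D.contraction ((w :: t).take j) ((w :: t).getD j 1 * (w :: t).getD (j + 1) 1)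
              ((w :: t).drop (j + 2))
      + Finsupp.single ((w :: t).dropLast)
          ((-1 : Env k A) ^ (t.length + 1) *
            (1 ⊗ₜ[k] MulOpposite.op (D.val ((w :: t).getLastD 1))))

/-- The coefficient `[c : c']` of the differential of the normalized Hochschild complex. -/
def bdCoeff (c c' : D.Cell) : Env k A := D.boundary c.1 c'.1

/-! ### The matching

In a monoid of words `u ∣ w` means that `u` is a prefix of `w`, in a commutative monoid of
monomials it is divisibility. -/

/-- `w = u v` with `[p|u|v|s] ∈ B`. -/
def Splits (B : Set D.Cell) (p s : List Mon) (w u : Mon) : Prop :=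
  ∃ v, u * v = w ∧ ∃ c ∈ B, c.1 = p ++ [u, v] ++ s

/-- `u` splits `w`, and no proper divisor (prefix) of `u` does. -/
def MinSplits (B : Set D.Cell) (p s : List Mon) (w u : Mon) : Prop :=
  D.Splits B p s w u ∧ ∀ u', u' ∣ u → u' ≠ u → ¬ D.Splits B p s w u'

/-- `u` is the largest one among the minimal splittings of `w`. (For words, the minimal splitting
is unique.) -/
def Chosen (B : Set D.Cell) (p s : List Mon) (w u : Mon) : Prop :=
  D.MinSplits B p s w u ∧ ∀ u', D.MinSplits B p s w u' → ¬ D.lt u u'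

/-- The edges `[p|u|v|s] ⟶ [p|uv|s]` between elements of `B` that satisfy the matching condition
in the coordinate `j + 1`, where `j` is the length of `p`. For `j = 0` and `B` the set of all cells,
the minimal `u` are variables, and `u` is the largest variable that divides `w = uv` (for words: the
first letter of `w`). -/
def matchAt (B : Set D.Cell) (j : ℕ) : Set (D.Cell × D.Cell) :=
  {e | e.1 ∈ B ∧ e.2 ∈ B ∧ ∃ p s : List Mon, ∃ u v : Mon, p.length = j ∧
    e.1.1 = p ++ [u, v] ++ s ∧ e.2.1 = p ++ [u * v] ++ s ∧ D.Chosen B p s (u * v) u}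

/-- The cells that are still critical after the matchings in the first `j` coordinates. -/
def critAfter : ℕ → Set D.Cell
  | 0 => Set.univ
  | j + 1 => {c | c ∈ critAfter j ∧ AlgMorse.Critical (D.matchAt (critAfter j) j) c}

/-- The union of the matchings in all coordinates. -/
def matching : Set (D.Cell × D.Cell) := ⋃ j, D.matchAt (D.critAfter j) j

/-- The critical cells. -/
def Crit (c : D.Cell) : Prop := AlgMorse.Critical D.matching c

/-! ### The complex `F` -/

/-- `F_i`, the free `A ⊗ A^op`-module on the critical cells of degree `i`. -/
abbrev F (i : ℕ) : Type _ := AlgMorse.CritCell D.deg D.matching i →₀ Env k A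

/-- The differential `e ↦ ∑_f [e : f] f` of `F`, where `[e : f]` is the sum of the weights of all
paths from `e` to `f` in the graph of the matching. -/
def d (i : ℕ) : D.F (i + 1) →ₗ[Env k A] D.F i :=
  AlgMorse.morseD D.deg D.bdCoeff D.matching i

/-- The augmentation `F_0 → A`. It sends the basis element `[ ]` to `1`. -/
def aug : D.F 0 →ₗ[Env k A] A := Finsupp.linearCombination (Env k A) fun _ => (1 : A)

/-- `⋯ → F_1 → F_0 → A → 0` is a free resolution of `A` as an `A ⊗ A^op`-module. -/
def IsFreeResolution : Prop := IsFreeRes (Env k A) D.F D.d D.aug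

/-- `D.matching` is an acyclic matching on the normalized Hochschild complex. -/
def IsAcyclicMatching : Prop := AlgMorse.IsAcyclicMatching D.deg D.bdCoeff D.matching

/-- Only finitely many paths start at a given cell, so the sums that define `D.d` are finite. -/
def FinitePaths : Prop :=
  ∀ c, (AlgMorse.pathsFrom D.deg D.bdCoeff D.matching c).Finite

/-! ### Reductions -/

/-- `c = [p|a|b|s]`, `c' = [p|v|s]`, and `v` occurs in the representation of `ab`. -/
def Contracts (c c' : D.Cell) : Prop :=
  ∃ p s : List Mon, ∃ a b v : Mon, c.1 = p ++ [a, b] ++ s ∧ c'.1 = p ++ [v] ++ s ∧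
    D.repr (D.val (a * b)) v ≠ 0

/-- Reduction of type I: a contraction, followed by the splitting that the matching prescribes. -/
def TypeI (c c₂ : D.Cell) : Prop :=
  c₂ ≠ c ∧ ∃ c', D.Contracts c c' ∧ (c₂, c') ∈ D.matching

/-- Reduction of type II: a contraction to a critical cell. -/
def TypeII (c f : D.Cell) : Prop := D.Crit f ∧ D.Contracts c f

/-- Starting from a critical cell, no sequence of reductions of type I ends with a reduction of
type II. -/
def NoTypeII : Prop :=
  ∀ e c f : D.Cell, D.Crit e → Relation.ReflTransGen D.TypeI e c → ¬ D.TypeII c f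

/-- Minimality with respect to an ideal `m` of `A ⊗ A^op`: `∂ F_{i+1} ⊆ m F_i`. -/
def IsMinimal (m : Ideal (Env k A)) : Prop := ∀ i (x : D.F (i + 1)) f, D.d i x f ∈ m

end StdMonomials

/-- The ideal of `A ⊗ A^op` generated by the elements `x_i ⊗ 1` and `1 ⊗ x_i`. -/
def envIdeal (k : Type*) {A ι : Type*} [Field k] [Ring A] [Algebra k A] (x : ι → A) :
    Ideal (Env k A) :=
  Ideal.span (Set.range (fun i => (x i ⊗ₜ[k] 1 : Env k A)) ∪
    Set.range (fun i => (1 ⊗ₜ[k] MulOpposite.op (x i) : Env k A)))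

/-! ### Gröbner bases -/

namespace Groebner

variable {k P Mon : Type*} [Field k] [Ring P] [Monoid Mon]

/-- `w` is the leading monomial of the polynomial with coefficients `q`. -/
def IsLead (lt : Mon → Mon → Prop) (q : Mon → k) (w : Mon) : Prop :=
  q w ≠ 0 ∧ ∀ v, q v ≠ 0 → v ≠ w → lt v w

/-- Divisibility of monomials (for words: being a subword). -/
def Factor (u w : Mon) : Prop := ∃ a b, w = a * u * b

/-- `S` is a reduced Gröbner basis of the ideal `I`; `coef` lists the coefficients of a
polynomial. -/
structure IsReduced (coef : P → Mon → k) (lt : Mon → Mon → Prop) (I : Set P) (S : Finset P) :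
    Prop where
  subset : ∀ f ∈ S, f ∈ I
  basis : ∀ p ∈ I, p ≠ 0 → ∃ f ∈ S, ∃ u w, IsLead lt (coef f) u ∧ IsLead lt (coef p) w ∧
    Factor u w
  monic : ∀ f ∈ S, ∃ u, IsLead lt (coef f) u ∧ coef f u = 1
  reduced : ∀ f ∈ S, ∀ g ∈ S, f ≠ g → ∀ u v, IsLead lt (coef g) u → coef f v ≠ 0 → ¬ Factor u v

/-- The standard monomials, `1` included (if the ideal is proper). -/
def Std (coef : P → Mon → k) (lt : Mon → Mon → Prop) (S : Finset P) : Set Mon :=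
  {w | ∀ f ∈ S, ∀ u, IsLead lt (coef f) u → ¬ Factor u w}

/-- The minimal generators of the initial ideal. -/
def MinGen (coef : P → Mon → k) (lt : Mon → Mon → Prop) (S : Finset P) : Set Mon :=
  {m | m ∉ Std coef lt S ∧ ∀ w, Factor w m → w ≠ m → w ∈ Std coef lt S}

end Groebner

/-! ### Quotients of the free algebra -/

namespace NonComm

variable {k : Type u} [Field k] {n : ℕ}

/-- The coefficient of a word in a noncommutative polynomial. -/
def coef (p : FreeAlgebra k (Fin n)) (w : FreeMonoid (Fin n)) : k :=
  (FreeAlgebra.equivMonoidAlgebraFreeMonoid p).coeff w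

/-- Degree-lexicographic order on words, with `x_0 ≻ x_1 ≻ ⋯`. -/
def lt (v w : FreeMonoid (Fin n)) : Prop :=
  v.length < w.length ∨
    (v.length = w.length ∧ List.Lex (fun i j : Fin n => j < i) v.toList w.toList)

/-- `k⟨x_0, …, x_{n-1}⟩ / ⟨S⟩`. -/
abbrev Quot (S : Finset (FreeAlgebra k (Fin n))) : Type u :=
  (TwoSidedIdeal.span (S : Set (FreeAlgebra k (Fin n)))).ringCon.Quotient

/-- `S` is a reduced Gröbner basis of the two-sided ideal that it generates. -/
def IsReducedGB (S : Finset (FreeAlgebra k (Fin n))) : Prop :=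
  Groebner.IsReduced coef lt
    {p | p ∈ TwoSidedIdeal.span (S : Set (FreeAlgebra k (Fin n)))} S

/-- The residue class of a polynomial. -/
def mk (S : Finset (FreeAlgebra k (Fin n))) : FreeAlgebra k (Fin n) →+* Quot S :=
  (TwoSidedIdeal.span (S : Set (FreeAlgebra k (Fin n)))).ringCon.mk'

def std (S : Finset (FreeAlgebra k (Fin n))) :
    StdMonomials k (Quot S) (FreeMonoid (Fin n)) where
  val := (mk S : FreeAlgebra k (Fin n) →* Quot S).comp (FreeMonoid.lift (FreeAlgebra.ι k))
  G := {w | w ∈ Groebner.Std coef lt S ∧ w ≠ 1}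
  lt := lt

/-- The ideal of `A ⊗ A^op` generated by the `x_i ⊗ 1` and `1 ⊗ x_i`. -/
def maxIdeal (S : Finset (FreeAlgebra k (Fin n))) : Ideal (Env k (Quot S)) :=
  envIdeal k fun i : Fin n => mk S (FreeAlgebra.ι k i)

/-- Fully attached tuples: `[]`, the tuples `[x_i]`, and the tuples
`[u₀, v₀ t₀, v₁ t₁, …, v_{r-1} t_{r-1}]`, `r ≥ 1`, of standard monomials such that `u₀` is a
letter, `u_j v_j t_j` are minimal generators of the initial ideal with `u_{j+1} = t_j`, and
`v_j t_j q` is standard for each proper prefix `q` of `v_{j+1} t_{j+1}`. -/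
def FullyAttached (S : Finset (FreeAlgebra k (Fin n))) (c : (std S).Cell) : Prop :=
  c.1 = [] ∨ (∃ i, c.1 = [FreeMonoid.of i]) ∨
  ∃ r : ℕ, 1 ≤ r ∧ ∃ u v t : ℕ → FreeMonoid (Fin n),
    c.1 = u 0 :: (List.range r).map (fun j => v j * t j) ∧
    (u 0).length = 1 ∧
    (∀ j < r, u j * v j * t j ∈ Groebner.MinGen coef lt S) ∧
    (∀ j, j + 1 < r → u (j + 1) = t j) ∧
    (∀ j, j + 1 < r → ∀ q, q ∣ v (j + 1) * t (j + 1) → q ≠ v (j + 1) * t (j + 1) →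
      v j * t j * q ∈ (std S).G)

end NonComm

/-! ### Quotients of the commutative polynomial ring -/

namespace Comm

variable {k : Type u} [Field k] {n : ℕ}

/-- The coefficient of a monomial in a polynomial. -/
def coef (p : MvPolynomial (Fin n) k) (w : Multiplicative (Fin n →₀ ℕ)) : k :=
  p.coeff w.toAdd

/-- Degree-lexicographic order on monomials, with `x_0 ≻ x_1 ≻ ⋯`. -/
def lt (v w : Multiplicative (Fin n →₀ ℕ)) : Prop := toDegLex v.toAdd < toDegLex w.toAdd

/-- `k[x_0, …, x_{n-1}] / ⟨S⟩`. -/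
abbrev Quot (S : Finset (MvPolynomial (Fin n) k)) : Type u :=
  MvPolynomial (Fin n) k ⧸ Ideal.span (S : Set (MvPolynomial (Fin n) k))

/-- `S` is a reduced Gröbner basis of the ideal that it generates. -/
def IsReducedGB (S : Finset (MvPolynomial (Fin n) k)) : Prop :=
  Groebner.IsReduced coef lt (Ideal.span (S : Set (MvPolynomial (Fin n) k)) : Set _) S

/-- The residue class of a polynomial. -/
def mk (S : Finset (MvPolynomial (Fin n) k)) : MvPolynomial (Fin n) k →+* Quot S :=
  Ideal.Quotient.mk (Ideal.span (S : Set (MvPolynomial (Fin n) k)))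

def std (S : Finset (MvPolynomial (Fin n) k)) :
    StdMonomials k (Quot S) (Multiplicative (Fin n →₀ ℕ)) where
  val := (mk S : MvPolynomial (Fin n) k →* Quot S).comp
    (MvPolynomial.monomialOneHom k (Fin n))
  G := {w | w ∈ Groebner.Std coef lt S ∧ w ≠ 1}
  lt := lt

/-- The ideal of `A ⊗ A^op` generated by the `x_i ⊗ 1` and `1 ⊗ x_i`. -/
def maxIdeal (S : Finset (MvPolynomial (Fin n) k)) : Ideal (Env k (Quot S)) :=
  envIdeal k fun i : Fin n => mk S (MvPolynomial.X i)

end Comm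

end

/-! The normalized bar complex has a k-linear contracting homotopy, so it resolves A. The matching
cancels pairs of cells whose mutual coefficient is a sign, and discrete Morse theory shows that what
remains is still a resolution.

Morse theory is carried out with operators on the free module on all cells. Let m be the part of the
differential d along matched edges, h its inverse on matched pairs, and N = d - m. Acyclicity makes
b = 1 + hN bijective (`bMap_surj`, `bMap_injective`). If e is critical and b y = e, then h y = 0 and
h d y = 0, and the path sum from e to a critical f is the coefficient of f in d y (`Gam_crit`). So b
identifies the subcomplex where h and hd vanish with the span of the critical cells, and carries d
to the Morse differential (`emb_morseD`). Every chain enters the kernel of h after subtracting a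
boundary (`exists_hMap_sub_eq_zero`), so exactness passes to the Morse complex (`isFreeRes`).

Combinatorially, whether a cell survives the first matchings depends only on a prefix and the entry
after it (`mem_critAfter`), and survival persists when that entry is enlarged inside the standard
monomials (`Q_up`). This turns membership in the matching into a local condition
(`mem_matching_iff`). Along edges of the reversed graph the product of the entries never grows.
While it stays constant, the list `key` weakly increases; it increases strictly along reversed
edges, and a merge that leaves it unchanged shortens the tuple (`below_of_mEdge`). Only finitely
many cells have a product of bounded length, so there are neither cycles nor infinite paths.

For minimality, a path between critical cells of adjacent degrees alternates descents and reversed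
edges. A descent whose coefficient is outside the maximal ideal is a contraction, so a path weight
outside the ideal would exhibit reductions of Type I followed by one of Type II (`pathWeight_mem`).
Over words the minimal splittings are linearly ordered prefixes, so a cell is critical exactly when
its entries form a chain for the relation `Attached`; this is the fully attached description. The
zero algebra is treated apart, since 1 is not standard there. -/

noncomputable section

/-! ### Paths in the reversed graph and their weights -/

namespace AlgMorse

section Paths

variable {V R : Type*} [Ring R] {deg : V → ℕ} {wt : V → V → R} {M : Set (V × V)}

theorem cons_mem_pathsFrom {c c' : V} {p : List V} (hc : MEdge deg wt M c c')
    (hp : p ∈ pathsFrom deg wt M c') : c :: p ∈ pathsFrom deg wt M c := by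
  obtain ⟨h1, h2⟩ := hp
  refine ⟨rfl, List.isChain_cons.2 ⟨fun y hy => ?_, h2⟩⟩
  rw [h1] at hy
  obtain rfl := Option.some_inj.1 hy
  exact hc

theorem pathsFrom_eq (c : V) : pathsFrom deg wt M c =
    {[c]} ∪ ⋃ c' ∈ {c' | MEdge deg wt M c c'}, List.cons c '' pathsFrom deg wt M c' := by
  ext p
  simp only [Set.mem_union, Set.mem_singleton_iff, Set.mem_iUnion, Set.mem_image, Set.mem_ofPred_eq]
  constructor
  · rintro ⟨h1, h2⟩
    rcases p with _ | ⟨a, _ | ⟨b, t⟩⟩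
    · simp at h1
    · left; simpa using h1
    · obtain rfl : a = c := by simpa using h1
      rw [List.isChain_cons_cons] at h2
      exact Or.inr ⟨b, h2.1, b :: t, ⟨rfl, h2.2⟩, rfl⟩
  · rintro (rfl | ⟨c', hc, q, hq, rfl⟩)
    · exact ⟨rfl, List.isChain_singleton c⟩
    · exact cons_mem_pathsFrom hc hq

theorem paths_eq (c f : V) : paths deg wt M c f =
    {p | p = [c] ∧ c = f} ∪
      ⋃ c' ∈ {c' | MEdge deg wt M c c'}, List.cons c '' paths deg wt M c' f := by
  have key : ∀ c', ∀ q ∈ pathsFrom deg wt M c', (c :: q).getLast? = q.getLast? := by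
    rintro c' (_ | ⟨b, t⟩) ⟨h1, -⟩
    · simp at h1
    · exact List.getLast?_cons_cons
  ext p
  simp only [paths, Set.mem_union, Set.mem_iUnion, Set.mem_image, Set.mem_ofPred_eq]
  rw [pathsFrom_eq]
  simp only [Set.mem_union, Set.mem_singleton_iff, Set.mem_iUnion, Set.mem_image, Set.mem_ofPred_eq]
  constructor
  · rintro ⟨rfl | ⟨c', hc, q, hq, rfl⟩, h⟩
    · exact Or.inl ⟨rfl, by simpa using h⟩
    · exact Or.inr ⟨c', hc, q, ⟨hq, by rw [← h, key c' q hq]⟩, rfl⟩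
  · rintro (⟨rfl, rfl⟩ | ⟨c', hc, q, ⟨hq, h⟩, rfl⟩)
    · exact ⟨Or.inl rfl, rfl⟩
    · exact ⟨Or.inr ⟨c', hc, q, hq, rfl⟩, by rw [← h, key c' q hq]⟩

theorem pathsFrom_finite (hwf : WellFounded fun c' c => MEdge deg wt M c c')
    (hfin : ∀ c, {c' | MEdge deg wt M c c'}.Finite) (c : V) : (pathsFrom deg wt M c).Finite := by
  induction c using hwf.induction with
  | h c ih =>
    rw [pathsFrom_eq]
    exact (Set.finite_singleton _).union ((hfin c).biUnion fun c' hc => (ih c' hc).image _)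

theorem pathWeight_cons {c c' : V} {p : List V} (hp : p ∈ pathsFrom deg wt M c') :
    pathWeight deg wt (c :: p) = stepWeight deg wt c c' * pathWeight deg wt p := by
  obtain ⟨h1, -⟩ := hp
  rcases p with _ | ⟨b, t⟩
  · simp at h1
  · obtain rfl : b = c' := by simpa using h1
    rfl

/-- A path is either trivial or a first step followed by a path, and these pieces are disjoint.
Finiteness lets the `finsum` be split and the step weight be pulled out. -/
theorem Gam_eq (hpaths : ∀ c, (pathsFrom deg wt M c).Finite)
    (hfin : ∀ c, {c' | MEdge deg wt M c c'}.Finite) (c f : V) :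
    Gam deg wt M c f = Finsupp.single c (1 : R) f +
      ∑ᶠ c' ∈ {c' | MEdge deg wt M c c'}, stepWeight deg wt c c' * Gam deg wt M c' f := by
  have hp : ∀ c, (paths deg wt M c f).Finite := fun c => (hpaths c).subset fun p hp => hp.1
  have head : ∀ {a q}, q ∈ paths deg wt M a f → q.head? = some a := fun h => h.1.1
  unfold Gam
  rw [paths_eq c f, finsum_mem_union]
  · congr 1
    · classical
      by_cases h : c = f
      · subst h
        simp [pathWeight]
      · simp [h]
    · rw [finsum_mem_biUnion]
      · refine finsum_mem_congr rfl fun c' _ => ?_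
        rw [finsum_mem_image (List.cons_injective.injOn), mul_finsum_mem' _ _ (hp c')]
        exact finsum_mem_congr rfl fun p hp => pathWeight_cons hp.1
      · intro a _ b _ hab
        refine Set.disjoint_left.2 ?_
        rintro _ ⟨q, hq, rfl⟩ ⟨q', hq', he⟩
        obtain rfl := List.cons_injective he
        exact hab (Option.some_inj.1 ((head hq).symm.trans (head hq')))
      · exact hfin c
      · exact fun c' _ => (hp c').image _
  · refine Set.disjoint_left.2 ?_
    rintro _ ⟨rfl, -⟩ h
    simp only [Set.mem_iUnion, Set.mem_image] at h
    obtain ⟨c', -, q, hq, he⟩ := h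
    have := head hq
    simp_all
  · exact (Set.finite_singleton [c]).subset fun p hp => hp.1
  · exact (hfin c).biUnion fun c' _ => (hp c').image _

/-- The second end of a matching edge does not occur as a first end. -/
theorem IsAcyclicMatching.not_up_of_low (hM : IsAcyclicMatching deg wt M) {u l l' : V}
    (h : (u, l) ∈ M) : (l, l') ∉ M := by
  intro h'
  have := hM.matching _ h _ h' (Or.inr (Or.inr (Or.inl rfl)))
  obtain rfl : u = l := (Prod.ext_iff.1 this).1
  obtain rfl : u = l' := (Prod.ext_iff.1 this).2
  exact Nat.succ_ne_self _ (hM.edge _ h).1.symm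

theorem IsAcyclicMatching.up_unique (hM : IsAcyclicMatching deg wt M) {u l l' : V}
    (h : (u, l) ∈ M) (h' : (u, l') ∈ M) : l = l' :=
  (Prod.ext_iff.1 (hM.matching _ h _ h' (Or.inl rfl))).2

theorem IsAcyclicMatching.low_unique (hM : IsAcyclicMatching deg wt M) {u u' l : V}
    (h : (u, l) ∈ M) (h' : (u', l) ∈ M) : u = u' :=
  (Prod.ext_iff.1 (hM.matching _ h _ h' (Or.inr (Or.inr (Or.inr rfl))))).1

/-- Along paths that end in a critical cell the degree drops, unless the path starts with a
reversed edge or is trivial. -/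
theorem deg_of_mem_paths (hM : IsAcyclicMatching deg wt M) {f : V} (hf : Critical M f) :
    ∀ (p : List V) (c : V), p ∈ paths deg wt M c f →
      deg f ≤ deg c ∧ ((∀ u, (u, c) ∉ M) → c = f ∨ deg f < deg c)
  | [], c, h => by simpa using h.1.1
  | a :: p, c, h => by
    rw [paths_eq] at h
    simp only [Set.mem_union, Set.mem_iUnion, Set.mem_image, Set.mem_ofPred_eq] at h
    rcases h with ⟨-, rfl⟩ | ⟨c', hc, q, hq, he⟩
    · exact ⟨le_rfl, fun _ => Or.inl rfl⟩
    · obtain ⟨rfl, rfl⟩ := List.cons.inj he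
      have ih := deg_of_mem_paths hM hf q c' hq
      rcases hc with ⟨⟨hd, -⟩, -⟩ | ⟨⟨hd, -⟩, hm⟩
      · have : deg f < deg c := by omega
        exact ⟨this.le, fun _ => Or.inr this⟩
      · refine ⟨?_, fun hu => absurd hm (hu c')⟩
        have := ih.2 fun u hu => hM.not_up_of_low hu hm
        rcases this with rfl | h
        · exact absurd rfl (hf _ hm).1
        · omega

theorem Gam_eq_zero (hM : IsAcyclicMatching deg wt M) {c f : V} (hf : Critical M f)
    (h : deg c < deg f) : Gam deg wt M c f = 0 := by
  rw [Gam, Set.eq_empty_of_forall_notMem (s := paths deg wt M c f)]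
  · simp
  · intro p hp
    have := (deg_of_mem_paths hM hf p c hp).1
    omega

end Paths

end AlgMorse

/-! ### Operators attached to a matching -/

namespace AlgMorse

/-- A complex of free modules, given as one module with a differential `d` of degree `-1`, together
with an acyclic matching without infinite paths. -/
structure MatchedComplex {V R : Type*} [Ring R] (deg : V → ℕ) (wt : V → V → R) (M : Set (V × V))
    (d : (V →₀ R) →ₗ[R] (V →₀ R)) : Prop where
  matching : IsAcyclicMatching deg wt M
  wf : WellFounded fun c' c => MEdge deg wt M c c'
  d_single : ∀ c c', d (Finsupp.single c 1) c' = wt c c'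
  deg_eq : ∀ c c', wt c c' ≠ 0 → deg c = deg c' + 1
  dd : ∀ x, d (d x) = 0

section Operators

variable {V R : Type*} [Ring R] (deg : V → ℕ) (wt : V → V → R) (M : Set (V × V))

theorem linearMap_ext {N : Type*} [AddCommGroup N] [Module R N] {f g : (V →₀ R) →ₗ[R] N}
    (h : ∀ c, f (Finsupp.single c 1) = g (Finsupp.single c 1)) : f = g :=
  Finsupp.lhom_ext' fun c => LinearMap.ext_ring (h c)

/-- The elements of degree `i`. -/
abbrev gr (i : ℕ) : Submodule R (V →₀ R) := Finsupp.supported R R {c | deg c = i}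

open Classical in
/-- The reversed matching edges. -/
def hMap : (V →₀ R) →ₗ[R] (V →₀ R) :=
  Finsupp.linearCombination R fun c => if hc : ∃ u, (u, c) ∈ M then
    Finsupp.single hc.choose (Ring.inverse (wt hc.choose c)) else 0

open Classical in
/-- The part of the differential that belongs to the matching edges. -/
def mMap : (V →₀ R) →ₗ[R] (V →₀ R) :=
  Finsupp.linearCombination R fun c => if hc : ∃ l, (c, l) ∈ M then
    Finsupp.single hc.choose (wt c hc.choose) else 0

/-- The projection to the span of the critical cells. -/
def piMap : (V →₀ R) →ₗ[R] (V →₀ R) :=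
  LinearMap.id - hMap wt M ∘ₗ mMap wt M - mMap wt M ∘ₗ hMap wt M

/-- `1 + h N`, where `N` is the part of `d` outside of the matching. -/
def bMap (d : (V →₀ R) →ₗ[R] (V →₀ R)) : (V →₀ R) →ₗ[R] (V →₀ R) :=
  LinearMap.id + hMap wt M ∘ₗ (d - mMap wt M)

end Operators

section

variable {V R : Type*} [Ring R] {deg : V → ℕ} {wt : V → V → R} {M : Set (V × V)}

theorem hMap_of_not {c : V} (hc : ∀ u, (u, c) ∉ M) : hMap wt M (Finsupp.single c 1) = 0 := by
  simp [hMap, hc]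

theorem mMap_of_not {c : V} (hc : ∀ l, (c, l) ∉ M) : mMap wt M (Finsupp.single c 1) = 0 := by
  simp [mMap, hc]

theorem IsAcyclicMatching.hMap_single (hM : IsAcyclicMatching deg wt M) {u l : V}
    (h : (u, l) ∈ M) :
    hMap wt M (Finsupp.single l 1) = Finsupp.single u (Ring.inverse (wt u l)) := by
  have hc : ∃ u, (u, l) ∈ M := ⟨u, h⟩
  rw [hMap, Finsupp.linearCombination_single, dif_pos hc, one_smul,
    hM.low_unique hc.choose_spec h]

theorem IsAcyclicMatching.mMap_single (hM : IsAcyclicMatching deg wt M) {u l : V}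
    (h : (u, l) ∈ M) : mMap wt M (Finsupp.single u 1) = Finsupp.single l (wt u l) := by
  have hc : ∃ l, (u, l) ∈ M := ⟨l, h⟩
  rw [mMap, Finsupp.linearCombination_single, dif_pos hc, one_smul,
    hM.up_unique hc.choose_spec h]

theorem single_eq_smul (c : V) (a : R) : Finsupp.single c a = a • Finsupp.single c (1 : R) := by
  simp

theorem IsAcyclicMatching.hm_single (hM : IsAcyclicMatching deg wt M) {u l : V}
    (h : (u, l) ∈ M) : hMap wt M (mMap wt M (Finsupp.single u 1)) = Finsupp.single u 1 := by
  rw [hM.mMap_single h, single_eq_smul, map_smul, hM.hMap_single h, Finsupp.smul_single,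
    smul_eq_mul, Ring.mul_inverse_cancel _ (hM.invertible _ h)]

theorem IsAcyclicMatching.mh_single (hM : IsAcyclicMatching deg wt M) {u l : V}
    (h : (u, l) ∈ M) : mMap wt M (hMap wt M (Finsupp.single l 1)) = Finsupp.single l 1 := by
  rw [hM.hMap_single h, single_eq_smul, map_smul, hM.mMap_single h, Finsupp.smul_single,
    smul_eq_mul, Ring.inverse_mul_cancel _ (hM.invertible _ h)]

/-- The upper end of a matched pair is never a lower end, so two reversed edges do not compose. -/
theorem IsAcyclicMatching.hh (hM : IsAcyclicMatching deg wt M) (x : V →₀ R) :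
    hMap wt M (hMap wt M x) = 0 := by
  suffices hMap wt M ∘ₗ hMap wt M = 0 from LinearMap.congr_fun this x
  refine linearMap_ext fun c => ?_
  by_cases hc : ∃ u, (u, c) ∈ M
  · obtain ⟨u, hu⟩ := hc
    rw [LinearMap.comp_apply, hM.hMap_single hu, single_eq_smul, map_smul,
      hMap_of_not fun w hw => hM.not_up_of_low hw hu]
    simp
  · rw [LinearMap.comp_apply, hMap_of_not (not_exists.1 hc)]
    simp

theorem IsAcyclicMatching.hmh (hM : IsAcyclicMatching deg wt M) (x : V →₀ R) :
    hMap wt M (mMap wt M (hMap wt M x)) = hMap wt M x := by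
  suffices hMap wt M ∘ₗ mMap wt M ∘ₗ hMap wt M = hMap wt M from LinearMap.congr_fun this x
  refine linearMap_ext fun c => ?_
  by_cases hc : ∃ u, (u, c) ∈ M
  · obtain ⟨u, hu⟩ := hc
    simp only [LinearMap.comp_apply]
    rw [hM.mh_single hu]
  · simp only [LinearMap.comp_apply]
    rw [hMap_of_not (not_exists.1 hc)]
    simp

theorem IsAcyclicMatching.mhm (hM : IsAcyclicMatching deg wt M) (x : V →₀ R) :
    mMap wt M (hMap wt M (mMap wt M x)) = mMap wt M x := by
  suffices mMap wt M ∘ₗ hMap wt M ∘ₗ mMap wt M = mMap wt M from LinearMap.congr_fun this x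
  refine linearMap_ext fun c => ?_
  by_cases hc : ∃ l, (c, l) ∈ M
  · obtain ⟨l, hl⟩ := hc
    simp only [LinearMap.comp_apply]
    rw [hM.hm_single hl]
  · simp only [LinearMap.comp_apply]
    rw [mMap_of_not (not_exists.1 hc)]
    simp

theorem Critical.notMem_left {c : V} (h : Critical M c) (l : V) : (c, l) ∉ M :=
  fun h' => (h _ h').1 rfl

theorem Critical.notMem_right {c : V} (h : Critical M c) (u : V) : (u, c) ∉ M :=
  fun h' => (h _ h').2 rfl

theorem not_critical {c : V} (h : ¬ Critical M c) : (∃ l, (c, l) ∈ M) ∨ ∃ u, (u, c) ∈ M := by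
  simp only [Critical, not_forall, not_and_or, not_not] at h
  obtain ⟨⟨a, b⟩, he, rfl | rfl⟩ := h
  · exact Or.inl ⟨_, he⟩
  · exact Or.inr ⟨_, he⟩

-- The composite hm is the identity on upper ends and mh is the identity on lower ends; both vanish
-- on the remaining cells. Subtracting the two from the identity therefore leaves the critical part.
open Classical in
theorem IsAcyclicMatching.piMap_eq (hM : IsAcyclicMatching deg wt M) (x : V →₀ R) :
    piMap wt M x = x.filter (Critical M) := by
  suffices piMap wt M = (Finsupp.supported R R {c | Critical M c}).subtype ∘ₗ
      Finsupp.restrictDom R R {c | Critical M c} from by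
    rw [this]
    rfl
  refine linearMap_ext fun c => ?_
  simp only [LinearMap.comp_apply, piMap, LinearMap.sub_apply, LinearMap.id_apply,
    Submodule.subtype_apply, Finsupp.restrictDom_apply]
  by_cases hc : Critical M c
  · rw [mMap_of_not hc.notMem_left, hMap_of_not hc.notMem_right,
      Finsupp.filter_single_of_pos _ (by exact hc)]
    simp
  · rw [Finsupp.filter_single_of_neg _ (by exact hc)]
    rcases not_critical hc with ⟨l, hl⟩ | ⟨u, hu⟩
    · rw [hM.hm_single hl, hMap_of_not fun w hw => hM.not_up_of_low hw hl]
      simp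
    · rw [hM.mh_single hu, mMap_of_not fun w hw => hM.not_up_of_low hu hw]
      simp

/-- A linear map that shifts the degree of the basis elements does so for all elements. -/
theorem mem_of_single {s : Set V} {N : Type*} [AddCommGroup N] [Module R N]
    {f : (V →₀ R) →ₗ[R] N} {T : Submodule R N} (h : ∀ c ∈ s, f (Finsupp.single c 1) ∈ T)
    {x : V →₀ R} (hx : x ∈ Finsupp.supported R R s) : f x ∈ T := by
  rw [Finsupp.supported_eq_span_single] at hx
  induction hx using Submodule.span_induction with
  | mem x hx => obtain ⟨c, hc, rfl⟩ := hx; exact h c hc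
  | zero => simp
  | add x y _ _ hx hy => rw [map_add]; exact T.add_mem hx hy
  | smul a x _ hx => rw [map_smul]; exact T.smul_mem a hx

theorem IsAcyclicMatching.hMap_mem (hM : IsAcyclicMatching deg wt M) {i : ℕ} {x : V →₀ R}
    (hx : x ∈ gr deg i) : hMap wt M x ∈ gr deg (i + 1) := by
  refine mem_of_single (fun c hc => ?_) hx
  by_cases h : ∃ u, (u, c) ∈ M
  · obtain ⟨u, hu⟩ := h
    rw [hM.hMap_single hu]
    refine Finsupp.single_mem_supported _ _ ?_
    rw [Set.mem_ofPred_eq, (hM.edge _ hu).1, ← hc]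
  · rw [hMap_of_not (not_exists.1 h)]
    exact zero_mem _

theorem IsAcyclicMatching.mMap_mem (hM : IsAcyclicMatching deg wt M) {i : ℕ} {x : V →₀ R}
    (hx : x ∈ gr deg (i + 1)) : mMap wt M x ∈ gr deg i := by
  refine mem_of_single (fun c hc => ?_) hx
  by_cases h : ∃ l, (c, l) ∈ M
  · obtain ⟨l, hl⟩ := h
    rw [hM.mMap_single hl]
    refine Finsupp.single_mem_supported _ _ ?_
    have : deg c = deg l + 1 := (hM.edge _ hl).1
    simp only [Set.mem_ofPred_eq] at hc ⊢
    omega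
  · rw [mMap_of_not (not_exists.1 h)]
    exact zero_mem _

end

/-! ### Invertibility of 1 + hN -/

namespace MatchedComplex

variable {V R : Type*} [Ring R] {deg : V → ℕ} {wt : V → V → R} {M : Set (V × V)}
  {d : (V →₀ R) →ₗ[R] (V →₀ R)}

theorem d_mem (H : MatchedComplex deg wt M d) {i : ℕ} {x : V →₀ R} (hx : x ∈ gr deg (i + 1)) :
    d x ∈ gr deg i := by
  refine mem_of_single (fun c hc => ?_) hx
  rw [Finsupp.mem_supported]
  intro c' hc'
  have := H.deg_eq c c' (by rw [← H.d_single]; simpa using hc')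
  simp only [Set.mem_ofPred_eq] at hc ⊢
  omega

theorem d_zero (H : MatchedComplex deg wt M d) {x : V →₀ R} (hx : x ∈ gr deg 0) : d x = 0 := by
  refine (Submodule.mem_bot R).1 (mem_of_single (fun c hc => ?_) hx)
  rw [Submodule.mem_bot]
  ext c'
  rw [H.d_single]
  by_contra h
  have := H.deg_eq c c' h
  simp only [Set.mem_ofPred_eq] at hc
  omega

theorem succ_finite (H : MatchedComplex deg wt M d) (c : V) :
    {c' | MEdge deg wt M c c'}.Finite := by
  have h1 : {c' | wt c c' ≠ 0}.Finite := by
    refine (d (Finsupp.single c 1)).support.finite_toSet.subset fun c' hc' => ?_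
    simpa [H.d_single] using hc'
  have h2 : {c' | (c', c) ∈ M}.Subsingleton := fun a ha b hb => H.matching.low_unique ha hb
  refine (h1.union h2.finite).subset ?_
  rintro c' (⟨⟨-, h⟩, -⟩ | ⟨-, h⟩)
  · exact Or.inl h
  · exact Or.inr h

theorem pathsFrom_finite (H : MatchedComplex deg wt M d) (c : V) :
    (pathsFrom deg wt M c).Finite :=
  AlgMorse.pathsFrom_finite H.wf H.succ_finite c

/-- The part of the differential outside of the matching. -/
theorem d_sub_m_single (H : MatchedComplex deg wt M d) (c c' : V) :
    (d - mMap wt M) (Finsupp.single c 1) c' =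
      open Classical in if (c, c') ∈ M then 0 else wt c c' := by
  classical
  rw [LinearMap.sub_apply, Finsupp.sub_apply, H.d_single]
  by_cases hc : ∃ l, (c, l) ∈ M
  · obtain ⟨l, hl⟩ := hc
    rw [H.matching.mMap_single hl]
    by_cases hl' : l = c'
    · subst hl'
      simp [hl]
    · rw [if_neg fun h => hl' (H.matching.up_unique hl h)]
      simp [hl']
  · rw [mMap_of_not (not_exists.1 hc), if_neg (not_exists.1 hc c')]
    simp

theorem mEdge_of_d_sub_m (H : MatchedComplex deg wt M d) {c c' : V}
    (h : (d - mMap wt M) (Finsupp.single c 1) c' ≠ 0) :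
    wt c c' ≠ 0 ∧ MEdge deg wt M c c' := by
  rw [H.d_sub_m_single] at h
  split_ifs at h with hc
  · simp at h
  · exact ⟨h, Or.inl ⟨⟨H.deg_eq _ _ h, h⟩, hc⟩⟩

/-- `h N` moves along paths of length two. -/
theorem transGen_of_hN (H : MatchedComplex deg wt M d) {c c₂ : V}
    (h : hMap wt M ((d - mMap wt M) (Finsupp.single c 1)) c₂ ≠ 0) :
    Relation.TransGen (MEdge deg wt M) c c₂ ∧ deg c₂ = deg c := by
  set y := (d - mMap wt M) (Finsupp.single c 1) with hy
  have : hMap wt M y ∈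
      Finsupp.supported R R {c₂ | Relation.TransGen (MEdge deg wt M) c c₂ ∧ deg c₂ = deg c} := by
    refine mem_of_single (s := {c' | y c' ≠ 0}) (fun c' hc' => ?_) ?_
    · obtain ⟨hw, hc⟩ := H.mEdge_of_d_sub_m hc'
      have hd := H.deg_eq _ _ hw
      by_cases hu : ∃ u, (u, c') ∈ M
      · obtain ⟨u, hu⟩ := hu
        rw [H.matching.hMap_single hu]
        have he := H.matching.edge _ hu
        refine Finsupp.single_mem_supported _ _
          ⟨Relation.TransGen.tail (.single hc) (Or.inr ⟨he, hu⟩), ?_⟩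
        rw [he.1, hd]
      · rw [hMap_of_not (not_exists.1 hu)]
        exact zero_mem _
    · rw [Finsupp.mem_supported]
      intro c' hc'
      simpa using hc'
  exact this (by simpa using h)

/-- The error b c - c = hN c involves only cells of the same degree reachable from c, so their
preimages are available by induction along paths. -/
theorem bMap_single_surj (H : MatchedComplex deg wt M d) (c : V) :
    ∃ y ∈ gr deg (deg c), bMap wt M d y = Finsupp.single c (1 : R) := by
  induction c using H.wf.transGen.induction with
  | h c ih =>
    set z := hMap wt M ((d - mMap wt M) (Finsupp.single c 1)) with hz
    have : z ∈ Submodule.map (bMap wt M d) (gr deg (deg c)) := by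
      rw [← Finsupp.sum_single z]
      refine Submodule.sum_mem _ fun c₂ hc₂ => ?_
      obtain ⟨ht, hd⟩ := H.transGen_of_hN (c := c) (c₂ := c₂) (Finsupp.mem_support_iff.1 hc₂)
      obtain ⟨y, hy, hb⟩ := ih c₂ (Relation.transGen_swap.1 ht)
      rw [single_eq_smul, ← hb, ← map_smul]
      exact Submodule.mem_map_of_mem (Submodule.smul_mem _ _ (hd ▸ hy))
    obtain ⟨y, hy, hb⟩ := this
    refine ⟨Finsupp.single c 1 - y,
      Submodule.sub_mem _ (Finsupp.single_mem_supported _ _ rfl) hy, ?_⟩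
    rw [map_sub, hb, bMap, LinearMap.add_apply, LinearMap.id_apply, LinearMap.comp_apply, ← hz]
    simp

theorem bMap_surj (H : MatchedComplex deg wt M d) {i : ℕ} {x : V →₀ R} (hx : x ∈ gr deg i) :
    ∃ y ∈ gr deg i, bMap wt M d y = x := by
  have : x ∈ Submodule.map (bMap wt M d) (gr deg i) := by
    rw [gr, Finsupp.supported_eq_span_single] at hx
    refine Submodule.span_le.2 ?_ hx
    rintro _ ⟨c, hc, rfl⟩
    obtain ⟨y, hy, hb⟩ := H.bMap_single_surj c
    exact ⟨y, (hc : deg c = i) ▸ hy, hb⟩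
  exact this

/-- A kernel element satisfies x = -hN x, so each cell of its support is reached from another such
cell. In a finite acyclic set this is impossible. -/
theorem bMap_injective (H : MatchedComplex deg wt M d) : Function.Injective (bMap wt M d) := by
  rw [← LinearMap.ker_eq_bot, LinearMap.ker_eq_bot']
  intro x hx
  by_contra h0
  have hx' : x = - hMap wt M ((d - mMap wt M) x) := by
    rw [bMap, LinearMap.add_apply, LinearMap.id_apply, LinearMap.comp_apply] at hx
    exact eq_neg_of_add_eq_zero_left hx
  -- every cell in the support of `x` is reached from another one
  have step : ∀ c ∈ x.support, ∃ c' ∈ x.support, Relation.TransGen (MEdge deg wt M) c' c := by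
    intro c hc
    have hmem : hMap wt M ((d - mMap wt M) x) ∈ Finsupp.supported R R
        {c | ∃ c' ∈ x.support, Relation.TransGen (MEdge deg wt M) c' c} := by
      refine mem_of_single (f := hMap wt M ∘ₗ (d - mMap wt M)) (s := x.support)
        (fun c' hc' => ?_) (by rw [Finsupp.mem_supported])
      rw [Finsupp.mem_supported]
      intro c₂ hc₂
      exact ⟨c', hc', (H.transGen_of_hN (by simpa using hc₂)).1⟩
    refine hmem ?_
    rw [hx', Finsupp.support_neg] at hc
    exact hc
  let r : x.support → x.support → Prop :=
    fun a b => Relation.TransGen (MEdge deg wt M) (a : V) b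
  have : IsTrans _ r := ⟨fun _ _ _ => Relation.TransGen.trans⟩
  have : Std.Irrefl r := ⟨fun a => H.matching.acyclic a⟩
  obtain ⟨c, hc, hmin⟩ := (Finite.wellFounded_of_trans_of_irrefl r).has_min Set.univ
      ⟨⟨_, (Finsupp.support_nonempty_iff.2 h0).choose_spec⟩, trivial⟩
  obtain ⟨c', hc', ht⟩ := step c c.2
  exact hmin ⟨c', hc'⟩ trivial ht

end MatchedComplex

end AlgMorse

/-! ### The Morse complex and its exactness -/

namespace AlgMorse

/-- The inclusion of the span of the critical cells of degree `i`. -/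
def emb {V : Type*} (R : Type*) [Ring R] (deg : V → ℕ) (M : Set (V × V)) (i : ℕ) :
    (CritCell deg M i →₀ R) →ₗ[R] (V →₀ R) :=
  Finsupp.lmapDomain R R fun e : CritCell deg M i => e.1

/-- `∑_c x_c Γ(c, f)` -/
def gamMap {V R : Type*} [Ring R] (deg : V → ℕ) (wt : V → V → R) (M : Set (V × V)) (f : V) :
    (V →₀ R) →ₗ[R] R :=
  Finsupp.linearCombination R fun c => Gam deg wt M c f

section

variable {V R : Type*} [Ring R] {deg : V → ℕ} {wt : V → V → R} {M : Set (V × V)}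

theorem emb_single {i : ℕ} (e : CritCell deg M i) (a : R) :
    emb R deg M i (Finsupp.single e a) = Finsupp.single e.1 a :=
  Finsupp.mapDomain_single

theorem emb_injective (i : ℕ) : Function.Injective (emb R deg M i) :=
  Finsupp.mapDomain_injective Subtype.val_injective

theorem emb_apply {i : ℕ} (x : CritCell deg M i →₀ R) (f : CritCell deg M i) :
    emb R deg M i x f.1 = x f :=
  Finsupp.mapDomain_apply Subtype.val_injective x f

theorem emb_mem {i : ℕ} (x : CritCell deg M i →₀ R) : emb R deg M i x ∈ gr deg i := by
  refine mem_of_single (s := Set.univ) (fun e _ => ?_) (by simp)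
  rw [emb_single]
  exact Finsupp.single_mem_supported _ _ e.2.2

theorem hMap_emb {i : ℕ} (x : CritCell deg M i →₀ R) : hMap wt M (emb R deg M i x) = 0 := by
  suffices hMap wt M ∘ₗ emb R deg M i = 0 from LinearMap.congr_fun this x
  refine linearMap_ext fun e => ?_
  rw [LinearMap.comp_apply, emb_single, hMap_of_not e.2.1.notMem_right, LinearMap.zero_apply]

theorem mMap_emb {i : ℕ} (x : CritCell deg M i →₀ R) : mMap wt M (emb R deg M i x) = 0 := by
  suffices mMap wt M ∘ₗ emb R deg M i = 0 from LinearMap.congr_fun this x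
  refine linearMap_ext fun e => ?_
  rw [LinearMap.comp_apply, emb_single, mMap_of_not e.2.1.notMem_left, LinearMap.zero_apply]

theorem IsAcyclicMatching.piMap_mem_range (hM : IsAcyclicMatching deg wt M) {i : ℕ} {x : V →₀ R}
    (hx : x ∈ gr deg i) : piMap wt M x ∈ LinearMap.range (emb R deg M i) := by
  classical
  refine mem_of_single (fun c hc => ?_) hx
  rw [hM.piMap_eq]
  by_cases h : Critical M c
  · rw [Finsupp.filter_single_of_pos _ h]
    exact ⟨Finsupp.single ⟨c, h, hc⟩ 1, emb_single _ _⟩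
  · rw [Finsupp.filter_single_of_neg _ h]
    exact zero_mem _

theorem IsAcyclicMatching.mMap_apply_crit (hM : IsAcyclicMatching deg wt M) {f : V}
    (hf : ∀ u, (u, f) ∉ M) (x : V →₀ R) : mMap wt M x f = 0 := by
  suffices mMap wt M x ∈ Finsupp.supported R R {c | c ≠ f} by
    by_contra h
    exact this (Finsupp.mem_support_iff.2 h) rfl
  refine mem_of_single (s := Set.univ) (fun c _ => ?_) (by simp)
  by_cases hc : ∃ l, (c, l) ∈ M
  · obtain ⟨l, hl⟩ := hc
    rw [hM.mMap_single hl]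
    exact Finsupp.single_mem_supported _ _ fun h => hf c (h ▸ hl)
  · rw [mMap_of_not (not_exists.1 hc)]
    exact zero_mem _

end

namespace MatchedComplex

variable {V R : Type*} [Ring R] {deg : V → ℕ} {wt : V → V → R} {M : Set (V × V)}
  {d : (V →₀ R) →ₗ[R] (V →₀ R)}

/-- Thus d - m - h is the one-step transfer operator of the reversed graph: d - m gives the kept
edges, and -h the reversed ones with their sign. -/
theorem step_single (H : MatchedComplex deg wt M d) (c c' : V) :
    (d - mMap wt M - hMap wt M) (Finsupp.single c 1) c' =
      open Classical in if MEdge deg wt M c c' then stepWeight deg wt c c' else 0 := by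
  rw [LinearMap.sub_apply, Finsupp.sub_apply, H.d_sub_m_single]
  by_cases h : (c', c) ∈ M
  · have he := H.matching.edge _ h
    have hd : deg c' = deg c + 1 := he.1
    have h0 : wt c c' = 0 := by
      by_contra h0
      have := H.deg_eq _ _ h0
      omega
    have hE : MEdge deg wt M c c' := Or.inr ⟨he, h⟩
    rw [if_pos hE, H.matching.hMap_single h, h0, stepWeight,
      if_pos (show deg c < deg c' by omega)]
    simp
  · have hh : hMap wt M (Finsupp.single c 1) c' = 0 := by
      by_cases hu : ∃ u, (u, c) ∈ M
      · obtain ⟨u, hu⟩ := hu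
        rw [H.matching.hMap_single hu, Finsupp.single_eq_of_ne]
        rintro rfl
        exact h hu
      · rw [hMap_of_not (not_exists.1 hu), Finsupp.zero_apply]
    rw [hh, sub_zero]
    by_cases h0 : wt c c' = 0
    · rw [h0, ite_self, if_neg]
      rintro (⟨⟨-, h1⟩, -⟩ | ⟨-, h1⟩)
      · exact h1 h0
      · exact h h1
    · have hd := H.deg_eq _ _ h0
      by_cases h2 : (c, c') ∈ M
      · rw [if_pos h2, if_neg]
        rintro (⟨-, h1⟩ | ⟨-, h1⟩)
        · exact h1 h2
        · exact h h1
      · have hE : MEdge deg wt M c c' := Or.inl ⟨⟨hd, h0⟩, h2⟩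
        rw [if_neg h2, if_pos hE, stepWeight, if_neg (by omega)]

/-- The first-step decomposition of path sums, extended linearly to chains so that it can be
combined with operator identities. -/
theorem gamMap_eq (H : MatchedComplex deg wt M d) (f : V) (x : V →₀ R) :
    gamMap deg wt M f x = x f + gamMap deg wt M f ((d - mMap wt M) x) -
      gamMap deg wt M f (hMap wt M x) := by
  classical
  rw [add_sub_assoc, ← map_sub, ← LinearMap.sub_apply]
  suffices gamMap deg wt M f = Finsupp.lapply f +
      gamMap deg wt M f ∘ₗ (d - mMap wt M - hMap wt M) from LinearMap.congr_fun this x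
  refine linearMap_ext fun c => ?_
  rw [LinearMap.add_apply, LinearMap.comp_apply, Finsupp.lapply_apply]
  conv_lhs => rw [gamMap, Finsupp.linearCombination_single, one_smul,
    Gam_eq H.pathsFrom_finite H.succ_finite]
  congr 1
  rw [finsum_mem_eq_finite_toFinset_sum _ (H.succ_finite c), gamMap,
    Finsupp.linearCombination_apply,
    Finsupp.sum_of_support_subset (s := (H.succ_finite c).toFinset)]
  · refine Finset.sum_congr rfl fun c' hc' => ?_
    rw [H.step_single, if_pos (by simpa using hc'), smul_eq_mul]
  · intro c' hc'
    rw [Finsupp.mem_support_iff, H.step_single] at hc'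
    simp only [Set.Finite.mem_toFinset, Set.mem_ofPred_eq]
    by_contra h
    exact hc' (if_neg h)
  · simp

theorem gamMap_eq_zero (H : MatchedComplex deg wt M d) {f : V} (hf : Critical M f) {x : V →₀ R}
    (hx : x ∈ Finsupp.supported R R {c | deg c < deg f}) : gamMap deg wt M f x = 0 := by
  refine (Submodule.mem_bot R).1 (mem_of_single (fun c hc => ?_) hx)
  rw [Submodule.mem_bot, gamMap, Finsupp.linearCombination_single, one_smul]
  exact Gam_eq_zero H.matching hf hc

theorem d_sub_m_mem (H : MatchedComplex deg wt M d) {i : ℕ} {x : V →₀ R} (hx : x ∈ gr deg i) :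
    (d - mMap wt M) x ∈ Finsupp.supported R R {c | deg c < i} := by
  refine mem_of_single (fun c hc => ?_) hx
  rw [Finsupp.mem_supported]
  intro c' hc'
  have := H.deg_eq _ _ (H.mEdge_of_d_sub_m (Finsupp.mem_support_iff.1 hc')).1
  simp only [Set.mem_ofPred_eq] at hc ⊢
  omega

/-- The reversed steps cancel because h x = 0, and the kept steps fall below the degree of f, from
where f cannot be reached. Only trivial paths contribute. -/
theorem gamMap_of_hMap_eq_zero (H : MatchedComplex deg wt M d) {f : V} (hf : Critical M f)
    {x : V →₀ R} (hx : x ∈ gr deg (deg f)) (h0 : hMap wt M x = 0) :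
    gamMap deg wt M f x = x f := by
  rw [H.gamMap_eq, h0, H.gamMap_eq_zero hf (H.d_sub_m_mem hx)]
  simp

theorem bMap_apply (x : V →₀ R) :
    bMap wt M d x = x + hMap wt M (d x) - hMap wt M (mMap wt M x) := by
  simp [bMap, add_sub_assoc]

/-- Applying hm to y + hdy - hmy = x and using hmh = h leaves hdy = 0. The equation then reads y = x
+ hmy, and hh = 0 gives hy = 0. -/
theorem of_bMap_eq (H : MatchedComplex deg wt M d) {x y : V →₀ R} (hh : hMap wt M x = 0)
    (hm : mMap wt M x = 0) (hy : bMap wt M d y = x) :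
    hMap wt M y = 0 ∧ hMap wt M (d y) = 0 ∧ y = x + hMap wt M (mMap wt M y) := by
  rw [bMap_apply] at hy
  have h1 : hMap wt M (d y) = 0 := by
    have := congrArg (fun z => hMap wt M (mMap wt M z)) hy
    simp only [map_sub, map_add, H.matching.mhm, H.matching.hmh, hm, map_zero] at this
    rwa [add_sub_cancel_left] at this
  have h2 : y = x + hMap wt M (mMap wt M y) := by
    rw [← hy, h1]
    simp
  refine ⟨?_, h1, h2⟩
  rw [h2, map_add, hh, H.matching.hh, add_zero]

/-- Together with `of_bMap_eq` this identifies the subcomplex where h and hd vanish with the span of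
the critical cells. -/
theorem bMap_eq_piMap {x : V →₀ R} (hx : hMap wt M x = 0) (hdx : hMap wt M (d x) = 0) :
    bMap wt M d x = piMap wt M x := by
  simp [bMap_apply, piMap, hx, hdx]

/-- Solve b y = h x. Applying hm and using hmh = h turns this into hdy = hx. -/
theorem exists_hMap_sub_eq_zero (H : MatchedComplex deg wt M d) {i : ℕ} {x : V →₀ R}
    (hx : x ∈ gr deg i) : ∃ y ∈ gr deg (i + 1), hMap wt M (x - d y) = 0 := by
  obtain ⟨y, hy, hb⟩ := H.bMap_surj (H.matching.hMap_mem hx)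
  refine ⟨y, hy, ?_⟩
  rw [bMap_apply] at hb
  have := congrArg (fun z => hMap wt M (mMap wt M z)) hb
  simp only [map_sub, map_add, H.matching.mhm, H.matching.hmh, add_sub_cancel_left] at this
  rw [map_sub, this, sub_self]

/-- Write Γ for path sums ending at f. One step from y gives Γ(y) = (dy)_f - Γ(my), because hy = 0
and hdy = 0; one step from my gives Γ(my) = -Γ(hmy). Comparing with y = e + hmy cancels Γ(hmy). -/
theorem Gam_crit (H : MatchedComplex deg wt M d) {i : ℕ} (e : CritCell deg M (i + 1))
    (f : CritCell deg M i) {y : V →₀ R} (hy : y ∈ gr deg (i + 1))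
    (hb : bMap wt M d y = Finsupp.single e.1 1) : Gam deg wt M e.1 f.1 = d y f.1 := by
  obtain ⟨f, hf, rfl⟩ := f
  obtain ⟨e, he, hd⟩ := e
  simp only at hb ⊢
  obtain ⟨h1, h2, h3⟩ := H.of_bMap_eq (hMap_of_not he.notMem_right)
    (mMap_of_not he.notMem_left) hb
  have e1 := H.gamMap_eq f y
  have e2 := H.gamMap_eq f (mMap wt M y)
  have e3 := congrArg (gamMap deg wt M f) h3
  have e4 : gamMap deg wt M f (Finsupp.single e 1) = Gam deg wt M e f := by
    rw [gamMap, Finsupp.linearCombination_single, one_smul]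
  have e5 : y f = 0 := by
    by_contra h
    have : deg f = deg f + 1 := hy (Finsupp.mem_support_iff.2 h)
    omega
  have hmy := H.matching.mMap_mem hy
  have e6 := H.gamMap_eq_zero hf (H.d_sub_m_mem hmy)
  rw [LinearMap.sub_apply, map_sub, h1, H.gamMap_of_hMap_eq_zero hf (H.d_mem hy) h2, e5,
    map_zero] at e1
  rw [H.matching.mMap_apply_crit hf.notMem_right, e6] at e2
  rw [map_add, e4, e1, e2] at e3
  have : Gam deg wt M e f = (0 + (d y f -
    (0 + 0 - gamMap deg wt M f (hMap wt M (mMap wt M y)))) - 0)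
      - gamMap deg wt M f (hMap wt M (mMap wt M y)) := by
    rw [e3]; abel
  rw [this]
  abel

theorem emb_morseD_single (H : MatchedComplex deg wt M d) {i : ℕ} (e : CritCell deg M (i + 1))
    {y : V →₀ R} (hy : y ∈ gr deg (i + 1)) (hb : bMap wt M d y = Finsupp.single e.1 1) :
    emb R deg M i (morseD deg wt M i (Finsupp.single e 1)) = piMap wt M (d y) := by
  classical
  obtain ⟨g, hg⟩ := H.matching.piMap_mem_range (H.d_mem hy)
  rw [← hg]
  congr 1
  have hG : ∀ f : CritCell deg M i, Gam deg wt M e.1 f.1 = g f := by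
    intro f
    rw [H.Gam_crit e f hy hb, ← emb_apply g, hg, H.matching.piMap_eq,
      Finsupp.filter_apply_pos _ _ f.2.1]
  rw [morseD, Finsupp.linearCombination_single, one_smul]
  simp only [hG]
  rw [finsum_eq_sum_of_support_subset (s := g.support)]
  · exact Finsupp.sum_single g
  · intro f hf
    simpa using hf

/-- In operator form the Morse differential is π d b⁻¹. The preimage y is arbitrary because b is
injective, which permits checking on single cells. -/
theorem emb_morseD (H : MatchedComplex deg wt M d) {i : ℕ} (x : CritCell deg M (i + 1) →₀ R)
    {y : V →₀ R} (hb : bMap wt M d y = emb R deg M (i + 1) x) :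
    emb R deg M i (morseD deg wt M i x) = piMap wt M (d y) := by
  induction x using Finsupp.induction_linear generalizing y with
  | zero =>
    rw [map_zero] at hb
    have : y = 0 := H.bMap_injective (by rw [hb, map_zero])
    simp [this]
  | add x x' hx hx' =>
    obtain ⟨z, -, hz⟩ := H.bMap_surj (emb_mem x)
    obtain ⟨z', -, hz'⟩ := H.bMap_surj (emb_mem x')
    have : y = z + z' := H.bMap_injective (by rw [hb, map_add, map_add, hz, hz'])
    rw [map_add, map_add, hx hz, hx' hz', this]
    simp
  | single e a =>
    obtain ⟨z, hz, hbz⟩ := H.bMap_surj (emb_mem (Finsupp.single e (1 : R)))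
    have : y = a • z := H.bMap_injective (by
      rw [hb, map_smul, hbz, single_eq_smul e a, map_smul])
    rw [emb_single] at hbz
    rw [single_eq_smul, map_smul, map_smul, H.emb_morseD_single e hz hbz, this]
    simp

/-- The Morse complex of an exact complex is exact. -/
theorem isFreeRes (H : MatchedComplex deg wt M d) {N : Type*} [AddCommGroup N] [Module R N]
    (ε : (V →₀ R) →ₗ[R] N) (hcrit : ∀ c, deg c = 0 → Critical M c)
    (hex : ∀ i, ∀ x ∈ gr deg (i + 1), d x = 0 → ∃ y ∈ gr deg (i + 2), d y = x)
    (hεd : ∀ x ∈ gr deg 1, ε (d x) = 0)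
    (hε : ∀ x ∈ gr deg 0, ε x = 0 → ∃ y ∈ gr deg 1, d y = x)
    (hsurj : ∀ n, ∃ x ∈ gr deg 0, ε x = n) :
    IsFreeRes R (fun i => CritCell deg M i →₀ R) (morseD deg wt M) (ε ∘ₗ emb R deg M 0) := by
  classical
  -- All cells of degree 0 are critical, so the augmentation needs no correction.
  have hpi0 : ∀ x ∈ gr deg 0, piMap wt M x = x := by
    intro x hx
    rw [H.matching.piMap_eq, Finsupp.filter_eq_self_iff]
    intro c hc
    exact hcrit c (hx (Finsupp.mem_support_iff.2 hc))
  -- Subtracting a boundary from z makes h vanish on it without changing d z; the corrected chain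
  -- lies in the subcomplex and corresponds to a critical chain.
  have lift : ∀ i (z : V →₀ R), z ∈ gr deg (i + 1) → hMap wt M (d z) = 0 →
      ∃ x : CritCell deg M (i + 1) →₀ R,
        emb R deg M i (morseD deg wt M i x) = piMap wt M (d z) := by
    intro i z hz h
    obtain ⟨y, hy, hzy⟩ := H.exists_hMap_sub_eq_zero hz
    have hd : d (z - d y) = d z := by rw [map_sub, H.dd, sub_zero]
    have hmem : z - d y ∈ gr deg (i + 1) := sub_mem hz (H.d_mem hy)
    obtain ⟨x, hx⟩ := H.matching.piMap_mem_range hmem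
    refine ⟨x, ?_⟩
    rw [H.emb_morseD x (y := z - d y), hd]
    rw [bMap_eq_piMap hzy (by rw [hd, h]), hx]
  refine ⟨fun i => inferInstance, fun i x => ⟨fun h => ?_, ?_⟩, fun x => ⟨fun h => ?_, ?_⟩,
    fun n => ?_⟩
  · obtain ⟨y, hy, hb⟩ := H.bMap_surj (emb_mem x)
    obtain ⟨h1, h2, h3⟩ := H.of_bMap_eq (hMap_emb x) (mMap_emb x) hb
    have hdy : d y = 0 := by
      refine H.bMap_injective ?_
      rw [bMap_eq_piMap h2 (by rw [H.dd, map_zero]), ← H.emb_morseD x hb, h]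
      simp
    obtain ⟨z, hz, rfl⟩ := hex i y hy hdy
    obtain ⟨x', hx'⟩ := lift (i + 1) z hz h1
    refine ⟨x', emb_injective _ ?_⟩
    rw [hx', ← bMap_eq_piMap h1 h2, hb]
  · rintro ⟨x, rfl⟩
    obtain ⟨y, hy, hb⟩ := H.bMap_surj (emb_mem x)
    obtain ⟨-, h2, -⟩ := H.of_bMap_eq (hMap_emb x) (mMap_emb x) hb
    refine emb_injective _ ?_
    rw [H.emb_morseD _ (y := d y), H.dd, map_zero, map_zero]
    rw [bMap_eq_piMap h2 (by rw [H.dd, map_zero]), ← H.emb_morseD x hb]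
  · obtain ⟨z, hz, hdz⟩ := hε _ (emb_mem x) h
    obtain ⟨x', hx'⟩ := lift 0 z hz (by rw [hdz, hMap_emb])
    refine ⟨x', emb_injective _ ?_⟩
    rw [hx', hdz, hpi0 _ (emb_mem x)]
  · rintro ⟨x, rfl⟩
    obtain ⟨y, hy, hb⟩ := H.bMap_surj (emb_mem x)
    rw [LinearMap.comp_apply, H.emb_morseD x hb, hpi0 _ (H.d_mem hy), hεd _ hy]
  · obtain ⟨x, hx, rfl⟩ := hsurj n
    obtain ⟨g, hg⟩ := H.matching.piMap_mem_range hx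
    exact ⟨g, by rw [LinearMap.comp_apply, hg, hpi0 _ hx]⟩

end MatchedComplex

end AlgMorse

/-! ### Graded monomial orders -/

/-- A monomial order that refines the order by the length `len`, with finitely many monomials of
each length. -/
structure IsGradedOrder {Mon : Type*} [Monoid Mon] (lt : Mon → Mon → Prop) (len : Mon → ℕ) :
    Prop where
  irrefl : ∀ a, ¬ lt a a
  trans : ∀ a b c, lt a b → lt b c → lt a c
  total : ∀ a b, lt a b ∨ a = b ∨ lt b a
  mul_lt : ∀ a b c e, lt a b → lt (c * a * e) (c * b * e)
  cancel : ∀ a b c : Mon, a * b = a * c → b = c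
  len_mul : ∀ a b, len (a * b) = len a + len b
  len_eq_zero : ∀ a, len a = 0 → a = 1
  lt_of_len_lt : ∀ a b, len a < len b → lt a b
  finite : ∀ N, {w | len w ≤ N}.Finite

namespace IsGradedOrder

variable {Mon : Type*} [Monoid Mon] {lt : Mon → Mon → Prop} {len : Mon → ℕ}

theorem len_le (H : IsGradedOrder lt len) {a b : Mon} (h : lt a b) : len a ≤ len b := by
  by_contra! h'
  exact H.irrefl a (H.trans _ _ _ h (H.lt_of_len_lt _ _ h'))

theorem len_one (H : IsGradedOrder lt len) : len 1 = 0 := by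
  have := H.len_mul 1 1
  rw [mul_one] at this
  omega

theorem len_pos (H : IsGradedOrder lt len) {a : Mon} (h : a ≠ 1) : 0 < len a :=
  Nat.pos_of_ne_zero fun h' => h (H.len_eq_zero a h')

theorem one_lt (H : IsGradedOrder lt len) {a : Mon} (h : a ≠ 1) : lt 1 a :=
  H.lt_of_len_lt _ _ (by rw [H.len_one]; exact H.len_pos h)

theorem len_le_of_dvd (H : IsGradedOrder lt len) {a b : Mon} (h : a ∣ b) : len a ≤ len b := by
  obtain ⟨c, rfl⟩ := h
  rw [H.len_mul]
  omega

theorem len_lt_of_dvd (H : IsGradedOrder lt len) {a b : Mon} (h : a ∣ b) (hne : a ≠ b) :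
    len a < len b := by
  obtain ⟨c, rfl⟩ := h
  have := H.len_pos (a := c) (by rintro rfl; simp at hne)
  rw [H.len_mul]
  omega

theorem ne_mul (H : IsGradedOrder lt len) (a : Mon) {b : Mon} (h : b ≠ 1) : a ≠ a * b := fun h' => by
  have h1 := H.len_mul a b
  have := H.len_pos h
  rw [← h'] at h1
  omega

/-- Only finitely many monomials lie below a given one, and their number drops strictly along `lt`.
-/
theorem wellFounded (H : IsGradedOrder lt len) : WellFounded lt := by
  have hfin : ∀ b, {a | lt a b}.Finite := fun b =>
    (H.finite (len b)).subset fun a ha => H.len_le ha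
  refine Subrelation.wf (fun {a b} h => ?_) (measure fun b => {a | lt a b}.ncard).wf
  exact Set.ncard_lt_ncard ⟨fun c hc => H.trans _ _ _ hc h, fun h' => H.irrefl a (h' h)⟩ (hfin b)

end IsGradedOrder

/-! ### Splittings and the local form of the matching -/

namespace StdMonomials

section Splittings

variable {Mon : Type*} [Monoid Mon]

/-- `u` is a minimal element of `T` for divisibility. -/
def Minl (T : Mon → Prop) (u : Mon) : Prop := T u ∧ ∀ u', u' ∣ u → u' ≠ u → ¬ T u'

/-- `u` is the largest one of the minimal elements of `T` that divide `w`. -/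
def Best (lt : Mon → Mon → Prop) (T : Mon → Prop) (w u : Mon) : Prop :=
  Minl T u ∧ u ∣ w ∧ ∀ u', Minl T u' → u' ∣ w → ¬ lt u u'

variable {lt : Mon → Mon → Prop} {len : Mon → ℕ}

theorem exists_minl (H : IsGradedOrder lt len) (T : Mon → Prop) (w : Mon) (hw : T w) :
    ∃ u, Minl T u ∧ u ∣ w := by
  induction h : len w using Nat.strong_induction_on generalizing w with
  | _ n ih =>
    by_cases hm : Minl T w
    · exact ⟨w, hm, dvd_rfl⟩
    · simp only [Minl, hw, true_and, not_forall, not_not] at hm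
      obtain ⟨u, hu, hne, hT⟩ := hm
      obtain ⟨u', h1, h2⟩ := ih (len u) (h ▸ H.len_lt_of_dvd hu hne) u hT rfl
      exact ⟨u', h1, h2.trans hu⟩

theorem exists_best (H : IsGradedOrder lt len) (T : Mon → Prop) (w : Mon) (hw : T w) :
    ∃ u, Best lt T w u := by
  obtain ⟨u, hu, hd⟩ := exists_minl H T w hw
  have : Finite {u | Minl T u ∧ u ∣ w} :=
    ((H.finite (len w)).subset fun u hu => H.len_le_of_dvd hu.2).to_subtype
  let r : {u | Minl T u ∧ u ∣ w} → {u | Minl T u ∧ u ∣ w} → Prop := fun a b => lt b.1 a.1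
  have : IsTrans _ r := ⟨fun _ _ _ h h' => H.trans _ _ _ h' h⟩
  have : Std.Irrefl r := ⟨fun a => H.irrefl a.1⟩
  obtain ⟨b, -, hb⟩ := (Finite.wellFounded_of_trans_of_irrefl r).has_min Set.univ
    ⟨⟨u, hu, hd⟩, trivial⟩
  exact ⟨b.1, b.2.1, b.2.2, fun u' h1 h2 => hb ⟨u', h1, h2⟩ trivial⟩

theorem Best.unique (H : IsGradedOrder lt len) {T : Mon → Prop} {w u u' : Mon}
    (h : Best lt T w u) (h' : Best lt T w u') : u = u' := by
  rcases H.total u u' with h1 | h1 | h1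
  · exact absurd h1 (h.2.2 _ h'.1 h'.2.1)
  · exact h1
  · exact absurd h1 (h'.2.2 _ h.1 h.2.1)

end Splittings

variable {k A Mon : Type*} [Field k] [Ring A] [Algebra k A] [Monoid Mon]

/-- The properties of the standard monomials of a quotient by an ideal with a Gröbner basis. -/
structure Admissible (D : StdMonomials k A Mon) (len : Mon → ℕ) : Prop where
  order : IsGradedOrder D.lt len
  left_mem : ∀ a b, a * b ∈ D.G → a ≠ 1 → a ∈ D.G
  right_mem : ∀ a b, a * b ∈ D.G → b ≠ 1 → b ∈ D.G
  one_notMem : (1 : Mon) ∉ D.G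
  exists_repr : ∀ w, ∃ r, D.IsRepr (D.val w) r ∧ ∀ v ∈ r.support, v = w ∨ D.lt v w
  indep : ∀ r : Mon →₀ k, (∀ v ∈ r.support, v ∈ D.G ∨ v = 1) →
    r.sum (fun v t => t • D.val v) = 0 → r = 0
  span : ∀ a, a ∈ Submodule.span k (Set.range D.val)

/-- `Q p w` says that the cells `[p|w|…]` survive the matchings in the coordinates before that of
`w`. The list `p` is in reverse order. -/
def Q (D : StdMonomials k A Mon) : List Mon → Mon → Prop
  | [], w => w ∈ D.G
  | u :: p, w => w ∈ D.G ∧ Minl (Q D p) u ∧ ¬ (u * w ∈ D.G ∧ Best D.lt (Q D p) (u * w) u)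

variable {D : StdMonomials k A Mon} {len : Mon → ℕ}

theorem Q.mem {p : List Mon} {w : Mon} (h : D.Q p w) : w ∈ D.G := by
  cases p with
  | nil => exact h
  | cons u p => exact h.1

namespace Admissible

theorem ne_one (H : D.Admissible len) {w : Mon} (h : w ∈ D.G) : w ≠ 1 :=
  fun h' => H.one_notMem (h' ▸ h)

/-- If the preceding entry u were the chosen splitting of u v', it would also be that of u v: the
product u v is standard as a left factor, and fewer minimal elements compete below it. -/
theorem Q_up (H : D.Admissible len) {p : List Mon} {v v' : Mon} (h : D.Q p v) (hd : v ∣ v')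
    (h' : v' ∈ D.G) : D.Q p v' := by
  cases p with
  | nil => exact h'
  | cons u p =>
    obtain ⟨h1, h2, h3⟩ := h
    refine ⟨h', h2, fun ⟨h4, h5⟩ => h3 ?_⟩
    obtain ⟨c, rfl⟩ := hd
    rw [← mul_assoc] at h4 h5
    refine ⟨H.left_mem _ c h4 fun h6 => ?_, h5.1, dvd_mul_right _ _, fun u' hu' hd =>
      h5.2.2 u' hu' (hd.mul_right c)⟩
    have := H.order.len_mul u v
    rw [h6, H.order.len_one] at this
    have := H.order.len_pos (H.ne_one h1)
    omega

theorem splits_iff {B : Set D.Cell} {p : List Mon}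
    (hB : ∀ w s (c : D.Cell), c.1 = p.reverse ++ w :: s → (c ∈ B ↔ D.Q p w)) {s : List Mon}
    (hp : ∀ w ∈ p, w ∈ D.G) (hs : ∀ w ∈ s, w ∈ D.G) {w u : Mon} :
    D.Splits B p.reverse s w u ↔ D.Q p u ∧ ∃ v ∈ D.G, u * v = w := by
  constructor
  · rintro ⟨v, rfl, c, hc, hcs⟩
    rw [List.append_assoc] at hcs
    exact ⟨(hB _ _ c hcs).1 hc, v, c.2 v (by simp [hcs]), rfl⟩
  · rintro ⟨hQ, v, hv, rfl⟩
    have hc : ∀ w ∈ p.reverse ++ u :: v :: s, w ∈ D.G := by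
      intro w hw
      simp only [List.mem_append, List.mem_reverse, List.mem_cons] at hw
      rcases hw with hw | rfl | rfl | hw
      exacts [hp _ hw, hQ.mem, hv, hs _ hw]
    exact ⟨v, rfl, ⟨_, hc⟩, (hB u (v :: s) ⟨_, hc⟩ rfl).2 hQ, by simp⟩

/-- A splitting needs a right factor in `G`, hence different from 1, while `Best` admits the trivial
divisor; this is the source of the condition u ≠ w. -/
theorem chosen_iff (H : D.Admissible len) {B : Set D.Cell} {p : List Mon}
    (hB : ∀ w s (c : D.Cell), c.1 = p.reverse ++ w :: s → (c ∈ B ↔ D.Q p w)) {s : List Mon}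
    (hp : ∀ w ∈ p, w ∈ D.G) (hs : ∀ w ∈ s, w ∈ D.G) {w u : Mon} (hw : w ∈ D.G) :
    D.Chosen B p.reverse s w u ↔ Best D.lt (D.Q p) w u ∧ u ≠ w := by
  have hsp : ∀ u, D.Splits B p.reverse s w u ↔ D.Q p u ∧ u ∣ w ∧ u ≠ w := by
    intro u
    rw [splits_iff hB hp hs]
    refine and_congr_right fun hu => ⟨?_, ?_⟩
    · rintro ⟨v, hv, rfl⟩
      exact ⟨dvd_mul_right _ _, H.order.ne_mul _ (H.ne_one hv)⟩
    · rintro ⟨⟨v, rfl⟩, hne⟩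
      exact ⟨v, H.right_mem _ _ hw fun h => hne (by simp [h]), rfl⟩
  have hmin : ∀ u, D.MinSplits B p.reverse s w u ↔ Minl (D.Q p) u ∧ u ∣ w ∧ u ≠ w := by
    intro u
    simp only [MinSplits, hsp, Minl]
    constructor
    · rintro ⟨⟨h1, h2, h3⟩, h4⟩
      refine ⟨⟨h1, fun u' hd hne hQ => h4 u' hd hne ⟨hQ, hd.trans h2, ?_⟩⟩, h2, h3⟩
      rintro rfl
      have := H.order.len_lt_of_dvd hd hne
      have := H.order.len_le_of_dvd h2
      omega
    · rintro ⟨⟨h1, h2⟩, h3, h4⟩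
      exact ⟨⟨h1, h3, h4⟩, fun u' hd hne h => h2 u' hd hne h.1⟩
  simp only [Chosen, hmin, Best]
  constructor
  · rintro ⟨⟨h1, h2, h3⟩, h4⟩
    refine ⟨⟨h1, h2, fun u' hu' hd => h4 u' ⟨hu', hd, ?_⟩⟩, h3⟩
    rintro rfl
    exact hu'.2 u h2 h3 h1.1
  · rintro ⟨⟨h1, h2, h3⟩, h4⟩
    exact ⟨⟨h1, h2, h4⟩, fun u' hu' => h3 u' hu'.1 hu'.2.1⟩

/-- Membership of both ends in `B` is automatic: u survives by minimality, and u v survives by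
`Q_up`. -/
theorem mem_matchAt_iff (H : D.Admissible len) {B : Set D.Cell} {p : List Mon}
    (hB : ∀ w s (c : D.Cell), c.1 = p.reverse ++ w :: s → (c ∈ B ↔ D.Q p w)) (c c' : D.Cell)
    {u v : Mon} {s : List Mon} (hc : c.1 = p.reverse ++ u :: v :: s)
    (hc' : c'.1 = p.reverse ++ (u * v) :: s) :
    (c, c') ∈ D.matchAt B p.length ↔ Best D.lt (D.Q p) (u * v) u := by
  have hp : ∀ w ∈ p, w ∈ D.G := fun w hw => c.2 w (by simp [hc, hw])
  have hs : ∀ w ∈ s, w ∈ D.G := fun w hw => c.2 w (by simp [hc, hw])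
  have huv : u * v ∈ D.G := c'.2 _ (by simp [hc'])
  have hv : v ∈ D.G := c.2 _ (by simp [hc])
  constructor
  · rintro ⟨-, -, p', s', u', v', hl, h1, h2, h3⟩
    simp only at h1 h2
    rw [hc, List.append_assoc] at h1
    obtain ⟨rfl, h4⟩ := List.append_inj h1 (by simp [hl])
    simp only [List.cons_append, List.nil_append, List.cons.injEq] at h4
    obtain ⟨rfl, rfl, rfl⟩ := h4
    exact ((chosen_iff H hB hp hs huv).1 h3).1
  · intro hb
    refine ⟨(hB _ _ c hc).2 hb.1.1, (hB _ _ c' hc').2 (H.Q_up hb.1.1 (dvd_mul_right _ _) huv),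
      p.reverse, s, u, v, by simp, by simp [hc], by simp [hc'],
      (chosen_iff H hB hp hs huv).2 ⟨hb, H.order.ne_mul _ (H.ne_one hv)⟩⟩

/-- A cell leaves at coordinate j in one of two ways: its entry there is not minimal and splits, or
that entry is the chosen splitting of its product with the next one. Neither test looks further
right. -/
theorem mem_critAfter (H : D.Admissible len) (p : List Mon) :
    ∀ w s (c : D.Cell), c.1 = p.reverse ++ w :: s → (c ∈ D.critAfter p.length ↔ D.Q p w) := by
  induction p with
  | nil =>
    intro w s c hc
    have : w ∈ D.G := c.2 w (by simp [hc])
    simp [critAfter, Q, this]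
  | cons u p ih =>
    intro w s c hc
    rw [List.reverse_cons, List.append_assoc] at hc
    replace hc : c.1 = p.reverse ++ u :: w :: s := hc
    have hp : ∀ w ∈ p, w ∈ D.G := fun x hx => c.2 x (by simp [hc, hx])
    have hs : ∀ x ∈ s, x ∈ D.G := fun x hx => c.2 x (by simp [hc, hx])
    have hw : w ∈ D.G := c.2 w (by simp [hc])
    have hu : u ∈ D.G := c.2 u (by simp [hc])
    change (c ∈ D.critAfter p.length ∧ AlgMorse.Critical (D.matchAt (D.critAfter p.length) p.length) c)
      ↔ _
    rw [ih _ _ c hc]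
    have cell : ∀ {l : List Mon}, (∀ x ∈ l, x ∈ D.G) → ∀ x ∈ p.reverse ++ (l ++ s), x ∈ D.G := by
      intro l hl x hx
      simp only [List.mem_append, List.mem_reverse] at hx
      rcases hx with hx | hx | hx
      exacts [hp x hx, hl x hx, hs x hx]
    constructor
    · rintro ⟨hQ, hcr⟩
      refine ⟨hw, ?_, ?_⟩
      -- A surviving but nonminimal entry has a chosen proper splitting, which makes the cell a
      -- lower end.
      · by_contra hm
        obtain ⟨u₀, hb⟩ := exists_best H.order (D.Q p) u hQ
        obtain ⟨v₀, rfl⟩ := hb.2.1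
        have hv₀ : v₀ ∈ D.G := H.right_mem _ _ hu fun h => hm (by simpa [h] using hb.1)
        have hcell := cell (l := [u₀, v₀, w])
          (by simp only [List.forall_mem_cons]; exact ⟨hb.1.1.mem, hv₀, hw, by simp⟩)
        exact (hcr _ ((H.mem_matchAt_iff ih ⟨_, hcell⟩ c rfl hc).2 hb)).2 rfl
      · rintro ⟨huw, hb⟩
        have hcell := cell (l := [u * w]) (by simpa using huw)
        exact (hcr _ ((H.mem_matchAt_iff ih c ⟨_, hcell⟩ hc rfl).2 hb)).1 rfl
    · rintro ⟨-, hm, hn⟩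
      refine ⟨hm.1, ?_⟩
      rintro ⟨c₁, c₂⟩ he
      have he' := he
      obtain ⟨-, -, p', s', u', v', hl, h1, h2, h3⟩ := he
      simp only at h1 h2 ⊢
      rw [List.append_assoc] at h1 h2
      constructor
      · rintro rfl
        rw [hc] at h1
        obtain ⟨rfl, h4⟩ := List.append_inj h1 (by simp [hl])
        simp only [List.cons_append, List.nil_append, List.cons.injEq] at h4
        obtain ⟨rfl, rfl, rfl⟩ := h4
        exact hn ⟨c₂.2 _ (by simp [h2]), (H.mem_matchAt_iff ih c₁ c₂ hc h2).1 he'⟩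
      · rintro rfl
        rw [hc] at h2
        obtain ⟨rfl, h4⟩ := List.append_inj h2 (by simp [hl])
        simp only [List.cons_append, List.nil_append, List.cons.injEq] at h4
        obtain ⟨rfl, rfl⟩ := h4
        obtain ⟨h5, h6⟩ := (chosen_iff H ih hp (fun x hx => c₁.2 x (by simp [h1, hx])) hu).1 h3
        exact hm.2 u' h5.2.1 h6 h5.1.1

theorem mem_matching_iff (H : D.Admissible len) (c c' : D.Cell) :
    (c, c') ∈ D.matching ↔ ∃ p u v s, c.1 = p.reverse ++ u :: v :: s ∧
      c'.1 = p.reverse ++ (u * v) :: s ∧ Best D.lt (D.Q p) (u * v) u := by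
  simp only [matching, Set.mem_iUnion]
  constructor
  · rintro ⟨j, h⟩
    have h' := h
    obtain ⟨-, -, p, s, u, v, hl, h1, h2, h3⟩ := h
    simp only [List.append_assoc, List.cons_append, List.nil_append] at h1 h2
    rw [← p.reverse_reverse] at h1 h2
    refine ⟨p.reverse, u, v, s, h1, h2, ?_⟩
    rw [← hl, ← List.length_reverse] at h'
    exact (H.mem_matchAt_iff (H.mem_critAfter _) c c' h1 h2).1 h'
  · rintro ⟨p, u, v, s, h1, h2, h3⟩
    exact ⟨p.length, (H.mem_matchAt_iff (H.mem_critAfter _) c c' h1 h2).2 h3⟩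

end Admissible

end StdMonomials

/-! ### Normal forms and coefficients of the bar differential -/

namespace StdMonomials

variable {k A Mon : Type*} [Field k] [Ring A] [Algebra k A] [Monoid Mon]
  {D : StdMonomials k A Mon} {len : Mon → ℕ}

theorem isRepr_iff {a : A} {r : Mon →₀ k} : D.IsRepr a r ↔
    r ∈ Finsupp.supported k k {v | v ∈ D.G ∨ v = 1} ∧ Finsupp.linearCombination k D.val r = a :=
  and_congr_left' (by rw [Finsupp.mem_supported]; rfl)

namespace Admissible

theorem exists_isRepr (H : D.Admissible len) (a : A) : ∃ r, D.IsRepr a r := by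
  have : a ∈ Submodule.map (Finsupp.linearCombination k D.val)
      (Finsupp.supported k k {v | v ∈ D.G ∨ v = 1}) := by
    refine Submodule.span_le.2 ?_ (H.span a)
    rintro _ ⟨w, rfl⟩
    obtain ⟨r, hr, -⟩ := H.exists_repr w
    exact ⟨r, isRepr_iff.1 hr⟩
  obtain ⟨r, hr⟩ := this
  exact ⟨r, isRepr_iff.2 hr⟩

theorem isRepr_repr (H : D.Admissible len) (a : A) : D.IsRepr a (D.repr a) := by
  rw [repr, dif_pos (H.exists_isRepr a)]
  exact (H.exists_isRepr a).choose_spec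

theorem repr_eq (H : D.Admissible len) {a : A} {r : Mon →₀ k} (h : D.IsRepr a r) :
    D.repr a = r := by
  have h1 := isRepr_iff.1 h
  have h2 := isRepr_iff.1 (H.isRepr_repr a)
  refine sub_eq_zero.1 (H.indep _ (fun v hv => sub_mem h2.1 h1.1 hv) ?_)
  change Finsupp.linearCombination k D.val _ = 0
  rw [map_sub, h1.2, h2.2, sub_self]

/-- The coefficients in the basis of standard monomials. -/
def reprL (H : D.Admissible len) : A →ₗ[k] (Mon →₀ k) where
  toFun := D.repr
  map_add' a b := by
    have h1 := isRepr_iff.1 (H.isRepr_repr a)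
    have h2 := isRepr_iff.1 (H.isRepr_repr b)
    exact H.repr_eq (isRepr_iff.2 ⟨add_mem h1.1 h2.1, by rw [map_add, h1.2, h2.2]⟩)
  map_smul' t a := by
    have h1 := isRepr_iff.1 (H.isRepr_repr a)
    exact H.repr_eq (isRepr_iff.2 ⟨Submodule.smul_mem _ _ h1.1, by rw [map_smul, h1.2]; rfl⟩)

theorem repr_val (H : D.Admissible len) {w : Mon} (hw : w ∈ D.G ∨ w = 1) :
    D.repr (D.val w) = Finsupp.single w 1 := by
  refine H.repr_eq (isRepr_iff.2 ⟨Finsupp.single_mem_supported _ _ hw, ?_⟩)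
  simp

theorem eq_or_lt_of_repr (H : D.Admissible len) {v w : Mon} (h : D.repr (D.val w) v ≠ 0) :
    v = w ∨ D.lt v w := by
  obtain ⟨r, hr, hlt⟩ := H.exists_repr w
  rw [H.repr_eq hr] at h
  exact hlt v (Finsupp.mem_support_iff.2 h)

theorem nontrivial (H : D.Admissible len) : Nontrivial A := by
  refine ⟨1, 0, fun h => ?_⟩
  have := H.indep (Finsupp.single 1 1)
    (fun v hv => Or.inr (by simpa using (Finsupp.support_single_subset hv)))
    (by simp [h])
  simp at this

theorem env_nontrivial (H : D.Admissible len) : Nontrivial (Env k A) := by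
  have := H.nontrivial
  infer_instance

end Admissible

theorem contraction_apply (p : List Mon) (w : Mon) (s l : List Mon) :
    D.contraction p w s l = (D.repr (D.val w)).sum fun v a =>
      Finsupp.single (p ++ [v] ++ s) (algebraMap k (Env k A) a) l := by
  rw [contraction, Finsupp.sum_apply]

theorem exists_of_contraction_ne_zero {p : List Mon} {w : Mon} {s l : List Mon}
    (h : D.contraction p w s l ≠ 0) : ∃ v, D.repr (D.val w) v ≠ 0 ∧ l = p ++ v :: s := by
  classical
  rw [contraction_apply] at h
  obtain ⟨v, hv, hne⟩ := Finset.exists_ne_zero_of_sum_ne_zero h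
  refine ⟨v, Finsupp.mem_support_iff.1 hv, ?_⟩
  dsimp only at hne
  rw [Finsupp.single_apply] at hne
  simpa [eq_comm] using (ite_ne_right_iff.1 hne).1

theorem take_append_cons_cons_drop (l : List Mon) (j : ℕ) (h : j + 1 < l.length) :
    l = l.take j ++ l.getD j 1 :: l.getD (j + 1) 1 :: l.drop (j + 2) := by
  conv_lhs => rw [← List.take_append_drop j l, List.drop_eq_getElem_cons (by omega),
    List.drop_eq_getElem_cons h]
  rw [List.getD_eq_getElem _ _ (by omega), List.getD_eq_getElem _ _ h]

/-- Formulated modulo an ideal to serve twice: the zero ideal describes the edges, the maximal ideal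
enters the minimality argument. -/
theorem exists_of_bdCoeff_notMem (I : Ideal (Env k A)) {c c' : D.Cell} (h : D.bdCoeff c c' ∉ I) :
    (∃ w, c.1 = w :: c'.1 ∧ (D.val w ⊗ₜ[k] 1 : Env k A) ∉ I) ∨
    (∃ w, c.1 = c'.1 ++ [w] ∧ (1 ⊗ₜ[k] MulOpposite.op (D.val w) : Env k A) ∉ I) ∨
    ∃ p a b s v, c.1 = p ++ a :: b :: s ∧ c'.1 = p ++ v :: s ∧ D.repr (D.val (a * b)) v ≠ 0 := by
  classical
  by_contra! hcon
  obtain ⟨h1, h2, h3⟩ := hcon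
  refine h ?_
  rw [bdCoeff]
  rcases hc : c.1 with _ | ⟨w, t⟩
  · simp [boundary]
  rw [boundary, Finsupp.add_apply, Finsupp.add_apply, Finsupp.finsetSum_apply]
  refine I.add_mem (I.add_mem ?_ (I.sum_mem fun j hj => ?_)) ?_
  · rw [Finsupp.single_apply]
    split_ifs with ht
    · exact h1 w (by rw [hc, ht])
    · exact I.zero_mem
  · rw [Finsupp.smul_apply]
    refine I.smul_mem _ ?_
    by_contra hne
    obtain ⟨v, hv, hv'⟩ := exists_of_contraction_ne_zero
      (fun h0 => hne (h0 ▸ I.zero_mem))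
    have := take_append_cons_cons_drop (w :: t) j (by simpa using hj)
    exact hv (h3 _ _ _ _ v (hc.trans this) hv')
  · rw [Finsupp.single_apply]
    split_ifs with ht
    · refine I.mul_mem_left _ (h2 _ ?_)
      rw [← ht, hc, List.getLastD_cons, ← List.getLast_eq_getLastD,
        List.dropLast_append_getLast]
      simp
    · exact I.zero_mem

theorem exists_of_bdCoeff_ne_zero {c c' : D.Cell} (h : D.bdCoeff c c' ≠ 0) :
    (∃ w, c.1 = w :: c'.1) ∨ (∃ w, c.1 = c'.1 ++ [w]) ∨
    ∃ p a b s v, c.1 = p ++ a :: b :: s ∧ c'.1 = p ++ v :: s ∧ D.repr (D.val (a * b)) v ≠ 0 := by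
  rcases exists_of_bdCoeff_notMem ⊥ (c := c) (c' := c') (by simpa using h) with
    ⟨w, h1, -⟩ | ⟨w, h1, -⟩ | h1
  exacts [Or.inl ⟨w, h1⟩, Or.inr (Or.inl ⟨w, h1⟩), Or.inr (Or.inr h1)]

theorem deg_of_bdCoeff_ne_zero {c c' : D.Cell} (h : D.bdCoeff c c' ≠ 0) :
    D.deg c = D.deg c' + 1 := by
  unfold deg
  rcases exists_of_bdCoeff_ne_zero h with ⟨w, h⟩ | ⟨w, h⟩ | ⟨p, a, b, s, v, h, h', -⟩
  · simp [h]
  · simp [h]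
  · simp only [h, h', List.length_append, List.length_cons]
    omega

/-- No other face of c can equal c': at the position of u v, faces taken further left show v and
faces taken further right show u, both different from u v. The coefficient is thus a single sign, a
central unit. -/
theorem Admissible.bdCoeff_split (H : D.Admissible len) {c c' : D.Cell} {p s : List Mon} {u v : Mon}
    (hc : c.1 = p ++ u :: v :: s) (hc' : c'.1 = p ++ (u * v) :: s) :
    D.bdCoeff c c' = (-1) ^ (p.length + 1) := by
  classical
  have hu : u ≠ 1 := H.ne_one (c.2 u (by simp [hc]))
  have hv : v ≠ 1 := H.ne_one (c.2 v (by simp [hc]))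
  have huv : u * v ∈ D.G := c'.2 _ (by simp [hc'])
  have ne1 : u ≠ u * v := H.order.ne_mul _ hv
  have ne2 : v ≠ u * v := fun h => by
    have h1 := H.order.len_mul u v
    have := H.order.len_pos hu
    rw [← h] at h1
    omega
  have e0 : c'.1[p.length]? = some (u * v) := by simp [hc']
  have e1 : c.1[p.length]? = some u := by simp [hc]
  have e2 : c.1[p.length + 1]? = some v := by simp [hc]
  have elen : c.1.length = p.length + s.length + 2 := by simp [hc]; omega
  rw [bdCoeff]
  rcases h : c.1 with _ | ⟨w, t⟩
  · simp [h] at hc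
  rw [h] at e1 e2 elen
  have hj : p.length < t.length := by simp at elen; omega
  rw [boundary, Finsupp.add_apply, Finsupp.add_apply, Finsupp.finsetSum_apply,
    Finsupp.single_eq_of_ne, Finsupp.single_eq_of_ne,
    Finset.sum_eq_single_of_mem p.length (Finset.mem_range.2 hj)]
  · have h1 : (w :: t).take p.length = p := by rw [← h, hc]; simp
    have h2 : (w :: t).drop (p.length + 2) = s := by rw [← h, hc]; simp [List.drop_append]
    have h3 : (w :: t).getD p.length 1 = u := by rw [List.getD_eq_getElem?_getD, e1]; rfl
    have h4 : (w :: t).getD (p.length + 1) 1 = v := by rw [List.getD_eq_getElem?_getD, e2]; rfl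
    rw [h1, h2, h3, h4, Finsupp.smul_apply, contraction, H.repr_val (Or.inl huv),
      Finsupp.sum_single_index (by simp), hc']
    simp [← Algebra.TensorProduct.one_def]
  · intro j hjm hne
    rw [Finsupp.smul_apply]
    by_contra h0
    obtain ⟨x, -, hx⟩ := exists_of_contraction_ne_zero (fun h1 => h0 (by rw [h1, smul_zero]))
    have hjt : j < t.length := Finset.mem_range.1 hjm
    rw [hx] at e0
    have hlen : ((w :: t).take j).length = j := by simp; omega
    rcases lt_or_gt_of_ne hne with hlt | hlt
    · rw [List.getElem?_append_right (by omega), hlen, show p.length - j = (p.length - j - 1) + 1 by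
        omega, List.getElem?_cons_succ, List.getElem?_drop, show j + 2 + (p.length - j - 1) =
        p.length + 1 by omega, e2] at e0
      exact ne2 (Option.some_inj.1 e0)
    · rw [List.getElem?_append_left (by omega), List.getElem?_take_of_lt hlt, e1] at e0
      exact ne1 (Option.some_inj.1 e0)
  · intro h0
    rw [h0, List.getElem?_dropLast, if_pos (by simp; omega), e1] at e0
    exact ne1 (Option.some_inj.1 e0)
  · intro h0
    rw [h0] at e0
    rw [List.getElem?_cons_succ, e0] at e2
    exact ne2 (Option.some_inj.1 e2).symm

end StdMonomials

/-! ### The matching is acyclic -/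

namespace StdMonomials

variable {k A Mon : Type*} [Field k] [Ring A] [Algebra k A] [Monoid Mon]
  {D : StdMonomials k A Mon} {len : Mon → ℕ}

open Classical in
/-- The largest one of the minimal splittings of `w`. -/
def best (D : StdMonomials k A Mon) (p : List Mon) (w : Mon) : Mon :=
  if h : ∃ u, Best D.lt (D.Q p) w u then h.choose else 1

open Classical in
/-- A list of monomials that weakly increases along the edges that preserve the product of the
entries. It is `[…,u,1]` for the upper end of the matching edge `[…|u|v|…] ⟶ […|uv|…]`, and `[…,u]`
for the lower one. -/
def key (D : StdMonomials k A Mon) : List Mon → List Mon → List Mon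
  | _, [] => [1]
  | p, w :: s => if Minl (D.Q p) w then w :: key D (w :: p) s else
      if D.Q p w then [best D p w] else [1]

theorem best_eq (H : D.Admissible len) {p : List Mon} {w u : Mon}
    (h : Best D.lt (D.Q p) w u) : best D p w = u := by
  rw [best, dif_pos ⟨u, h⟩]
  exact (⟨u, h⟩ : ∃ u, Best D.lt (D.Q p) w u).choose_spec.unique H.order h

theorem best_spec (H : D.Admissible len) {p : List Mon} {w : Mon} (h : D.Q p w) :
    Best D.lt (D.Q p) w (best D p w) := by
  obtain ⟨u, hu⟩ := exists_best H.order _ _ h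
  rwa [best_eq H hu]

theorem key_of_minl {p : List Mon} {w : Mon} {s : List Mon} (h : Minl (D.Q p) w) :
    D.key p (w :: s) = w :: D.key (w :: p) s := by
  rw [key, if_pos h]

theorem key_of_Q {p : List Mon} {w : Mon} {s : List Mon} (h : ¬ Minl (D.Q p) w) (h' : D.Q p w) :
    D.key p (w :: s) = [best D p w] := by
  rw [key, if_neg h, if_pos h']

theorem key_of_not_Q {p : List Mon} {w : Mon} {s : List Mon} (h' : ¬ D.Q p w) :
    D.key p (w :: s) = [1] := by
  rw [key, if_neg fun h => h' h.1, if_neg h']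

/-- The entries before a surviving entry are kept by `key`. -/
theorem key_append {p : List Mon} : ∀ {w : Mon} (_ : D.Q p w) (s : List Mon),
    D.key [] (p.reverse ++ s) = p.reverse ++ D.key p s := by
  induction p with
  | nil => simp
  | cons u p ih =>
    intro w h s
    rw [List.reverse_cons, List.append_assoc, List.append_assoc, List.singleton_append,
      ih h.2.1.1, key_of_minl h.2.1]
    rfl

namespace Admissible

theorem key_upper {p : List Mon} {u v : Mon} {s : List Mon}
    (huv : u * v ∈ D.G) (h : Best D.lt (D.Q p) (u * v) u) :
    D.key [] (p.reverse ++ u :: v :: s) = p.reverse ++ [u, 1] := by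
  rw [key_append h.1.1, key_of_minl h.1, key_of_not_Q]
  exact fun h' => h'.2.2 ⟨huv, h⟩

theorem key_lower (H : D.Admissible len) {p : List Mon} {u v : Mon} {s : List Mon}
    (hv : v ≠ 1) (huv : u * v ∈ D.G) (h : Best D.lt (D.Q p) (u * v) u) :
    D.key [] (p.reverse ++ (u * v) :: s) = p.reverse ++ [u] := by
  rw [key_append h.1.1, key_of_Q _ (H.Q_up h.1.1 (dvd_mul_right _ _) huv), best_eq H h]
  exact fun h' => h'.2 u (dvd_mul_right _ _) (H.order.ne_mul u hv) h.1.1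

/-- The weak lexicographic order. -/
def _root_.StdMonomials.KeyLE (D : StdMonomials k A Mon) (l l' : List Mon) : Prop :=
  l = l' ∨ List.Lex D.lt l l'

/-- Before the merged position both keys agree or have already stopped. There, if a does not
survive, its key ends in 1, the least monomial. Otherwise the key shows a or its best splitting, a
minimal element dividing a b and so not above the best splitting of a b. Equality with a minimal a
would be a matching edge, which is excluded. -/
theorem key_merge (H : D.Admissible len) {a b : Mon} {s : List Mon} (hab : a * b ∈ D.G)
    (hb : b ≠ 1) (q : List Mon) : ∀ p : List Mon,
    ¬ Best D.lt (D.Q (q.reverse ++ p)) (a * b) a →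
    D.KeyLE (D.key p (q ++ a :: b :: s)) (D.key p (q ++ (a * b) :: s)) := by
  induction q with
  | nil =>
    intro p hn
    simp only [List.reverse_nil, List.nil_append] at hn ⊢
    by_cases ha : D.Q p a
    · have hQ := H.Q_up ha (dvd_mul_right a b) hab
      have hm : ¬ Minl (D.Q p) (a * b) := fun h =>
        h.2 a (dvd_mul_right _ _) (H.order.ne_mul a hb) ha
      have hbest := best_spec H hQ
      rw [key_of_Q hm hQ]
      by_cases ham : Minl (D.Q p) a
      · rw [key_of_minl ham]
        rcases H.order.total a (best D p (a * b)) with h | h | h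
        · exact Or.inr (.rel h)
        · exact absurd (by rwa [← h] at hbest) hn
        · exact absurd h (hbest.2.2 a ham (dvd_mul_right _ _))
      · rw [key_of_Q ham ha]
        have hbest' := best_spec H ha
        rcases H.order.total (best D p a) (best D p (a * b)) with h | h | h
        · exact Or.inr (.rel h)
        · exact Or.inl (by rw [h])
        · exact absurd h (hbest.2.2 _ hbest'.1 (hbest'.2.1.mul_right b))
    · rw [key_of_not_Q ha]
      by_cases hm : Minl (D.Q p) (a * b)
      · rw [key_of_minl hm]
        exact Or.inr (.rel (H.order.one_lt (H.ne_one hab)))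
      · by_cases hQ : D.Q p (a * b)
        · rw [key_of_Q hm hQ]
          exact Or.inr (.rel (H.order.one_lt (H.ne_one (best_spec H hQ).1.1.mem)))
        · rw [key_of_not_Q hQ]
          exact Or.inl rfl
  | cons x q ih =>
    intro p hn
    simp only [List.cons_append]
    by_cases hm : Minl (D.Q p) x
    · rw [key_of_minl hm, key_of_minl hm]
      rcases ih (x :: p) (by simpa using hn) with h | h
      · exact Or.inl (by rw [h])
      · exact Or.inr (.cons h)
    · by_cases hQ : D.Q p x
      · rw [key_of_Q hm hQ, key_of_Q hm hQ]
        exact Or.inl rfl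
      · rw [key_of_not_Q hQ, key_of_not_Q hQ]
        exact Or.inl rfl

/-- The key of either end determines p and u, and a final 1 tells upper ends from lower ones. Left
cancellation recovers v from u v. -/
theorem matching_unique (H : D.Admissible len) : ∀ e ∈ D.matching, ∀ e' ∈ D.matching,
    (e.1 = e'.1 ∨ e.1 = e'.2 ∨ e.2 = e'.1 ∨ e.2 = e'.2) → e = e' := by
  rintro ⟨c, l⟩ he ⟨c', l'⟩ he' hor
  obtain ⟨p, u, v, s, h1, h2, h3⟩ := (H.mem_matching_iff _ _).1 he
  obtain ⟨p', u', v', s', h1', h2', h3'⟩ := (H.mem_matching_iff _ _).1 he'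
  have huv : u * v ∈ D.G := l.2 _ (by simp [h2])
  have huv' : u' * v' ∈ D.G := l'.2 _ (by simp [h2'])
  have hv : v ≠ 1 := H.ne_one (c.2 _ (by simp [h1]))
  have hv' : v' ≠ 1 := H.ne_one (c'.2 _ (by simp [h1']))
  have k1 : D.key [] c.1 = (p.reverse ++ [u]) ++ [1] := by
    rw [h1, key_upper huv h3]
    simp
  have k1' : D.key [] c'.1 = (p'.reverse ++ [u']) ++ [1] := by
    rw [h1', key_upper huv' h3']
    simp
  have k2 : D.key [] l.1 = p.reverse ++ [u] := by rw [h2, H.key_lower hv huv h3]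
  have k2' : D.key [] l'.1 = p'.reverse ++ [u'] := by rw [h2', H.key_lower hv' huv' h3']
  have bad : ∀ {c l : D.Cell} {q q' : List Mon} {x : Mon}, c = l → D.key [] c.1 = q ++ [1] →
      D.key [] l.1 = q' ++ [x] → x ∈ D.G → False := by
    rintro c _ q q' x rfl e1 e2 hx
    rw [e1] at e2
    have := (List.append_inj' e2 rfl).2
    simp only [List.cons.injEq, and_true] at this
    exact H.one_notMem (this ▸ hx)
  have fin : p = p' → u = u' → v = v' → s = s' → (c, l) = (c', l') := by
    rintro rfl rfl rfl rfl
    rw [Prod.mk.injEq]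
    exact ⟨Subtype.ext (h1.trans h1'.symm), Subtype.ext (h2.trans h2'.symm)⟩
  rcases hor with h | h | h | h
  · simp only at h
    subst h
    rw [k1] at k1'
    have e := (List.append_inj' (List.append_inj' k1' rfl).1 rfl)
    obtain rfl := List.reverse_injective e.1
    have := e.2
    simp only [List.cons.injEq, and_true] at this
    subst this
    rw [h1] at h1'
    have := List.append_cancel_left h1'
    simp only [List.cons.injEq, true_and] at this
    exact fin rfl rfl this.1 this.2
  · exact (bad h k1 k2' h3'.1.1.mem).elim
  · exact (bad h.symm k1' k2 h3.1.1.mem).elim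
  · simp only at h
    subst h
    rw [k2] at k2'
    have e := List.append_inj' k2' rfl
    obtain rfl := List.reverse_injective e.1
    have := e.2
    simp only [List.cons.injEq, and_true] at this
    subst this
    rw [h2] at h2'
    have := List.append_cancel_left h2'
    simp only [List.cons.injEq] at this
    exact fin rfl rfl (H.order.cancel _ _ _ this.1) this.2

/-- The relation that decreases along the edges of the graph of the matching. -/
def _root_.StdMonomials.Below (D : StdMonomials k A Mon) (len : Mon → ℕ) (c' c : D.Cell) : Prop :=
  len c'.1.prod ≤ len c.1.prod ∧
  (D.lt c'.1.prod c.1.prod ∨ c'.1.prod = c.1.prod ∧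
    (List.Lex D.lt (D.key [] c.1) (D.key [] c'.1) ∨
      D.key [] c.1 = D.key [] c'.1 ∧ c'.1.length < c.1.length))

theorem isTrans_lex (H : D.Admissible len) {l₁ l₂ l₃ : List Mon} (h : List.Lex D.lt l₁ l₂)
    (h' : List.Lex D.lt l₂ l₃) : List.Lex D.lt l₁ l₃ := by
  induction h generalizing l₃ with
  | nil => cases h' <;> exact .nil
  | rel h => cases h' with
    | cons h' => exact .rel h
    | rel h' => exact .rel (H.order.trans _ _ _ h h')
  | cons h ih => cases h' with
    | cons h' => exact .cons (ih h')
    | rel h' => exact .rel h'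

theorem lex_irrefl (H : D.Admissible len) (l : List Mon) : ¬ List.Lex D.lt l l := by
  induction l with
  | nil => exact fun h => nomatch h
  | cons a l ih =>
    rintro (_ | h | h)
    · exact H.order.irrefl _ h
    · exact ih h

theorem below_trans (H : D.Admissible len) {a b c : D.Cell} (h : D.Below len a b)
    (h' : D.Below len b c) : D.Below len a c := by
  refine ⟨h.1.trans h'.1, ?_⟩
  rcases h.2 with h1 | ⟨h1, h2⟩ <;> rcases h'.2 with h1' | ⟨h1', h2'⟩
  · exact Or.inl (H.order.trans _ _ _ h1 h1')
  · exact Or.inl (h1' ▸ h1)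
  · exact Or.inl (h1 ▸ h1')
  · refine Or.inr ⟨h1.trans h1', ?_⟩
    rcases h2 with h2 | ⟨h2, h3⟩ <;> rcases h2' with h2' | ⟨h2', h3'⟩
    · exact Or.inl (H.isTrans_lex h2' h2)
    · exact Or.inl (h2' ▸ h2)
    · exact Or.inl (h2 ▸ h2')
    · exact Or.inr ⟨h2'.trans h2, h3.trans h3'⟩

theorem below_irrefl (H : D.Admissible len) (c : D.Cell) : ¬ D.Below len c c := by
  rintro ⟨-, h | ⟨-, h | ⟨-, h⟩⟩⟩
  · exact H.order.irrefl _ h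
  · exact H.lex_irrefl _ h
  · exact lt_irrefl _ h

theorem length_le_len_prod (H : D.Admissible len) : ∀ l : List Mon, (∀ w ∈ l, w ∈ D.G) →
    l.length ≤ len l.prod ∧ ∀ w ∈ l, len w ≤ len l.prod
  | [], _ => by simp
  | a :: l, h => by
    rw [List.forall_mem_cons] at h
    obtain ⟨h1, h2⟩ := H.length_le_len_prod l h.2
    have := H.order.len_pos (H.ne_one h.1)
    rw [List.prod_cons, H.order.len_mul, List.length_cons, List.forall_mem_cons]
    exact ⟨by omega, by omega, fun w hw => (h2 w hw).trans (by omega)⟩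

/-- Entries have positive length, so the length of the product bounds both the number of entries and
the length of each. -/
theorem cells_finite (H : D.Admissible len) (N : ℕ) : {c : D.Cell | len c.1.prod ≤ N}.Finite := by
  have := (H.order.finite N).to_subtype
  have hf : ((fun l : List {w | len w ≤ N} => l.map Subtype.val) '' {l | l.length ≤ N}).Finite :=
    (List.finite_length_le _ N).image _
  refine Set.Finite.of_finite_image (f := Subtype.val) (hf.subset ?_)
    Subtype.val_injective.injOn
  rintro _ ⟨c, hc, rfl⟩
  obtain ⟨h1, h2⟩ := H.length_le_len_prod c.1 c.2
  refine ⟨c.1.pmap Subtype.mk fun w hw => (h2 w hw).trans hc, ?_, ?_⟩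
  · simpa using h1.trans hc
  · simp [List.map_pmap]

theorem below_wf (H : D.Admissible len) : WellFounded (D.Below len) := by
  have hfin : ∀ b, {a | D.Below len a b}.Finite := fun b =>
    (H.cells_finite (len b.1.prod)).subset fun a ha => ha.1
  refine Subrelation.wf (fun {a b} h => ?_)
    (measure fun b => {a | D.Below len a b}.ncard).wf
  exact Set.ncard_lt_ncard ⟨fun c hc => H.below_trans hc h, fun h' => H.below_irrefl a (h' h)⟩
    (hfin b)

/-- Outer faces shorten the product, and reducing contractions make it smaller in the order. Trivial
contractions preserve the product and never lower the key, while the degree drops. A reversed edge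
appends 1 to the key. -/
theorem below_of_mEdge (H : D.Admissible len) {c c' : D.Cell}
    (h : AlgMorse.MEdge D.deg D.bdCoeff D.matching c c') : D.Below len c' c := by
  rcases h with ⟨⟨-, hne⟩, hM⟩ | ⟨-, hM⟩
  · suffices D.lt c'.1.prod c.1.prod ∨ c'.1.prod = c.1.prod ∧
        (List.Lex D.lt (D.key [] c.1) (D.key [] c'.1) ∨
          D.key [] c.1 = D.key [] c'.1 ∧ c'.1.length < c.1.length) by
      refine ⟨?_, this⟩
      rcases this with h | ⟨h, -⟩
      · exact H.order.len_le h
      · rw [h]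
    rcases exists_of_bdCoeff_ne_zero hne with ⟨w, hw⟩ | ⟨w, hw⟩ | ⟨p, a, b, s, v, hc, hc', hv⟩
    · have := H.order.len_pos (H.ne_one (c.2 w (by simp [hw])))
      refine Or.inl (H.order.lt_of_len_lt _ _ ?_)
      rw [hw, List.prod_cons, H.order.len_mul]
      omega
    · have := H.order.len_pos (H.ne_one (c.2 w (by simp [hw])))
      refine Or.inl (H.order.lt_of_len_lt _ _ ?_)
      rw [hw, List.prod_append, H.order.len_mul, List.prod_singleton]
      omega
    · have pc : c.1.prod = p.prod * (a * b) * s.prod := by simp [hc, mul_assoc]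
      have pc' : c'.1.prod = p.prod * v * s.prod := by simp [hc', mul_assoc]
      rcases H.eq_or_lt_of_repr hv with rfl | hlt
      · refine Or.inr ⟨by rw [pc, pc'], ?_⟩
        have hab : a * b ∈ D.G := c'.2 _ (by simp [hc'])
        have hb : b ∈ D.G := c.2 _ (by simp [hc])
        have hn : ¬ Best D.lt (D.Q (p.reverse ++ [])) (a * b) a := by
          intro hbest
          rw [List.append_nil] at hbest
          exact hM ((H.mem_matching_iff _ _).2 ⟨p.reverse, a, b, s, by simpa using hc,
            by simpa using hc', hbest⟩)
        have hk := H.key_merge (s := s) hab (H.ne_one hb) p [] hn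
        rw [← hc, ← hc'] at hk
        rcases hk with hk | hk
        · exact Or.inr ⟨hk, by simp [hc, hc']⟩
        · exact Or.inl hk
      · left
        rw [pc, pc']
        exact H.order.mul_lt _ _ _ _ hlt
  · obtain ⟨p, u, v, s, h1, h2, h3⟩ := (H.mem_matching_iff _ _).1 hM
    have hp : c'.1.prod = c.1.prod := by simp [h1, h2, mul_assoc]
    have huv : u * v ∈ D.G := c.2 _ (by simp [h2])
    have hv : v ∈ D.G := c'.2 _ (by simp [h1])
    refine ⟨by rw [hp], Or.inr ⟨hp, Or.inl ?_⟩⟩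
    rw [h1, h2, key_upper huv h3, H.key_lower (H.ne_one hv) huv h3]
    generalize p.reverse = q
    induction q with
    | nil => exact .cons .nil
    | cons x q ih => exact .cons ih

theorem mEdge_wf (H : D.Admissible len) :
    WellFounded fun c' c => AlgMorse.MEdge D.deg D.bdCoeff D.matching c c' :=
  Subrelation.wf (fun h => H.below_of_mEdge h) H.below_wf

theorem bdCoeff_of_mem_matching (H : D.Admissible len) {e : D.Cell × D.Cell}
    (he : e ∈ D.matching) : ∃ n, D.bdCoeff e.1 e.2 = (-1) ^ n := by
  obtain ⟨p, u, v, s, h1, h2, -⟩ := (H.mem_matching_iff _ _).1 he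
  exact ⟨_, H.bdCoeff_split h1 h2⟩

theorem isAcyclicMatching (H : D.Admissible len) : D.IsAcyclicMatching := by
  have := H.env_nontrivial
  have hunit : ∀ e ∈ D.matching, IsUnit (D.bdCoeff e.1 e.2) := by
    intro e he
    obtain ⟨n, hn⟩ := H.bdCoeff_of_mem_matching he
    rw [hn]
    exact (isUnit_one (M := Env k A)).neg.pow n
  refine ⟨fun e he => ?_, H.matching_unique, fun e he => ?_, hunit, fun c hc => ?_⟩
  · have hne := (hunit e he).ne_zero
    exact ⟨deg_of_bdCoeff_ne_zero hne, hne⟩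
  · obtain ⟨n, hn⟩ := H.bdCoeff_of_mem_matching he
    rw [hn]
    exact pow_mem (neg_mem (one_mem _)) n
  · have hb : D.Below len c c := by
      have : ∀ {a b}, Relation.TransGen (AlgMorse.MEdge D.deg D.bdCoeff D.matching) a b →
          D.Below len b a := by
        intro a b h
        induction h with
        | single h => exact H.below_of_mEdge h
        | tail _ h ih => exact H.below_trans (H.below_of_mEdge h) ih
      exact this hc
    exact H.below_irrefl c hb

end Admissible

end StdMonomials

/-! ### The contracting homotopy of the bar complex -/

namespace StdMonomials

variable {k A Mon : Type*} [Field k] [Ring A] [Algebra k A] [Monoid Mon]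

theorem env_smul_assoc (t : k) (e : Env k A) (x : A) : (t • e) • x = t • (e • x) := by
  induction e using TensorProduct.induction_on with
  | zero =>
    have h : (0 : Env k A) • x = 0 := by
      have := add_smul (0 : Env k A) 0 x
      rwa [add_zero, left_eq_add] at this
    rw [smul_zero, h, smul_zero]
  | add e e' h h' => rw [smul_add, add_smul, h, h', add_smul, smul_add]
  | tmul a b =>
    obtain ⟨b, rfl⟩ := MulOpposite.op_surjective b
    rw [TensorProduct.smul_tmul', Env.tmul_smul, Env.tmul_smul]
    simp

variable (D : StdMonomials k A Mon) {len : Mon → ℕ}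

/-- The normalized Hochschild complex as one module. -/
abbrev Bar : Type _ := D.Cell →₀ Env k A

/-- Omit the tuples that are not cells. -/
def restrict : (List Mon →₀ Env k A) →ₗ[Env k A] D.Bar :=
  Finsupp.lsubtypeDomain {l : List Mon | ∀ w ∈ l, w ∈ D.G}

/-- The differential of the normalized Hochschild complex. -/
def barD : D.Bar →ₗ[Env k A] D.Bar :=
  Finsupp.linearCombination (Env k A) fun c => D.restrict (D.boundary c.1)

/-- The cell `[]`. -/
def nil : D.Cell := ⟨[], by simp⟩

open Classical in
/-- The augmentation, extended by zero. -/
def barAug : D.Bar →ₗ[Env k A] A :=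
  Finsupp.linearCombination (Env k A) fun c => if c.1 = [] then (1 : A) else 0

/-- `b ↦ (1 ⊗ b)[l]` -/
def rightCell (l : List Mon) : Aᵐᵒᵖ →ₗ[k] D.Bar :=
  D.restrict.restrictScalars k ∘ₗ Finsupp.lsingle l ∘ₗ TensorProduct.mk k A Aᵐᵒᵖ 1

/-- The section of the augmentation, composed with the augmentation. -/
def barEta : D.Bar →ₗ[k] D.Bar :=
  D.rightCell [] ∘ₗ (MulOpposite.opLinearEquiv k).toLinearMap ∘ₗ
    { toFun := D.barAug
      map_add' := map_add D.barAug
      map_smul' := fun t x => by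
        have h : t • x = (t • (1 : Env k A)) • x := by rw [smul_assoc, one_smul]
        rw [h, map_smul, env_smul_assoc, one_smul]
        rfl }

variable {D}

/-- The contracting homotopy `(a ⊗ b)[w₁|…] ↦ ∑_v a_v (1 ⊗ b)[v|w₁|…]`. -/
def Admissible.homotopy (H : D.Admissible len) : D.Bar →ₗ[k] D.Bar :=
  Finsupp.lsum k fun t : D.Cell =>
    TensorProduct.lift (Finsupp.linearCombination k (fun u => D.rightCell (u :: t.1)) ∘ₗ H.reprL)

/-- Scalar multiplication as a linear map over the field. -/
def envSMul (D : StdMonomials k A Mon) (e : Env k A) : D.Bar →ₗ[k] D.Bar where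
  toFun x := e • x
  map_add' := smul_add e
  map_smul' t x := smul_comm e t x

theorem envSMul_apply (e : Env k A) (x : D.Bar) : D.envSMul e x = e • x := rfl

theorem neg_one_pow_succ_smul (n : ℕ) (x : D.Bar) :
    (-1 : Env k A) ^ (n + 1) • x = -((-1 : Env k A) ^ n • x) := by
  have h : ∀ {R M : Type _} [Ring R] [AddCommGroup M] [Module R M] (y : M),
      (-1 : R) ^ (n + 1) • y = -((-1 : R) ^ n • y) := fun y => by
    rw [pow_succ, mul_neg_one, neg_smul]
  exact h x

theorem restrict_single_mul (l : List Mon) (e e' : Env k A) :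
    D.restrict (Finsupp.single l (e * e')) = e • D.restrict (Finsupp.single l e') := by
  rw [← D.restrict.map_smul, Finsupp.smul_single, smul_eq_mul]

theorem restrict_single (c : D.Cell) (x : Env k A) :
    D.restrict (Finsupp.single c.1 x) = Finsupp.single c x := by
  classical
  ext c'
  change Finsupp.single c.1 x c'.1 = _
  rw [Finsupp.single_apply, Finsupp.single_apply]
  exact if_congr Subtype.ext_iff.symm rfl rfl

theorem restrict_single_of_not {l : List Mon} (h : ¬ ∀ w ∈ l, w ∈ D.G) (x : Env k A) :
    D.restrict (Finsupp.single l x) = 0 := by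
  classical
  ext c'
  change Finsupp.single l x c'.1 = _
  rw [Finsupp.single_eq_of_ne]
  · rfl
  · rintro rfl
    exact h c'.2

theorem rightCell_apply (l : List Mon) (b : Aᵐᵒᵖ) :
    D.rightCell l b = D.restrict (Finsupp.single l (1 ⊗ₜ[k] b)) := rfl

theorem rightCell_mul (l : List Mon) (b b' : Aᵐᵒᵖ) :
    D.rightCell l (b * b') = (1 ⊗ₜ[k] b : Env k A) • D.rightCell l b' := by
  rw [rightCell_apply, rightCell_apply, ← map_smul, Finsupp.smul_single, smul_eq_mul,
    Algebra.TensorProduct.tmul_mul_tmul, one_mul]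

theorem barD_single (c : D.Cell) : D.barD (Finsupp.single c 1) = D.restrict (D.boundary c.1) := by
  rw [barD, Finsupp.linearCombination_single, one_smul]

theorem barD_single_apply (c c' : D.Cell) : D.barD (Finsupp.single c 1) c' = D.bdCoeff c c' := by
  rw [barD_single]
  rfl

namespace Admissible

theorem barMap_ext (H : D.Admissible len) {N : Type*} [AddCommGroup N] [Module k N]
    {f g : D.Bar →ₗ[k] N}
    (h : ∀ (t : D.Cell) (v : Mon) (b : Aᵐᵒᵖ), v ∈ D.G ∨ v = 1 →
      f (Finsupp.single t (D.val v ⊗ₜ[k] b)) = g (Finsupp.single t (D.val v ⊗ₜ[k] b))) :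
    f = g := by
  refine Finsupp.lhom_ext' fun t => TensorProduct.ext' fun a b => ?_
  rw [← (H.isRepr_repr a).2, Finsupp.sum, TensorProduct.sum_tmul, map_sum, map_sum]
  refine Finset.sum_congr rfl fun v hv => ?_
  rw [← TensorProduct.smul_tmul', map_smul, map_smul]
  congr 1
  exact h t v b ((H.isRepr_repr a).1 v hv)

theorem homotopy_single (H : D.Admissible len) (t : D.Cell) (a : A) (b : Aᵐᵒᵖ) :
    H.homotopy (Finsupp.single t (a ⊗ₜ[k] b)) =
      (D.repr a).sum fun u x => x • D.rightCell (u :: t.1) b := by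
  rw [homotopy, Finsupp.lsum_single, TensorProduct.lift.tmul, LinearMap.comp_apply,
    Finsupp.linearCombination_apply, Finsupp.sum, LinearMap.sum_apply]
  rfl

theorem homotopy_single_val (H : D.Admissible len) (t : D.Cell) {v : Mon} (hv : v ∈ D.G ∨ v = 1)
    (b : Aᵐᵒᵖ) :
    H.homotopy (Finsupp.single t (D.val v ⊗ₜ[k] b)) = D.rightCell (v :: t.1) b := by
  rw [homotopy_single, H.repr_val hv, Finsupp.sum_single_index (by simp), one_smul]

theorem homotopy_smul (H : D.Admissible len) (b : Aᵐᵒᵖ) (x : D.Bar) :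
    H.homotopy ((1 ⊗ₜ[k] b : Env k A) • x) = (1 ⊗ₜ[k] b : Env k A) • H.homotopy x := by
  suffices H.homotopy ∘ₗ D.envSMul (1 ⊗ₜ[k] b) = D.envSMul (1 ⊗ₜ[k] b) ∘ₗ H.homotopy from
    LinearMap.congr_fun this x
  refine H.barMap_ext (N := D.Bar) fun t v b' hv => ?_
  rw [LinearMap.comp_apply, LinearMap.comp_apply, envSMul_apply, envSMul_apply,
    Finsupp.smul_single, smul_eq_mul, Algebra.TensorProduct.tmul_mul_tmul, one_mul,
    H.homotopy_single_val t hv, H.homotopy_single_val t hv, rightCell_mul]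

/-- `[l] ↦ [v|l]`, as a part of the homotopy. -/
theorem homotopy_rightCell (H : D.Admissible len) {v : Mon} (hv : v ∈ D.G ∨ v = 1)
    (l : List Mon) (b : Aᵐᵒᵖ) :
    H.homotopy ((D.val v ⊗ₜ[k] 1 : Env k A) • D.rightCell l b) = D.rightCell (v :: l) b := by
  by_cases hl : ∀ w ∈ l, w ∈ D.G
  · obtain ⟨c, rfl⟩ : ∃ c : D.Cell, c.1 = l := ⟨⟨l, hl⟩, rfl⟩
    rw [rightCell_apply, restrict_single c, Finsupp.smul_single, smul_eq_mul,
      Algebra.TensorProduct.tmul_mul_tmul, one_mul, mul_one, H.homotopy_single_val _ hv]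
  · rw [rightCell_apply, restrict_single_of_not hl, smul_zero, map_zero, rightCell_apply,
      restrict_single_of_not]
    exact fun h => hl fun w hw => h w (List.mem_cons_of_mem v hw)

theorem rightCell_one_cons (H : D.Admissible len) (l : List Mon) (b : Aᵐᵒᵖ) :
    D.rightCell (1 :: l) b = 0 := by
  rw [rightCell_apply, restrict_single_of_not]
  exact fun h => H.one_notMem (h 1 List.mem_cons_self)

theorem _root_.StdMonomials.restrict_contraction (p : List Mon) (w : Mon) (s : List Mon) :
    D.restrict (D.contraction p w s) = (D.repr (D.val w)).sum fun v a =>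
      a • D.rightCell (p ++ [v] ++ s) 1 := by
  rw [contraction, Finsupp.sum, map_sum]
  refine Finset.sum_congr rfl fun v _ => ?_
  dsimp only
  rw [← map_smul, rightCell_apply, TensorProduct.tmul_smul, ← Algebra.TensorProduct.one_def,
    ← Algebra.algebraMap_eq_smul_one]

theorem homotopy_contraction (H : D.Admissible len) {v : Mon} (hv : v ∈ D.G ∨ v = 1)
    (p : List Mon) (w : Mon) (s : List Mon) :
    H.homotopy ((D.val v ⊗ₜ[k] 1 : Env k A) • D.restrict (D.contraction p w s)) =
      D.restrict (D.contraction (v :: p) w s) := by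
  rw [restrict_contraction, restrict_contraction, Finsupp.sum, Finset.smul_sum, map_sum]
  refine Finset.sum_congr rfl fun u _ => ?_
  rw [smul_comm, map_smul, H.homotopy_rightCell hv]
  rfl

theorem contraction_one_cons (H : D.Admissible len) (p : List Mon) (w : Mon) (s : List Mon) :
    D.restrict (D.contraction (1 :: p) w s) = 0 := by
  rw [restrict_contraction]
  refine Finset.sum_eq_zero fun u _ => ?_
  dsimp only [List.cons_append]
  rw [H.rightCell_one_cons, smul_zero]

theorem homotopy_neg_one_pow_smul (H : D.Admissible len) (n : ℕ) (e : Env k A) (x : D.Bar) :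
    H.homotopy (e • ((-1 : Env k A) ^ n • x)) = (-1 : Env k A) ^ n • H.homotopy (e • x) := by
  -- The homotopy is not linear over the left factor of the enveloping algebra, so the sign is moved
  -- into k.
  have h : ∀ x : D.Bar, (-1 : Env k A) ^ n • x = (-1 : k) ^ n • x := fun x => by
    rw [← algebraMap_smul (Env k A) ((-1 : k) ^ n) x, map_pow, map_neg, map_one]
  rw [h, h, ← envSMul_apply, map_smul, map_smul, envSMul_apply]

/-- The first face of [w|t] turns v into the algebra element v w, whose expansion becomes a new
first entry; every other face just gets v prepended. Up to sign these are the faces of [v|w|t] other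
than the first. -/
theorem homotopy_boundary (H : D.Admissible len) {v : Mon} (hv : v ∈ D.G ∨ v = 1) (w : Mon)
    (t : List Mon) (ht : ∀ x ∈ t, x ∈ D.G) :
    H.homotopy ((D.val v ⊗ₜ[k] 1 : Env k A) • D.restrict (D.boundary (w :: t))) =
      D.restrict (D.contraction [] (v * w) t) +
      ∑ j ∈ Finset.range t.length, (-1 : Env k A) ^ (j + 1) •
        D.restrict (D.contraction (v :: (w :: t).take j)
          ((w :: t).getD j 1 * (w :: t).getD (j + 1) 1) ((w :: t).drop (j + 2))) +
      (-1 : Env k A) ^ (t.length + 1) •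
        D.rightCell (v :: (w :: t).dropLast) (MulOpposite.op (D.val ((w :: t).getLastD 1))) := by
  rw [boundary, map_add, map_add, map_sum, smul_add, smul_add, map_add, map_add, Finset.smul_sum,
    map_sum]
  congr 1
  · congr 1
    · obtain ⟨c, rfl⟩ : ∃ c : D.Cell, c.1 = t := ⟨⟨t, ht⟩, rfl⟩
      rw [restrict_single c, Finsupp.smul_single, smul_eq_mul,
        Algebra.TensorProduct.tmul_mul_tmul, one_mul, ← map_mul, homotopy_single,
        restrict_contraction]
      rfl
    · refine Finset.sum_congr rfl fun j _ => ?_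
      rw [D.restrict.map_smul, H.homotopy_neg_one_pow_smul, H.homotopy_contraction hv]
  · rw [restrict_single_mul, H.homotopy_neg_one_pow_smul,
      ← rightCell_apply, H.homotopy_rightCell hv]

theorem _root_.StdMonomials.restrict_boundary (v w : Mon) (t : List Mon) :
    D.restrict (D.boundary (v :: w :: t)) +
      (D.restrict (D.contraction [] (v * w) t) +
      ∑ j ∈ Finset.range t.length, (-1 : Env k A) ^ (j + 1) •
        D.restrict (D.contraction (v :: (w :: t).take j)
          ((w :: t).getD j 1 * (w :: t).getD (j + 1) 1) ((w :: t).drop (j + 2))) +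
      (-1 : Env k A) ^ (t.length + 1) •
        D.rightCell (v :: (w :: t).dropLast) (MulOpposite.op (D.val ((w :: t).getLastD 1)))) =
      D.restrict (Finsupp.single (w :: t) (D.val v ⊗ₜ[k] 1)) := by
  rw [boundary, map_add, map_add, map_sum, List.length_cons, Finset.sum_range_succ',
    restrict_single_mul, ← rightCell_apply]
  have hs : ∀ (s : Finset ℕ) (f : ℕ → D.Bar), ∑ x ∈ s, -f x = -∑ x ∈ s, f x :=
    fun s f => Finset.sum_neg_distrib f
  simp only [List.take_succ_cons, List.getD_cons_succ, List.getD_cons_zero, List.drop_succ_cons,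
    List.take_zero, List.drop_zero, map_smul, List.dropLast_cons_cons, List.getLastD_cons,
    neg_one_pow_succ_smul, pow_zero, one_smul, hs]
  abel

end Admissible

end StdMonomials

/-! ### Exactness of the bar complex and the free resolution -/

namespace StdMonomials

open AlgMorse

variable {k A Mon : Type*} [Field k] [Ring A] [Algebra k A] [Monoid Mon]
  {D : StdMonomials k A Mon} {len : Mon → ℕ}

theorem single_eq_smul_one (c : D.Cell) (e : Env k A) :
    (Finsupp.single c e : D.Bar) = e • Finsupp.single c 1 :=
  single_eq_smul c e

theorem single_mul (c : D.Cell) (e e' : Env k A) :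
    (Finsupp.single c (e * e') : D.Bar) = e • Finsupp.single c e' := by
  rw [Finsupp.smul_single, smul_eq_mul]

theorem mul_smul_bar (e e' : Env k A) (x : D.Bar) : (e * e') • x = e • e' • x := mul_smul e e' x

theorem barD_single_smul (c : D.Cell) (e : Env k A) :
    D.barD (Finsupp.single c e) = e • D.restrict (D.boundary c.1) := by
  rw [single_eq_smul_one, map_smul, barD_single]

theorem rightCell_cell (c : D.Cell) (b : Aᵐᵒᵖ) :
    D.rightCell c.1 b = Finsupp.single c (1 ⊗ₜ[k] b) := by
  rw [rightCell_apply, restrict_single]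

theorem barD_rightCell (c : D.Cell) (b : Aᵐᵒᵖ) :
    D.barD (D.rightCell c.1 b) = (1 ⊗ₜ[k] b : Env k A) • D.restrict (D.boundary c.1) := by
  rw [rightCell_cell, barD_single_smul]

theorem barD_rightCell_nil (b : Aᵐᵒᵖ) : D.barD (D.rightCell [] b) = 0 := by
  rw [show ([] : List Mon) = D.nil.1 from rfl, barD_rightCell]
  change _ • D.restrict (D.boundary []) = 0
  rw [boundary, map_zero, smul_zero]

theorem barAug_single_nil (a b : A) :
    D.barAug (Finsupp.single D.nil (a ⊗ₜ[k] MulOpposite.op b)) = a * b := by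
  rw [barAug, Finsupp.linearCombination_single, if_pos (show D.nil.1 = [] from rfl),
    Env.tmul_smul, mul_one]

theorem barAug_single_of_ne (c : D.Cell) (hc : c.1 ≠ []) (e : Env k A) :
    D.barAug (Finsupp.single c e) = 0 := by
  rw [barAug, Finsupp.linearCombination_single, if_neg hc]
  exact smul_zero e

theorem barEta_apply (x : D.Bar) : D.barEta x = D.rightCell [] (MulOpposite.op (D.barAug x)) := rfl

theorem barEta_of_barAug {x : D.Bar} (h : D.barAug x = 0) : D.barEta x = 0 := by
  rw [barEta_apply, h, MulOpposite.op_zero, map_zero]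

theorem restrict_boundary_nil : D.restrict (D.boundary []) = 0 := by
  rw [boundary, map_zero]

theorem restrict_boundary_singleton (v : Mon) :
    D.restrict (D.boundary [v]) + D.rightCell [] (MulOpposite.op (D.val v)) =
      Finsupp.single D.nil (D.val v ⊗ₜ[k] 1) := by
  rw [boundary, map_add, map_add, restrict_single_mul, List.length_nil, neg_one_pow_succ_smul,
    pow_zero, one_smul, Finset.sum_range_zero, map_zero, add_zero, add_assoc]
  change D.restrict (Finsupp.single D.nil.1 _) + (-D.rightCell [] _ + D.rightCell [] _) = _
  rw [restrict_single]
  have h : ∀ z : D.Bar, -z + z = 0 := fun z => neg_add_cancel z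
  exact (congrArg (_ + ·) (h _)).trans (add_zero _)

theorem barAug_barD (x : D.Bar) : D.barAug (D.barD x) = 0 := by
  suffices D.barAug ∘ₗ D.barD = 0 from LinearMap.congr_fun this x
  refine linearMap_ext fun c => ?_
  rw [LinearMap.comp_apply, LinearMap.zero_apply]
  rcases hc : c.1 with _ | ⟨w, _ | ⟨w', t⟩⟩
  · rw [barD_single, hc, restrict_boundary_nil, map_zero]
  · have h := congrArg D.barAug (restrict_boundary_singleton (D := D) w)
    have h' : D.rightCell [] (MulOpposite.op (D.val w)) =
        Finsupp.single D.nil (1 ⊗ₜ[k] MulOpposite.op (D.val w)) := rightCell_cell D.nil _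
    rw [map_add, h', ← MulOpposite.op_one, barAug_single_nil, barAug_single_nil, one_mul, mul_one,
      add_eq_right] at h
    rw [barD_single, hc, h]
  · refine (Submodule.mem_bot (Env k A)).1
      (mem_of_single (s := {c' : D.Cell | c'.1 ≠ []}) (fun c' hc' => ?_) ?_)
    · exact (Submodule.mem_bot _).2 (barAug_single_of_ne c' hc' 1)
    · rw [Finsupp.mem_supported]
      intro c' hc' h0
      rw [Finset.mem_coe, Finsupp.mem_support_iff, barD_single_apply] at hc'
      have := deg_of_bdCoeff_ne_zero hc'
      rw [deg, deg, h0, hc] at this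
      simp at this

namespace Admissible

/-- On (v ⊗ b)[t] with v in `G`, all faces of [v|t] except the first cancel against the homotopy of
the boundary. For v = 1 the homotopy vanishes, since tuples containing 1 are omitted, and the first
face alone returns [t]. -/
theorem homotopy_identity (H : D.Admissible len) (x : D.Bar) :
    D.barD (H.homotopy x) + H.homotopy (D.barD x) + D.barEta x = x := by
  suffices D.barD.restrictScalars k ∘ₗ H.homotopy + H.homotopy ∘ₗ D.barD.restrictScalars k +
      D.barEta = LinearMap.id from LinearMap.congr_fun this x
  refine H.barMap_ext (N := D.Bar) fun t v b hv => ?_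
  change D.barD (H.homotopy _) + H.homotopy (D.barD _) + D.barEta _ = _
  rw [LinearMap.id_apply, H.homotopy_single_val t hv, barD_single_smul]
  rcases ht : t.1 with _ | ⟨w, s⟩
  · obtain rfl : t = D.nil := Subtype.ext ht
    obtain ⟨b, rfl⟩ := MulOpposite.op_surjective b
    rw [restrict_boundary_nil, smul_zero, map_zero, add_zero, barEta_apply, barAug_single_nil]
    rcases hv with hv | rfl
    · obtain ⟨c, hc⟩ : ∃ c : D.Cell, c.1 = [v] := ⟨⟨[v], by simpa using hv⟩, rfl⟩
      rw [← hc, barD_rightCell, hc, MulOpposite.op_mul, rightCell_mul, ← smul_add,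
        restrict_boundary_singleton, Finsupp.smul_single, smul_eq_mul,
        Algebra.TensorProduct.tmul_mul_tmul, one_mul, mul_one]
    · rw [H.rightCell_one_cons, map_zero, zero_add, map_one, one_mul]
      exact rightCell_cell D.nil _
  · have hw : w ∈ D.G := t.2 w (by rw [ht]; exact List.mem_cons_self)
    have hs : ∀ x ∈ s, x ∈ D.G := fun x hx =>
      t.2 x (by rw [ht]; exact List.mem_cons_of_mem w hx)
    have e1 : (D.val v ⊗ₜ[k] b : Env k A) = (1 ⊗ₜ[k] b) * (D.val v ⊗ₜ[k] 1) := by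
      rw [Algebra.TensorProduct.tmul_mul_tmul, one_mul, mul_one]
    have e4 : D.restrict (Finsupp.single (w :: s) (D.val v ⊗ₜ[k] 1)) =
        Finsupp.single t (D.val v ⊗ₜ[k] 1) := by rw [← ht, restrict_single]
    rw [barEta_of_barAug (barAug_single_of_ne _ (by rw [ht]; simp) _), add_zero, e1, mul_smul_bar,
      H.homotopy_smul, H.homotopy_boundary hv w s hs, single_mul]
    rcases hv with hv | rfl
    · obtain ⟨c, hc⟩ : ∃ c : D.Cell, c.1 = v :: w :: s :=
        ⟨⟨v :: w :: s, List.forall_mem_cons.2 ⟨hv, ht ▸ t.2⟩⟩, rfl⟩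
      rw [← hc, barD_rightCell, hc, ← smul_add, restrict_boundary, e4]
    · rw [H.rightCell_one_cons, map_zero, zero_add]
      congr 1
      have z1 : ∀ j, D.restrict (D.contraction (1 :: (w :: s).take j)
          ((w :: s).getD j 1 * (w :: s).getD (j + 1) 1) ((w :: s).drop (j + 2))) = 0 :=
        fun j => H.contraction_one_cons _ _ _
      simp only [z1, smul_zero, Finset.sum_const_zero, H.rightCell_one_cons, add_zero]
      rw [one_mul, restrict_contraction, H.repr_val (Or.inl hw),
        Finsupp.sum_single_index (by simp), one_smul]
      change D.rightCell (w :: s) 1 = _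
      rw [← ht, rightCell_cell, map_one]

/-- Deduced from the homotopy s without cancelling faces. The cell [v|t] is s y for y = (v ⊗ 1)[t],
and ddy = 0 by induction on t. The identity at dy gives dsdy = dy; applying d to the identity at y
then leaves ddsy = 0. -/
theorem barD_barD (H : D.Admissible len) (x : D.Bar) : D.barD (D.barD x) = 0 := by
  suffices D.barD ∘ₗ D.barD = 0 from LinearMap.congr_fun this x
  refine linearMap_ext (R := Env k A) (N := D.Bar) fun c => ?_
  rw [LinearMap.comp_apply, LinearMap.zero_apply]
  induction hn : c.1 generalizing c with
  | nil => rw [barD_single, hn, restrict_boundary_nil, map_zero]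
  | cons v t ih =>
    have hc := c.2
    rw [hn, List.forall_mem_cons] at hc
    obtain ⟨t', ht'⟩ : ∃ t' : D.Cell, t'.1 = t := ⟨⟨t, hc.2⟩, rfl⟩
    set y : D.Bar := Finsupp.single t' (D.val v ⊗ₜ[k] 1) with hy
    have h1 : Finsupp.single c (1 : Env k A) = H.homotopy y := by
      rw [hy, H.homotopy_single_val t' (Or.inl hc.1), ht', ← hn, rightCell_cell]
      rfl
    have h2 : D.barD (D.barD y) = 0 := by
      rw [hy, single_eq_smul_one, map_smul, map_smul, ih t' ht', smul_zero]
    have h3 := congrArg D.barD (H.homotopy_identity y)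
    have h4 := H.homotopy_identity (D.barD y)
    rw [h2, map_zero, add_zero, barEta_of_barAug (barAug_barD y), add_zero] at h4
    rw [map_add, map_add, barEta_apply, barD_rightCell_nil, add_zero, h4, add_eq_right] at h3
    rw [h1, h3]

theorem homotopy_mem (H : D.Admissible len) {i : ℕ} {x : D.Bar} (hx : x ∈ gr D.deg i) :
    H.homotopy x ∈ (gr D.deg (i + 1) : Submodule (Env k A) D.Bar) := by
  rw [← Finsupp.sum_single x, Finsupp.sum, map_sum]
  refine Submodule.sum_mem _ fun c hc => ?_
  have hd : D.deg c = i := hx hc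
  generalize x c = e
  induction e using TensorProduct.induction_on with
  | zero => rw [Finsupp.single_zero, map_zero]; exact zero_mem _
  | add e e' h h' => rw [Finsupp.single_add, map_add]; exact add_mem h h'
  | tmul a b =>
    rw [homotopy_single]
    refine Submodule.sum_mem _ fun u _ => ?_
    dsimp only
    rw [← map_smul]
    by_cases h : ∀ w ∈ u :: c.1, w ∈ D.G
    · obtain ⟨c', hc'⟩ : ∃ c' : D.Cell, c'.1 = u :: c.1 := ⟨⟨_, h⟩, rfl⟩
      rw [← hc', rightCell_cell]
      refine Finsupp.single_mem_supported _ _ ?_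
      change c'.1.length = i + 1
      rw [hc', List.length_cons, ← hd]
      rfl
    · rw [rightCell_apply, restrict_single_of_not h]
      exact zero_mem _

theorem barAug_of_mem {i : ℕ} {x : D.Bar} (hx : x ∈ gr D.deg (i + 1)) : D.barAug x = 0 := by
  refine (Submodule.mem_bot (Env k A)).1 (mem_of_single (fun c hc => ?_) hx)
  refine (Submodule.mem_bot _).2 (barAug_single_of_ne c (fun h0 => ?_) 1)
  rw [Set.mem_ofPred_eq, deg, h0] at hc
  simp at hc

theorem matchedComplex (H : D.Admissible len) :
    MatchedComplex D.deg D.bdCoeff D.matching D.barD :=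
  ⟨H.isAcyclicMatching, H.mEdge_wf, barD_single_apply, fun _ _ h => deg_of_bdCoeff_ne_zero h,
    H.barD_barD⟩

theorem finitePaths (H : D.Admissible len) : D.FinitePaths :=
  H.matchedComplex.pathsFrom_finite

theorem critical_of_deg_zero (H : D.Admissible len) (c : D.Cell) (hc : D.deg c = 0) :
    Critical D.matching c := by
  rintro ⟨a, b⟩ he
  obtain ⟨p, u, v, s, h1, h2, -⟩ := (H.mem_matching_iff _ _).1 he
  refine ⟨?_, ?_⟩
  · rintro rfl
    rw [deg, h1] at hc
    simp at hc
  · rintro rfl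
    rw [deg, h2] at hc
    simp at hc

theorem isFreeResolution (H : D.Admissible len) : D.IsFreeResolution := by
  have key := H.matchedComplex.isFreeRes D.barAug H.critical_of_deg_zero ?_
    (fun x _ => barAug_barD x) ?_ ?_
  · have haug : D.aug = D.barAug ∘ₗ emb (Env k A) D.deg D.matching 0 := by
      refine linearMap_ext fun e => ?_
      rw [LinearMap.comp_apply, emb_single, aug, barAug, Finsupp.linearCombination_single,
        Finsupp.linearCombination_single, if_pos (List.length_eq_zero_iff.1 e.2.2)]
    rw [IsFreeResolution, haug]
    exact key
  · intro i x hx h0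
    refine ⟨H.homotopy x, H.homotopy_mem hx, ?_⟩
    have := H.homotopy_identity x
    rwa [h0, map_zero, add_zero, barEta_of_barAug (barAug_of_mem hx), add_zero] at this
  · intro x hx h0
    refine ⟨H.homotopy x, H.homotopy_mem hx, ?_⟩
    have := H.homotopy_identity x
    rwa [H.matchedComplex.d_zero hx, map_zero, add_zero, barEta_of_barAug h0, add_zero] at this
  · intro a
    refine ⟨Finsupp.single D.nil (a ⊗ₜ[k] MulOpposite.op 1),
      Finsupp.single_mem_supported _ _ rfl, ?_⟩
    rw [barAug_single_nil, mul_one]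

end Admissible

end StdMonomials

/-! ### Minimality -/

namespace StdMonomials

open AlgMorse

variable {k A Mon : Type*} [Field k] [Ring A] [Algebra k A] [Monoid Mon]
  {D : StdMonomials k A Mon} {len : Mon → ℕ}

namespace Admissible

/-- A path from c to f alternates between the two degrees. If its first descent has a coefficient
outside m, that descent is a contraction; it cannot end at f, so a reversed edge follows and
completes a Type I reduction. Induction applies to the shorter remaining path. -/
theorem pathWeight_mem (H : D.Admissible len) (hT : D.NoTypeII) {m : Ideal (Env k A)}
    (hl : ∀ w ∈ D.G, (D.val w ⊗ₜ[k] 1 : Env k A) ∈ m)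
    (hr : ∀ w ∈ D.G, (1 ⊗ₜ[k] MulOpposite.op (D.val w) : Env k A) ∈ m)
    (hm : ∀ y ∈ m, ∀ e, y * e ∈ m) {e f : D.Cell} (he : D.Crit e) (hf : D.Crit f)
    {p : List D.Cell} : ∀ {c : D.Cell}, Relation.ReflTransGen D.TypeI e c →
      (∀ u, (u, c) ∉ D.matching) → D.deg c = D.deg f + 1 →
      p ∈ paths D.deg D.bdCoeff D.matching c f → pathWeight D.deg D.bdCoeff p ∈ m := by
  have hM := H.isAcyclicMatching
  induction hn : p.length using Nat.strong_induction_on generalizing p with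
  | _ n ih =>
  intro c hec hc hdeg hp
  rw [paths_eq] at hp
  simp only [Set.mem_union, Set.mem_iUnion, Set.mem_image, Set.mem_ofPred_eq] at hp
  rcases hp with ⟨-, rfl⟩ | ⟨c', hcc', q, hq, rfl⟩
  · omega
  rcases hcc' with ⟨hE, hnot⟩ | ⟨-, hup⟩
  swap
  · exact absurd hup (hc c')
  rw [pathWeight_cons hq.1, stepWeight, if_neg (by have := hE.1; omega)]
  by_cases hw : D.bdCoeff c c' ∈ m
  -- A factor in m on the left suffices because m is also stable under right multiplication.
  · exact hm _ hw _
  have hcon : D.Contracts c c' := by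
    rcases exists_of_bdCoeff_notMem m hw with ⟨w, h1, h2⟩ | ⟨w, h1, h2⟩ | ⟨p, a, b, s, v, h1, h2, h3⟩
    · exact absurd (hl w (c.2 w (by simp [h1]))) h2
    · exact absurd (hr w (c.2 w (by simp [h1]))) h2
    · exact ⟨p, s, a, b, v, by simp [h1], by simp [h2], h3⟩
  refine m.mul_mem_left _ ?_
  have hd' : D.deg c' = D.deg f := by have := hE.1; omega
  rw [paths_eq] at hq
  simp only [Set.mem_union, Set.mem_iUnion, Set.mem_image, Set.mem_ofPred_eq] at hq
  rcases hq with ⟨-, rfl⟩ | ⟨c'', hcc'', r, hr', rfl⟩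
  · exact absurd ⟨hf, hcon⟩ (hT e c _ he hec)
  rcases hcc'' with ⟨hE', -⟩ | ⟨hE', hup⟩
  -- A second descent would fall below the degree of f, which no path to f can recover.
  · have h1 := (deg_of_mem_paths hM hf r c'' hr').1
    have := hE'.1
    omega
  rw [pathWeight_cons hr'.1]
  refine m.mul_mem_left _ (ih r.length ?_ rfl (hec.tail ⟨?_, c', hcon, hup⟩)
    (fun u hu => hM.not_up_of_low hu hup) (by have := hE'.1; omega) hr')
  · rw [← hn, List.length_cons, List.length_cons]
    omega
  · rintro rfl
    exact hnot hup

theorem isMinimal (H : D.Admissible len) (hT : D.NoTypeII) {m : Ideal (Env k A)}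
    (hl : ∀ w ∈ D.G, (D.val w ⊗ₜ[k] 1 : Env k A) ∈ m)
    (hr : ∀ w ∈ D.G, (1 ⊗ₜ[k] MulOpposite.op (D.val w) : Env k A) ∈ m)
    (hm : ∀ y ∈ m, ∀ e, y * e ∈ m) : D.IsMinimal m := by
  intro i x
  let T : Submodule (Env k A) (D.F i) :=
    { carrier := {y | ∀ f, y f ∈ m}
      add_mem' := fun hy hz f => m.add_mem (hy f) (hz f)
      zero_mem' := fun f => m.zero_mem
      smul_mem' := fun e y hy f => m.mul_mem_left e (hy f) }
  suffices D.d i x ∈ T from this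
  refine mem_of_single (R := Env k A) (N := D.F i) (f := D.d i) (T := T) (s := Set.univ)
    (fun e _ => ?_) (by simp)
  rw [d, morseD, Finsupp.linearCombination_single, one_smul]
  refine finsum_induction (· ∈ T) T.zero_mem (fun _ _ => T.add_mem) fun f g => ?_
  have hG : Gam D.deg D.bdCoeff D.matching e.1 f.1 ∈ m := by
    refine finsum_mem_induction (· ∈ m) m.zero_mem (fun _ _ => m.add_mem) fun p hp => ?_
    refine H.pathWeight_mem hT hl hr hm e.2.1 f.2.1 .refl e.2.1.notMem_right ?_ hp
    rw [e.2.2, f.2.2]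
  by_cases h : f = g
  · subst h
    rwa [Finsupp.single_eq_same]
  · rw [Finsupp.single_eq_of_ne (Ne.symm h)]
    exact m.zero_mem

section EnvIdeal

variable {ι : Type*} {x : ι → A}

theorem tmul_one_mem (hr : ∀ w, w ≠ 1 → ∃ i w', D.val w = D.val w' * x i) {w : Mon} (hw : w ≠ 1)
    (b : Aᵐᵒᵖ) : (D.val w ⊗ₜ[k] b : Env k A) ∈ envIdeal k x := by
  obtain ⟨i, w', h⟩ := hr w hw
  have : (D.val w ⊗ₜ[k] b : Env k A) = (D.val w' ⊗ₜ[k] b) * (x i ⊗ₜ[k] 1) := by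
    rw [Algebra.TensorProduct.tmul_mul_tmul, h, mul_one]
  rw [this]
  exact Ideal.mul_mem_left _ _ (Ideal.subset_span (Or.inl ⟨i, rfl⟩))

theorem one_tmul_mem (hl : ∀ w, w ≠ 1 → ∃ i w', D.val w = x i * D.val w') {w : Mon} (hw : w ≠ 1)
    (a : A) : (a ⊗ₜ[k] MulOpposite.op (D.val w) : Env k A) ∈ envIdeal k x := by
  obtain ⟨i, w', h⟩ := hl w hw
  have : (a ⊗ₜ[k] MulOpposite.op (D.val w) : Env k A) =
      (a ⊗ₜ[k] MulOpposite.op (D.val w')) * (1 ⊗ₜ[k] MulOpposite.op (x i)) := by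
    rw [Algebra.TensorProduct.tmul_mul_tmul, h, mul_one, MulOpposite.op_mul]
  rw [this]
  exact Ideal.mul_mem_left _ _ (Ideal.subset_span (Or.inr ⟨i, rfl⟩))

/-- The point is that the left ideal generated by the variables is also a right ideal: x_i a is a
combination of classes of nontrivial words, and each of these can be rewritten as a multiple ending
in some variable. The opposite factor is symmetric. -/
theorem isMinimal_envIdeal (H : D.Admissible len) (hT : D.NoTypeII)
    (hx : ∀ i, ∃ w, w ≠ 1 ∧ x i = D.val w)
    (hl : ∀ w, w ≠ 1 → ∃ i w', D.val w = x i * D.val w')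
    (hr : ∀ w, w ≠ 1 → ∃ i w', D.val w = D.val w' * x i) : D.IsMinimal (envIdeal k x) := by
  have hmul : ∀ a b : Mon, a ≠ 1 ∨ b ≠ 1 → a * b ≠ 1 := by
    intro a b h hab
    have h1 := H.order.len_mul a b
    rw [hab, H.order.len_one] at h1
    rcases h with h | h
    · have := H.order.len_pos h
      omega
    · have := H.order.len_pos h
      omega
  refine H.isMinimal hT (fun w hw => tmul_one_mem hr (H.ne_one hw) 1)
    (fun w hw => one_tmul_mem hl (H.ne_one hw) 1) fun y hy e => ?_
  induction hy using Submodule.span_induction with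
  | zero => rw [zero_mul]; exact zero_mem _
  | add y y' _ _ h h' => rw [add_mul]; exact add_mem h h'
  | smul e' y _ h => rw [smul_mul_assoc]; exact Submodule.smul_mem _ e' h
  | mem y hy =>
    induction e using TensorProduct.induction_on with
    | zero => rw [mul_zero]; exact zero_mem _
    | add e e' h h' => rw [mul_add]; exact add_mem h h'
    | tmul a b =>
      rcases hy with ⟨i, rfl⟩ | ⟨i, rfl⟩
      · obtain ⟨v, hv, hxv⟩ := hx i
        dsimp only
        rw [Algebra.TensorProduct.tmul_mul_tmul, one_mul, hxv]
        induction H.span a using Submodule.span_induction with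
        | mem a ha =>
          obtain ⟨w, rfl⟩ := ha
          rw [← map_mul]
          exact tmul_one_mem hr (hmul v w (Or.inl hv)) b
        | zero => rw [mul_zero, TensorProduct.zero_tmul]; exact zero_mem _
        | add a a' _ _ h h' => rw [mul_add, TensorProduct.add_tmul]; exact add_mem h h'
        | smul t a _ h =>
          rw [mul_smul_comm, ← TensorProduct.smul_tmul', ← algebraMap_smul (Env k A) t]
          exact Submodule.smul_mem _ _ h
      · obtain ⟨v, hv, hxv⟩ := hx i
        dsimp only
        obtain ⟨b, rfl⟩ := MulOpposite.op_surjective b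
        rw [Algebra.TensorProduct.tmul_mul_tmul, one_mul, hxv, ← MulOpposite.op_mul]
        induction H.span b using Submodule.span_induction with
        | mem a ha =>
          obtain ⟨w, rfl⟩ := ha
          rw [← map_mul]
          exact one_tmul_mem hl (hmul w v (Or.inr hv)) a
        | zero => rw [zero_mul, MulOpposite.op_zero, TensorProduct.tmul_zero]; exact zero_mem _
        | add a a' _ _ h h' =>
          rw [add_mul, MulOpposite.op_add, TensorProduct.tmul_add]
          exact add_mem h h'
        | smul t a _ h =>
          rw [smul_mul_assoc, MulOpposite.op_smul, TensorProduct.tmul_smul,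
            ← algebraMap_smul (Env k A) t]
          exact Submodule.smul_mem _ _ h

end EnvIdeal

end Admissible

end StdMonomials

/-! ### Standard monomials from a Gröbner basis -/

namespace Groebner

variable {k P A Mon : Type*} [Field k] [Monoid Mon] {coef : P → Mon → k} {lt : Mon → Mon → Prop}
  {len : Mon → ℕ} {S : Finset P} {I : Set P}

theorem Factor.trans {a b c : Mon} (h : Factor a b) (h' : Factor b c) : Factor a c := by
  obtain ⟨x, y, rfl⟩ := h
  obtain ⟨z, w, rfl⟩ := h'
  exact ⟨z * x, y * w, by simp only [mul_assoc]⟩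

theorem factor_mul_right (a b : Mon) : Factor a (a * b) := ⟨1, b, by simp⟩

theorem factor_mul_left (a b : Mon) : Factor b (a * b) := ⟨a, 1, by simp⟩

theorem mem_std_of_factor {a b : Mon} (h : b ∈ Std coef lt S) (hab : Factor a b) :
    a ∈ Std coef lt S := fun f hf u hu hua => h f hf u hu (hua.trans hab)

theorem IsLead.unique (H : IsGradedOrder lt len) {q : Mon → k} {u v : Mon} (h : IsLead lt q u)
    (h' : IsLead lt q v) : u = v := by
  by_contra hne
  exact H.irrefl u (H.trans _ _ _ (h'.2 u h.1 hne) (h.2 v h'.1 (Ne.symm hne)))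

variable [Ring P] [Algebra k P] [Ring A] [Algebra k A]

/-- The data that present `A` as a quotient of an algebra `P` with a basis of monomials. -/
structure IsPresentation (coef : P → Mon → k) (e : (Mon →₀ k) ≃ₗ[k] P) (mono : Mon →* P)
    (π : P →ₐ[k] A) (I : Set P) (D : StdMonomials k A Mon) (S : Finset P) : Prop where
  single : ∀ w, e (Finsupp.single w 1) = mono w
  coef_eq : ∀ p w, coef p w = e.symm p w
  surjective : Function.Surjective π
  mem_ker : ∀ p, p ∈ I ↔ π p = 0
  val_eq : ∀ w, D.val w = π (mono w)
  mem_G : ∀ w, w ∈ D.G ↔ w ∈ Std coef D.lt S ∧ w ≠ 1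
  reduced : IsReduced coef D.lt I S

namespace IsPresentation

variable {e : (Mon →₀ k) ≃ₗ[k] P} {mono : Mon →* P} {π : P →ₐ[k] A} {D : StdMonomials k A Mon}

theorem apply_eq (h : IsPresentation coef e mono π I D S) (r : Mon →₀ k) :
    e r = Finsupp.linearCombination k mono r := by
  have : (e : (Mon →₀ k) →ₗ[k] P) = Finsupp.linearCombination k mono :=
    Finsupp.lhom_ext' fun w => LinearMap.ext_ring (by simp [h.single])
  exact LinearMap.congr_fun this r

theorem map_apply (h : IsPresentation coef e mono π I D S) (r : Mon →₀ k) :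
    π (e r) = Finsupp.linearCombination k D.val r := by
  rw [h.apply_eq, Finsupp.linearCombination_apply, Finsupp.linearCombination_apply, map_finsuppSum]
  exact Finsupp.sum_congr fun w _ => by rw [map_smul, h.val_eq]

/-- A leading monomial dividing 1 is 1 itself; a monic polynomial with that leading monomial is 1,
so the quotient would vanish. -/
theorem one_mem_std [Nontrivial A] (h : IsPresentation coef e mono π I D S)
    (H : IsGradedOrder D.lt len) : (1 : Mon) ∈ Std coef D.lt S := by
  rintro f hf u hu ⟨a, b, hab⟩
  have h1 : len u = 0 := by
    have := H.len_mul (a * u) b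
    rw [← hab, H.len_mul, H.len_one] at this
    omega
  obtain rfl := H.len_eq_zero u h1
  obtain ⟨u, hu', h2⟩ := h.reduced.monic f hf
  obtain rfl := hu.unique H hu'
  have h3 : f = 1 := by
    rw [← map_one mono, ← h.single, ← e.symm_apply_eq]
    ext v
    rw [← h.coef_eq]
    by_cases hv : v = 1
    · rw [hv, h2, Finsupp.single_eq_same]
    · rw [Finsupp.single_eq_of_ne hv]
      by_contra h4
      exact H.irrefl v (H.trans _ _ _ (hu.2 v h4 hv) (H.one_lt hv))
  have h4 := (h.mem_ker f).1 (h.reduced.subset f hf)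
  rw [h3, map_one] at h4
  exact one_ne_zero h4

/-- The division algorithm as a well-founded induction: a nonstandard w = a u b is rewritten by a f
b, all of whose other monomials are smaller. -/
theorem val_mem (h : IsPresentation coef e mono π I D S) (H : IsGradedOrder D.lt len) (w : Mon) :
    D.val w ∈ Submodule.map (Finsupp.linearCombination k D.val)
      (Finsupp.supported k k {v | v ∈ Std coef D.lt S ∧ (v = w ∨ D.lt v w)}) := by
  induction w using H.wellFounded.induction with
  | _ w ih =>
  by_cases hw : w ∈ Std coef D.lt S
  · exact ⟨Finsupp.single w 1, Finsupp.single_mem_supported _ _ ⟨hw, Or.inl rfl⟩, by simp⟩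
  simp only [Std, Set.mem_ofPred_eq, not_forall, not_not] at hw
  obtain ⟨f, hf, u, hu, a, b, rfl⟩ := hw
  obtain ⟨u', hu', h1⟩ := h.reduced.monic f hf
  obtain rfl := hu.unique H hu'
  have h2 : (e.symm f).sum (fun v t => t • D.val (a * v * b)) = 0 := by
    have h3 : π (mono a * f * mono b) = 0 := by
      rw [map_mul, map_mul, (h.mem_ker f).1 (h.reduced.subset f hf), mul_zero, zero_mul]
    rw [← e.apply_symm_apply f, map_mul, map_mul, h.map_apply, Finsupp.linearCombination_apply,
      Finsupp.sum, Finset.mul_sum, Finset.sum_mul] at h3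
    rw [Finsupp.sum, ← h3]
    refine Finset.sum_congr rfl fun v _ => ?_
    rw [← h.val_eq, ← h.val_eq, mul_smul_comm, smul_mul_assoc, map_mul, map_mul]
  classical
  rw [Finsupp.sum, ← Finset.add_sum_erase _ _
    (Finsupp.mem_support_iff.2 (h.coef_eq f u ▸ hu.1)), ← h.coef_eq, h1, one_smul] at h2
  rw [eq_neg_of_add_eq_zero_left h2]
  refine neg_mem (Submodule.sum_mem _ fun v hv => Submodule.smul_mem _ _ ?_)
  rw [Finset.mem_erase, Finsupp.mem_support_iff, ← h.coef_eq] at hv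
  have hlt := H.mul_lt _ _ a b (hu.2 v hv.2 hv.1)
  refine Submodule.map_mono (Finsupp.supported_mono ?_) (ih _ hlt)
  rintro x ⟨hx, rfl | hx'⟩
  · exact ⟨hx, Or.inr hlt⟩
  · exact ⟨hx, Or.inr (H.trans _ _ _ hx' hlt)⟩

theorem admissible [Nontrivial A] (h : IsPresentation coef e mono π I D S)
    (H : IsGradedOrder D.lt len) : D.Admissible len where
  order := H
  left_mem a b hab ha := by
    rw [h.mem_G] at hab ⊢
    exact ⟨mem_std_of_factor hab.1 (factor_mul_right a b), ha⟩
  right_mem a b hab hb := by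
    rw [h.mem_G] at hab ⊢
    exact ⟨mem_std_of_factor hab.1 (factor_mul_left a b), hb⟩
  one_notMem := by simp [h.mem_G]
  exists_repr w := by
    obtain ⟨r, hr, hrw⟩ := h.val_mem H w
    refine ⟨r, ⟨fun v hv => ?_, hrw⟩, fun v hv => (hr hv).2⟩
    rw [h.mem_G, or_iff_not_imp_right]
    exact fun hv1 => ⟨(hr hv).1, hv1⟩
  indep r hr h0 := by
    by_contra hne
    have h1 : e r ∈ I := by
      rw [h.mem_ker, h.map_apply]
      exact h0
    -- A nontrivial relation would be an element of the ideal whose leading monomial is standard.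
    obtain ⟨f, hf, u, w, hu, hw, huw⟩ := h.reduced.basis _ h1 (by simpa using hne)
    have h2 := hw.1
    rw [h.coef_eq, e.symm_apply_apply] at h2
    have h3 : w ∈ Std coef D.lt S := by
      rcases hr w (Finsupp.mem_support_iff.2 h2) with h3 | rfl
      · exact ((h.mem_G w).1 h3).1
      · exact h.one_mem_std H
    exact h3 f hf u hu huw
  span a := by
    obtain ⟨p, rfl⟩ := h.surjective a
    rw [← e.apply_symm_apply p, h.map_apply, Finsupp.linearCombination_apply]
    exact Submodule.sum_mem _ fun v _ => Submodule.smul_mem _ _ (Submodule.subset_span ⟨v, rfl⟩)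

theorem G_eq_empty [Subsingleton A] (h : IsPresentation coef e mono π I D S) :
    D.G = ∅ := by
  rw [Set.eq_empty_iff_forall_notMem]
  intro w hw
  have h1 : mono 1 ∈ I := (h.mem_ker _).2 (Subsingleton.elim _ _)
  obtain ⟨f, hf, u, v, hu, hv, huv⟩ := h.reduced.basis _ h1 (by simp [← h.single])
  have hv1 : v = 1 := by
    have := hv.1
    rw [h.coef_eq, ← h.single, e.symm_apply_apply] at this
    by_contra hne
    exact this (Finsupp.single_eq_of_ne hne)
  rw [hv1] at huv
  exact ((h.mem_G w).1 hw).1 f hf u hu (huv.trans ⟨1, w, by simp⟩)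

end IsPresentation

end Groebner

namespace StdMonomials

variable {k A Mon : Type*} [Field k] [Ring A] [Algebra k A] [Monoid Mon]
  {D : StdMonomials k A Mon}

/-! ### The zero algebra -/

section Trivial

variable (hG : D.G = ∅)
include hG

theorem cell_eq_nil (c : D.Cell) : c.1 = [] :=
  List.eq_nil_iff_forall_not_mem.2 fun w hw => by simpa [hG] using c.2 w hw

theorem matching_eq_empty : D.matching = ∅ := by
  refine Set.eq_empty_of_forall_notMem fun e he => ?_
  obtain ⟨j, hj⟩ := Set.mem_iUnion.1 he
  obtain ⟨-, -, p, s, u, v, -, h, -⟩ := hj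
  simp [cell_eq_nil hG] at h

theorem not_mEdge (M : Set (D.Cell × D.Cell)) (c c' : D.Cell) :
    ¬ AlgMorse.MEdge D.deg D.bdCoeff M c c' := by
  have hd : ∀ c, D.deg c = 0 := fun c => by rw [deg, cell_eq_nil hG, List.length_nil]
  rintro (⟨⟨h, -⟩, -⟩ | ⟨⟨h, -⟩, -⟩) <;> rw [hd, hd] at h <;> omega

theorem isAcyclicMatching_of_eq_empty : D.IsAcyclicMatching where
  edge := by simp [matching_eq_empty hG]
  matching := by simp [matching_eq_empty hG]
  central := by simp [matching_eq_empty hG]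
  invertible := by simp [matching_eq_empty hG]
  acyclic c h := by
    obtain ⟨c', -, h⟩ := Relation.TransGen.tail'_iff.1 h
    exact not_mEdge hG _ _ _ h

theorem finitePaths_of_eq_empty : D.FinitePaths := by
  refine fun c => (Set.finite_singleton [c]).subset fun p hp => ?_
  obtain ⟨h1, h2⟩ := hp
  match p with
  | [] => simp at h1
  | [a] => simpa using h1
  | a :: b :: p =>
    rw [List.isChain_cons_cons] at h2
    exact absurd h2.1 (not_mEdge hG _ _ _)

end Trivial

theorem env_subsingleton (k A : Type*) [Field k] [Ring A] [Algebra k A] [Subsingleton A] :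
    Subsingleton (Env k A) :=
  ⟨fun a b => by rw [← one_mul a, ← one_mul b, Algebra.TensorProduct.one_def,
    Subsingleton.elim (1 : A) 0, TensorProduct.zero_tmul, zero_mul, zero_mul]⟩

theorem isFreeResolution_of_subsingleton [Subsingleton A] : D.IsFreeResolution := by
  have := env_subsingleton k A
  have hF : ∀ i, Subsingleton (D.F i) := fun i => inferInstance
  exact
    { free := fun i => inferInstance
      exact := fun i y => ⟨fun _ => ⟨0, Subsingleton.elim _ _⟩, fun _ => Subsingleton.elim _ _⟩
      exact_zero := fun y => ⟨fun _ => ⟨0, Subsingleton.elim _ _⟩, fun _ => Subsingleton.elim _ _⟩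
      surjective := fun y => ⟨0, Subsingleton.elim _ _⟩ }

theorem isMinimal_of_subsingleton [Subsingleton A] (m : Ideal (Env k A)) : D.IsMinimal m := by
  have := env_subsingleton k A
  intro i x f
  rw [Subsingleton.elim (D.d i x f) 0]
  exact m.zero_mem

end StdMonomials

/-! ### Words and commutative monomials as instances -/

namespace NonComm

variable {k : Type u} [Field k] {n : ℕ}

theorem lex_append {α : Type*} {r : α → α → Prop} {a b : List α} (h : List.Lex r a b)
    (hl : a.length = b.length) (e : List α) : List.Lex r (a ++ e) (b ++ e) := by
  induction h with
  | nil => simp at hl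
  | rel h => exact .rel h
  | cons _ ih => exact .cons (ih (by simpa using hl))

theorem lex_trans {α : Type*} {r : α → α → Prop} (hr : ∀ a b c, r a b → r b c → r a c)
    {a b c : List α} (h : List.Lex r a b) (h' : List.Lex r b c) : List.Lex r a c := by
  induction h generalizing c with
  | nil => cases h' <;> exact .nil
  | rel h =>
    cases h' with
    | rel h' => exact .rel (hr _ _ _ h h')
    | cons h' => exact .rel h
  | cons _ ih =>
    cases h' with
    | rel h' => exact .rel h'
    | cons h' => exact .cons (ih h')

theorem isGradedOrder : IsGradedOrder (lt (n := n)) FreeMonoid.length where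
  irrefl a h := by
    rcases h with h | ⟨-, h⟩
    · exact lt_irrefl _ h
    · have : Std.Asymm (fun i j : Fin n => j < i) := ⟨fun _ _ => lt_asymm⟩
      exact Std.Asymm.asymm _ _ h h
  trans a b c h h' := by
    rcases h with h | ⟨h1, h⟩ <;> rcases h' with h' | ⟨h1', h'⟩
    · exact Or.inl (h.trans h')
    · exact Or.inl (h1' ▸ h)
    · exact Or.inl (h1 ▸ h')
    · exact Or.inr ⟨h1.trans h1', lex_trans (r := fun i j : Fin n => j < i)
        (fun _ _ _ h h' => lt_trans h' h) h h'⟩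
  total a b := by
    rcases lt_trichotomy a.length b.length with h | h | h
    · exact Or.inl (Or.inl h)
    · have : Std.Trichotomous (fun i j : Fin n => j < i) :=
        ⟨fun a b h h' => le_antisymm (not_lt.1 h) (not_lt.1 h')⟩
      rcases trichotomous_of (List.Lex fun i j : Fin n => j < i) a.toList b.toList with h' | h' | h'
      · exact Or.inl (Or.inr ⟨h, h'⟩)
      · exact Or.inr (Or.inl (FreeMonoid.toList.injective h'))
      · exact Or.inr (Or.inr (Or.inr ⟨h.symm, h'⟩))
    · exact Or.inr (Or.inr (Or.inl h))
  mul_lt a b c e h := by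
    rcases h with h | ⟨h1, h⟩
    · refine Or.inl ?_
      simp only [FreeMonoid.length_mul]
      omega
    · refine Or.inr ⟨by simp only [FreeMonoid.length_mul, h1], ?_⟩
      simp only [FreeMonoid.toList_mul]
      refine lex_append (List.Lex.append_left _ h _) ?_ _
      rw [List.length_append, List.length_append]
      exact congrArg _ h1
  cancel a b c h := mul_left_cancel h
  len_mul := FreeMonoid.length_mul
  len_eq_zero a h := FreeMonoid.length_eq_zero.1 h
  lt_of_len_lt a b h := Or.inl h
  finite N := List.finite_length_le (Fin n) N

variable {S : Finset (FreeAlgebra k (Fin n))}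

theorem isPresentation (hS : IsReducedGB S) :
    Groebner.IsPresentation coef (FreeAlgebra.basisFreeMonoid k (Fin n)).repr.symm
      (FreeMonoid.lift (FreeAlgebra.ι k))
      ({ mk S with commutes' := fun _ => rfl } : FreeAlgebra k (Fin n) →ₐ[k] Quot S)
      {p | p ∈ TwoSidedIdeal.span (S : Set (FreeAlgebra k (Fin n)))} (std S) S where
  single w := by
    rw [FreeAlgebra.basisFreeMonoid]
    simp [FreeAlgebra.equivMonoidAlgebraFreeMonoid]
  coef_eq p w := rfl
  surjective := RingCon.mk'_surjective _
  mem_ker p := by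
    rw [Set.mem_ofPred_eq, TwoSidedIdeal.mem_iff]
    exact (RingCon.eq _).symm
  val_eq w := rfl
  mem_G w := Iff.rfl
  reduced := hS

end NonComm

namespace Comm

variable {k : Type u} [Field k] {n : ℕ}

theorem isGradedOrder :
    IsGradedOrder (lt (n := n)) (fun w => Finsupp.degree w.toAdd) where
  irrefl a h := lt_irrefl _ h
  trans a b c h h' := lt_trans h h'
  total a b := lt_trichotomy (toDegLex a.toAdd) (toDegLex b.toAdd)
  mul_lt a b c e h := by
    have h1 := add_lt_add_left (add_lt_add_right h (toDegLex c.toAdd)) (toDegLex e.toAdd)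
    exact h1
  cancel a b c h := mul_left_cancel h
  len_mul a b := map_add _ _ _
  len_eq_zero a h := (Finsupp.degree_eq_zero_iff _).1 h
  lt_of_len_lt a b h := Finsupp.DegLex.lt_iff.2 (Or.inl h)
  finite N := Finsupp.finite_of_degree_le N

variable {S : Finset (MvPolynomial (Fin n) k)}

theorem isPresentation (hS : IsReducedGB S) :
    Groebner.IsPresentation coef
      ((Finsupp.domLCongr Multiplicative.toAdd).trans
        (MvPolynomial.basisMonomials (Fin n) k).repr.symm)
      (MvPolynomial.monomialOneHom k (Fin n))
      ({ mk S with commutes' := fun _ => rfl } : MvPolynomial (Fin n) k →ₐ[k] Quot S)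
      (Ideal.span (S : Set (MvPolynomial (Fin n) k)) : Set _) (std S) S where
  single w := by
    simp only [LinearEquiv.trans_apply, Finsupp.domLCongr_single, Module.Basis.repr_symm_single,
      MvPolynomial.coe_basisMonomials, one_smul]
    rfl
  coef_eq p w := rfl
  surjective := Ideal.Quotient.mk_surjective
  mem_ker p := Ideal.Quotient.eq_zero_iff_mem.symm
  val_eq w := rfl
  mem_G w := Iff.rfl
  reduced := hS

end Comm

/-! ### Critical cells through minimal entries -/

namespace StdMonomials

variable {k A Mon : Type*} [Field k] [Ring A] [Algebra k A] [Monoid Mon]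
  {D : StdMonomials k A Mon} {len : Mon → ℕ}

/-- Each entry of the tuple `l`, preceded by the reversed tuple `p`, is a minimal one that survives
the matchings in the coordinates before it. -/
def MinEntries (D : StdMonomials k A Mon) : List Mon → List Mon → Prop
  | _, [] => True
  | p, w :: s => Minl (D.Q p) w ∧ MinEntries D (w :: p) s

theorem minEntries_iff (p l : List Mon) : D.MinEntries p l ↔
    ∀ p' w s, l = p'.reverse ++ w :: s → Minl (D.Q (p' ++ p)) w := by
  induction l generalizing p with
  | nil => simp [MinEntries]
  | cons v l ih =>
    rw [MinEntries, ih]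
    constructor
    · rintro ⟨h1, h2⟩ p' w s h
      rcases List.eq_nil_or_concat p' with rfl | ⟨p', x, rfl⟩
      · simp only [List.reverse_nil, List.nil_append, List.cons.injEq] at h
        rwa [← h.1]
      · simp only [List.concat_eq_append, List.reverse_append, List.reverse_cons, List.reverse_nil,
          List.nil_append, List.cons_append, List.cons.injEq] at h
        rw [List.concat_eq_append, List.append_assoc, ← h.1]
        exact h2 p' w s h.2
    · refine fun h => ⟨h [] v l rfl, fun p' w s hl => ?_⟩
      have := h (p' ++ [v]) w s (by simp [hl])
      rwa [List.append_assoc] at this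

theorem Admissible.minl_of_crit (H : D.Admissible len) {c : D.Cell} (hcr : D.Crit c)
    {p s : List Mon} {w : Mon} (hc : c.1 = p.reverse ++ w :: s) (hQ : D.Q p w) :
    Minl (D.Q p) w := by
  by_contra hm
  obtain ⟨u, hb⟩ := exists_best H.order (D.Q p) w hQ
  obtain ⟨v, rfl⟩ := hb.2.1
  have hv : v ∈ D.G := H.right_mem _ _ hQ.mem fun h => hm (by simpa [h] using hb.1)
  have hcell : ∀ x ∈ p.reverse ++ u :: v :: s, x ∈ D.G := by
    intro x hx
    simp only [List.mem_append, List.mem_cons] at hx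
    rcases hx with hx | rfl | rfl | hx
    exacts [c.2 x (by simp [hc, List.mem_reverse.1 hx]), hb.1.1.mem, hv, c.2 x (by simp [hc, hx])]
  exact (hcr _ ((H.mem_matching_iff ⟨_, hcell⟩ c).2 ⟨p, u, v, s, rfl, hc, hb⟩)).2 rfl

/-- Scanning from the left, the first nonminimal entry either survives, and then splits, or was
eliminated by merging with its predecessor. In both cases the cell is matched; conversely each end
of a matched pair shows a nonminimal entry. -/
theorem Admissible.crit_iff (H : D.Admissible len) (c : D.Cell) :
    D.Crit c ↔ D.MinEntries [] c.1 := by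
  simp only [minEntries_iff, List.append_nil]
  constructor
  · intro hcr p
    induction p with
    | nil =>
      intro w s hc
      exact H.minl_of_crit hcr hc (c.2 w (by simp [hc]))
    | cons u p ih =>
      intro w s hc
      have hc' : c.1 = p.reverse ++ u :: w :: s := by simp [hc]
      refine H.minl_of_crit hcr hc ⟨c.2 w (by simp [hc]), ih u (w :: s) hc', ?_⟩
      rintro ⟨huw, hb⟩
      have hcell : ∀ x ∈ p.reverse ++ (u * w) :: s, x ∈ D.G := by
        intro x hx
        simp only [List.mem_append, List.mem_cons] at hx
        rcases hx with hx | rfl | hx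
        exacts [c.2 x (by simp [hc', List.mem_reverse.1 hx]), huw, c.2 x (by simp [hc', hx])]
      exact (hcr _ ((H.mem_matching_iff c ⟨_, hcell⟩).2 ⟨p, u, w, s, hc', rfl, hb⟩)).1 rfl
  · rintro h ⟨c₁, c₂⟩ he
    obtain ⟨p, u, v, s, h1, h2, hb⟩ := (H.mem_matching_iff c₁ c₂).1 he
    constructor
    · rintro rfl
      exact (h (u :: p) v s (by simp [h1])).1.2.2 ⟨c₂.2 _ (by simp [h2]), hb⟩
    · rintro rfl
      exact (h p _ s h2).2 u (dvd_mul_right _ _)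
        (H.order.ne_mul _ (H.ne_one (c₁.2 v (by simp [h1])))) hb.1.1

end StdMonomials

/-! ### Critical cells of words are fully attached tuples -/

namespace NonComm

open StdMonomials

variable {k : Type u} [Field k] {n : ℕ} {S : Finset (FreeAlgebra k (Fin n))}

theorem dvd_or_dvd_of_mul_eq_mul {a b c d : FreeMonoid (Fin n)} (h : a * b = c * d) :
    a ∣ c ∨ c ∣ a := by
  have h' : a.toList ++ b.toList = c.toList ++ d.toList := congrArg FreeMonoid.toList h
  rcases List.append_eq_append_iff.1 h' with ⟨x, hx, -⟩ | ⟨x, hx, -⟩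
  · exact Or.inl ⟨FreeMonoid.ofList x, FreeMonoid.toList.injective hx⟩
  · exact Or.inr ⟨FreeMonoid.ofList x, FreeMonoid.toList.injective hx⟩

/-- Prefixes of one word are comparable, so a word has at most one minimal prefix in T and the
maximality condition is vacuous. -/
theorem best_of_minl {T : FreeMonoid (Fin n) → Prop} {u : FreeMonoid (Fin n)} (h : Minl T u)
    (v : FreeMonoid (Fin n)) : Best lt T (u * v) u := by
  refine ⟨h, dvd_mul_right _ _, fun u' hu' hd => ?_⟩
  obtain ⟨x, hx⟩ := hd
  have : u = u' := by
    by_contra hne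
    rcases dvd_or_dvd_of_mul_eq_mul hx with hd | hd
    · exact hu'.2 u hd hne h.1
    · exact h.2 u' hd (Ne.symm hne) hu'.1
  rw [this]
  exact isGradedOrder.irrefl u'

/-- `u v` is not standard, but `u q` is standard for each proper prefix `q` of `v`. -/
def Attached (S : Finset (FreeAlgebra k (Fin n))) (u v : FreeMonoid (Fin n)) : Prop :=
  u * v ∉ (std S).G ∧ ∀ q, q ∣ v → q ≠ v → u * q ∈ (std S).G

/-- Since u is automatically the best prefix, survival of w after u just means that u w is not
standard; minimality concerns the prefixes of v. -/
theorem minl_Q_cons_iff {len : FreeMonoid (Fin n) → ℕ} (H : (std S).Admissible len)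
    {p : List (FreeMonoid (Fin n))} {u v : FreeMonoid (Fin n)} (hu : Minl ((std S).Q p) u)
    (hv : v ∈ (std S).G) : Minl ((std S).Q (u :: p)) v ↔ Attached S u v := by
  have hQ : ∀ w, (std S).Q (u :: p) w ↔ w ∈ (std S).G ∧ u * w ∉ (std S).G := fun w => by
    refine and_congr_right fun _ => ⟨fun h h' => h.2 ⟨h', best_of_minl hu w⟩,
      fun h => ⟨hu, fun h' => h h'.1⟩⟩
  simp only [Minl, hQ, Attached, hv, true_and]
  refine and_congr_right fun _ => forall₃_congr fun q hq _ => ?_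
  obtain ⟨x, rfl⟩ := hq
  by_cases h1 : q = 1
  · subst h1
    simp [H.one_notMem, hu.1.mem]
  · simp [H.left_mem q x hv h1]

theorem minEntries_iff_isChain {len : FreeMonoid (Fin n) → ℕ} (H : (std S).Admissible len)
    {p l : List (FreeMonoid (Fin n))} {u : FreeMonoid (Fin n)} (hu : Minl ((std S).Q p) u)
    (hl : ∀ w ∈ l, w ∈ (std S).G) :
    (std S).MinEntries (u :: p) l ↔ (u :: l).IsChain (Attached S) := by
  induction l generalizing u p with
  | nil => simp [MinEntries]
  | cons v l ih =>
    rw [List.forall_mem_cons] at hl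
    rw [MinEntries, List.isChain_cons_cons, minl_Q_cons_iff H hu hl.1]
    exact and_congr_right fun h => ih ((minl_Q_cons_iff H hu hl.1).2 h) hl.2

theorem minl_Q_nil_iff {w : FreeMonoid (Fin n)} (H : (std S).Admissible FreeMonoid.length)
    (hw : w ∈ (std S).G) : Minl ((std S).Q []) w ↔ w.length = 1 := by
  have h0 := H.order.len_pos (H.ne_one hw)
  constructor
  · intro h
    induction w using FreeMonoid.casesOn with
    | one => exact absurd rfl (H.ne_one hw)
    | of_mul x w =>
      by_contra hne
      refine h.2 (FreeMonoid.of x) (dvd_mul_right _ _) (fun h' => hne ?_)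
        (H.left_mem _ w hw (FreeMonoid.of_ne_one x))
      rw [← h', FreeMonoid.length_of]
  · refine fun h => ⟨hw, fun q hd hne hq => ?_⟩
    have h1 := H.order.len_lt_of_dvd hd hne
    have h2 := H.order.len_pos (H.ne_one (w := q) hq)
    omega

theorem crit_iff_isChain (H : (std S).Admissible FreeMonoid.length) (c : (std S).Cell) :
    (std S).Crit c ↔ c.1 = [] ∨ ∃ w l, c.1 = w :: l ∧ w.length = 1 ∧
      (w :: l).IsChain (Attached S) := by
  rw [H.crit_iff]
  rcases hc : c.1 with _ | ⟨w, l⟩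
  · simp [MinEntries]
  · have hw : w ∈ (std S).G := c.2 w (by simp [hc])
    have hl : ∀ x ∈ l, x ∈ (std S).G := fun x hx => c.2 x (by simp [hc, hx])
    simp only [reduceCtorEq, false_or, List.cons.injEq]
    rw [MinEntries]
    constructor
    · rintro ⟨h1, h2⟩
      exact ⟨w, l, ⟨rfl, rfl⟩, (minl_Q_nil_iff H hw).1 h1, (minEntries_iff_isChain H h1 hl).1 h2⟩
    · rintro ⟨_, _, ⟨rfl, rfl⟩, h1, h2⟩
      have h1' := (minl_Q_nil_iff H hw).2 h1
      exact ⟨h1', (minEntries_iff_isChain H h1' hl).2 h2⟩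

theorem exists_minGen {w : FreeMonoid (Fin n)} (hw : w ∉ Groebner.Std coef lt S) :
    ∃ m ∈ Groebner.MinGen coef lt S, Groebner.Factor m w := by
  induction h : w.length using Nat.strong_induction_on generalizing w with
  | _ N ih =>
    by_cases hm : w ∈ Groebner.MinGen coef lt S
    · exact ⟨w, hm, 1, 1, by simp⟩
    · simp only [Groebner.MinGen, Set.mem_ofPred_eq, hw, not_false_eq_true, true_and, not_forall]
        at hm
      obtain ⟨x, ⟨a, b, hab⟩, hne, hx⟩ := hm
      have hl : x.length < w.length := by
        by_contra! hle
        have h1 := congrArg FreeMonoid.length hab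
        simp only [FreeMonoid.length_mul] at h1
        have ha : a = 1 := FreeMonoid.length_eq_zero.1 (by omega)
        have hb : b = 1 := FreeMonoid.length_eq_zero.1 (by omega)
        exact hne (by simp [hab, ha, hb])
      obtain ⟨m, hm, hmx⟩ := ih _ (h ▸ hl) hx rfl
      exact ⟨m, hm, hmx.trans ⟨a, b, hab⟩⟩

theorem Attached.exists_minGen {u v : FreeMonoid (Fin n)} (h : Attached S u v)
    (hu : u ∈ (std S).G) (hv : v ∈ (std S).G) :
    ∃ a b, u = a * b ∧ b ≠ 1 ∧ b * v ∈ Groebner.MinGen coef lt S := by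
  have huv : u * v ∉ Groebner.Std coef lt S := fun h' => h.1 ⟨h', fun h1 => hu.2 ?_⟩
  swap
  · have h2 := congrArg FreeMonoid.length h1
    rw [FreeMonoid.length_mul, FreeMonoid.length_one] at h2
    exact FreeMonoid.length_eq_zero.1 (by omega)
  obtain ⟨m, hm, x, y, hxy⟩ := NonComm.exists_minGen huv
  have hfac : ∀ {w}, w ∈ (std S).G → ¬ Groebner.Factor m w := fun hw hf =>
    hm.1 (Groebner.mem_std_of_factor hw.1 hf)
  -- The generator must reach the end of u v: otherwise it lies in u or in u q for a proper prefix q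
  -- of v, and both are standard.
  have hy : y = 1 := by
    by_contra hy
    rcases dvd_or_dvd_of_mul_eq_mul hxy with ⟨q, hq⟩ | ⟨q, hq⟩
    · have h1 : v = q * y := mul_left_cancel (a := u) (by rw [hxy, hq, mul_assoc])
      refine hfac (h.2 q ⟨y, h1⟩ fun h2 => ?_) ⟨x, 1, by rw [← hq, mul_one]⟩
      rw [h1] at h2
      exact isGradedOrder.ne_mul q hy h2
    · exact hfac hu ⟨x, q, hq⟩
  rw [hy, mul_one] at hxy
  -- It must also begin inside u, for v is standard.
  rcases dvd_or_dvd_of_mul_eq_mul hxy with ⟨q, hq⟩ | ⟨q, hq⟩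
  · refine absurd ⟨q, 1, ?_⟩ (hfac hv)
    rw [hq, mul_assoc] at hxy
    rw [mul_one]
    exact mul_left_cancel hxy
  · rw [hq, mul_assoc] at hxy
    have h1 := mul_left_cancel hxy
    refine ⟨x, q, hq, ?_, h1 ▸ hm⟩
    rintro rfl
    exact hfac hv ⟨1, 1, by rw [← h1]; simp⟩

theorem fullyAttached_iff (c : (std S).Cell) :
    FullyAttached S c ↔ c.1 = [] ∨ ∃ w l, c.1 = w :: l ∧ w.length = 1 ∧
      (w :: l).IsChain (Attached S) := by
  constructor
  · rintro (h | ⟨i, h⟩ | ⟨r, -, u, v, t, hc, hu, hm, hut, hq⟩)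
    · exact Or.inl h
    · exact Or.inr ⟨_, [], h, FreeMonoid.length_of i, List.isChain_singleton _⟩
    refine Or.inr ⟨_, _, hc, hu, ?_⟩
    -- The entries of the tuple indexed from 0, with the product of v j and t j in place j + 1.
    let W : ℕ → FreeMonoid (Fin n) := fun j => Nat.casesOn j (u 0) fun j => v j * t j
    have hW : u 0 :: (List.range r).map (fun j => v j * t j) = (List.range (r + 1)).map W := by
      rw [List.range_succ_eq_map, List.map_cons, List.map_map]
      rfl
    rw [hW, List.isChain_map, List.isChain_range_succ]
    rintro (_ | j) hj
    · change Attached S (u 0) (v 0 * t 0)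
      have hm0 := hm 0 hj
      rw [mul_assoc] at hm0
      refine ⟨fun h => hm0.1 h.1, fun q ⟨x, hx⟩ hne => ⟨hm0.2 _ ⟨1, x, ?_⟩ ?_, ?_⟩⟩
      · rw [one_mul, hx, mul_assoc]
      · exact fun h => hne (mul_left_cancel h)
      · intro h
        have := congrArg FreeMonoid.length h
        rw [FreeMonoid.length_mul, hu, FreeMonoid.length_one] at this
        omega
    · change Attached S (v j * t j) (v (j + 1) * t (j + 1))
      -- The generator starting with u (j + 1) = t j is a suffix of the product of the two adjacent
      -- entries.
      refine ⟨fun h => (hm (j + 1) hj).1 (Groebner.mem_std_of_factor h.1 ⟨v j, 1, ?_⟩), hq j hj⟩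
      rw [hut j hj]
      simp only [mul_assoc, mul_one]
  · rintro (h | ⟨w, l, hc, hw, hch⟩)
    · exact Or.inl h
    rcases Nat.eq_zero_or_pos l.length with hl | hl
    · rw [List.length_eq_zero_iff] at hl
      obtain ⟨i, rfl⟩ := FreeMonoid.length_eq_one.1 hw
      exact Or.inr (Or.inl ⟨i, by rw [hc, hl]⟩)
    set r := l.length with hr
    let W : ℕ → FreeMonoid (Fin n) := fun j => (w :: l).getD j 1
    have hW : ∀ j (h : j < r + 1), W j = (w :: l)[j] := fun j h =>
      List.getD_eq_getElem _ _ (by simpa using h)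
    have hG : ∀ j, j < r + 1 → W j ∈ (std S).G := fun j h => by
      rw [hW j h]
      exact c.2 _ (by rw [hc]; exact List.getElem_mem _)
    have hA : ∀ j, j < r → Attached S (W j) (W (j + 1)) := fun j h => by
      rw [hW j (by omega), hW (j + 1) (by omega)]
      exact List.isChain_iff_getElem.1 hch j (by simp [← hr, h])
    have hab : ∀ j, ∃ a b, j < r → W j = a * b ∧ b ≠ 1 ∧
        b * W (j + 1) ∈ Groebner.MinGen coef lt S := fun j => by
      by_cases h : j < r
      · obtain ⟨a, b, h'⟩ := (hA j h).exists_minGen (hG j (by omega)) (hG (j + 1) (by omega))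
        exact ⟨a, b, fun _ => h'⟩
      · exact ⟨1, 1, fun h' => absurd h' h⟩
    choose a b hab using hab
    -- Entry j + 1 is cut where the generator shared with the next entry begins. The last entry has
    -- no successor, so its t is taken to be 1.
    let v : ℕ → FreeMonoid (Fin n) := fun j => if j + 1 < r then a (j + 1) else W (j + 1)
    let t : ℕ → FreeMonoid (Fin n) := fun j => if j + 1 < r then b (j + 1) else 1
    have hvt : ∀ j, v j * t j = W (j + 1) := fun j => by
      by_cases h : j + 1 < r
      · simp only [v, t, if_pos h]
        exact (hab _ h).1.symm
      · simp only [v, t, if_neg h, mul_one]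
    -- A nonempty suffix of a single letter is that letter.
    have hb0 : b 0 = w := by
      obtain ⟨h1, h2, -⟩ := hab 0 hl
      have h3 : w = a 0 * b 0 := h1
      have h4 := congrArg FreeMonoid.length h3
      have h5 := isGradedOrder.len_pos h2
      rw [FreeMonoid.length_mul, hw] at h4
      have h6 : a 0 = 1 := FreeMonoid.length_eq_zero.1 (by omega)
      rw [h3, h6, one_mul]
    refine Or.inr (Or.inr ⟨r, hl, b, v, t, ?_, ?_, fun j hj => ?_, fun j hj => ?_,
      fun j hj q hd hne => ?_⟩)
    · rw [hc, hb0]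
      congr 1
      refine List.ext_getElem (by simp [hr]) fun j h1 h2 => ?_
      rw [List.getElem_map, List.getElem_range, hvt, hW (j + 1) (by omega),
        List.getElem_cons_succ]
    · rw [hb0, hw]
    · rw [mul_assoc, hvt]
      exact (hab j hj).2.2
    · simp only [t, if_pos hj]
    · rw [hvt] at hd hne ⊢
      exact (hA (j + 1) hj).2 q hd hne

end NonComm

/-! ### Minimality for the two presentations and the main theorem -/

namespace NonComm

variable {k : Type u} [Field k] {n : ℕ} {S : Finset (FreeAlgebra k (Fin n))}

theorem isMinimal (H : (std S).Admissible FreeMonoid.length) (hT : (std S).NoTypeII) :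
    (std S).IsMinimal (maxIdeal S) := by
  have hval : ∀ i, (std S).val (FreeMonoid.of i) = mk S (FreeAlgebra.ι k i) := fun i =>
    congrArg (mk S) (FreeMonoid.lift_eval_of _ _)
  refine H.isMinimal_envIdeal hT
    (fun i => ⟨FreeMonoid.of i, FreeMonoid.of_ne_one i, (hval i).symm⟩) (fun w hw => ?_)
    (fun w hw => ?_)
  · induction w using FreeMonoid.casesOn with
    | one => exact absurd rfl hw
    | of_mul i w => exact ⟨i, w, by rw [map_mul, hval]⟩
  · rcases List.eq_nil_or_concat w.toList with h | ⟨w', i, h⟩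
    · exact absurd (FreeMonoid.toList.injective h) hw
    · refine ⟨i, FreeMonoid.ofList w', ?_⟩
      rw [← hval, ← map_mul]
      exact congrArg _ (FreeMonoid.toList.injective (by simpa using h))

end NonComm

namespace Comm

variable {k : Type u} [Field k] {n : ℕ} {S : Finset (MvPolynomial (Fin n) k)}

theorem isMinimal {len : Multiplicative (Fin n →₀ ℕ) → ℕ} (H : (std S).Admissible len)
    (hT : (std S).NoTypeII) : (std S).IsMinimal (maxIdeal S) := by
  let X : Fin n → Multiplicative (Fin n →₀ ℕ) := fun i =>
    Multiplicative.ofAdd (Finsupp.single i 1)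
  have hval : ∀ i, (std S).val (X i) = mk S (MvPolynomial.X i) := fun i => rfl
  have hX : ∀ w : Multiplicative (Fin n →₀ ℕ), w ≠ 1 → ∃ i w', w = X i * w' := by
    intro w hw
    obtain ⟨i, hi⟩ : ∃ i, w.toAdd i ≠ 0 := by
      by_contra! h
      exact hw (Multiplicative.toAdd.injective (Finsupp.ext h))
    refine ⟨i, Multiplicative.ofAdd (w.toAdd - Finsupp.single i 1), ?_⟩
    exact Multiplicative.toAdd.injective (add_tsub_cancel_of_le
      (Finsupp.single_le_iff.2 (Nat.one_le_iff_ne_zero.2 hi))).symm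
  refine H.isMinimal_envIdeal hT (fun i => ⟨X i, fun h => ?_, (hval i).symm⟩) (fun w hw => ?_)
    (fun w hw => ?_)
  · have := DFunLike.congr_fun (congrArg Multiplicative.toAdd h) i
    simp [X] at this
  · obtain ⟨i, w', rfl⟩ := hX w hw
    exact ⟨i, w', by rw [map_mul, hval]⟩
  · obtain ⟨i, w', rfl⟩ := hX w hw
    exact ⟨i, w', by rw [mul_comm, map_mul, hval]⟩

end Comm

end

theorem mainTheorem9 {k : Type u} [Field k] (n : ℕ) :
    (∀ S : Finset (FreeAlgebra k (Fin n)), NonComm.IsReducedGB S →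
      (NonComm.std S).IsAcyclicMatching ∧
      (∀ c, (NonComm.std S).Crit c ↔ NonComm.FullyAttached S c) ∧
      (NonComm.std S).FinitePaths ∧
      (NonComm.std S).IsFreeResolution ∧
      ((NonComm.std S).NoTypeII → (NonComm.std S).IsMinimal (NonComm.maxIdeal S))) ∧
    (∀ S : Finset (MvPolynomial (Fin n) k), Comm.IsReducedGB S →
      (Comm.std S).IsAcyclicMatching ∧
      (Comm.std S).FinitePaths ∧
      (Comm.std S).IsFreeResolution ∧
      ((Comm.std S).NoTypeII → (Comm.std S).IsMinimal (Comm.maxIdeal S))) := by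
  refine ⟨fun S hS => ?_, fun S hS => ?_⟩
  · have hP := NonComm.isPresentation hS
    -- In the zero algebra 1 is not standard, so `Admissible` fails; there the only cell is the
    -- empty tuple and all modules vanish.
    rcases subsingleton_or_nontrivial (NonComm.Quot S) with hA | hA
    · have hG := hP.G_eq_empty
      refine ⟨StdMonomials.isAcyclicMatching_of_eq_empty hG, fun c => ?_,
        StdMonomials.finitePaths_of_eq_empty hG, StdMonomials.isFreeResolution_of_subsingleton,
        fun _ => StdMonomials.isMinimal_of_subsingleton _⟩
      refine iff_of_true ?_ (Or.inl (StdMonomials.cell_eq_nil hG c))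
      intro e he
      simp [StdMonomials.matching_eq_empty hG] at he
    · have H := hP.admissible NonComm.isGradedOrder
      exact ⟨H.isAcyclicMatching,
        fun c => (NonComm.crit_iff_isChain H c).trans (NonComm.fullyAttached_iff c).symm,
        H.finitePaths, H.isFreeResolution, NonComm.isMinimal H⟩
  · have hP := Comm.isPresentation hS
    rcases subsingleton_or_nontrivial (Comm.Quot S) with hA | hA
    · have hG := hP.G_eq_empty
      exact ⟨StdMonomials.isAcyclicMatching_of_eq_empty hG,
        StdMonomials.finitePaths_of_eq_empty hG, StdMonomials.isFreeResolution_of_subsingleton,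
        fun _ => StdMonomials.isMinimal_of_subsingleton _⟩
    · have H := hP.admissible Comm.isGradedOrder
      exact ⟨H.isAcyclicMatching, H.finitePaths, H.isFreeResolution, Comm.isMinimal H⟩
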